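/- All rings are commutative. For a Noetherian local ring $(R,\mathfrak m)$ of dimension $d$, the multiplicity $e(R)$ is $d!$ times the leading coefficient of the polynomial of degree $d$ that agrees with $n\mapsto \mathrm{len}(R/\mathfrak m^{n+1})$ for $n\gg0$. A prime $\mathfrak p$ of $R$ is analytically unramified if the completion of the local ring $R/\mathfrak p$ has no nonzero nilpotents. A ring is catenary if, for all primes $\mathfrak p\subseteq\mathfrak q$, chains of primes from $\mathfrak p$ to $\mathfrak q$ have bounded length and all saturated ones have the same length. Let $K$ be a field and $r\ge 1$. There exist $z_1,\dots,z_r\in K[[x]]$ that are algebraically independent over $K(x)$. Let $z_i=\sum_k a_{ik}x^k$ $(1\le i\le r)$ be any such power series, and let $m,s,t$ be integers with $m\ge 2$ and $s\ge t>1$. Put $$z_{ij}=\sum_{k\ge j}a_{ik}x^{k-j+1}\ (j>0),\qquad R_0=K[x,\{z_{ij}\}]\subseteq K[[x]],\qquad R_m=R_0[y_1,\dots,y_m],$$ where $y_1,\dots,y_m$ are indeterminates, and $$\mathfrak m_m=(x,y_1,\dots,y_m)R_m,\qquad \mathfrak n_m=(x-1,z_1,\dots,z_r,y_1,\dots,y_m)R_m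 .$$ Let $A_m$ be the localization of $R_m$ at $R_m\smallsetminus(\mathfrak m_m\cup\mathfrak n_m)$, let $f=y_m^s+x^t(x-1)$ and $A=A_m/fA_m$, let $J$ be the Jacobson radical of $A$, and let $R=K+J\subseteq A$. Finally let $P=(x,y_m)A$ and $\mathfrak p=P\cap R$. Then: 1. $A$ is a domain, and $A$ is a finite $R$-module; 2. $R$ is a Noetherian local domain with maximal ideal $J$ and residue field $K$, and $R$ is not catenary; 3. $e(R)=1$; 4. $P$ is a prime ideal of $A$, and $\mathfrak p$ is a non-maximal prime ideal of $R$ which is analytically unramified; 5. $\mathrm{ht}(\mathfrak p)+\dim(R/\mathfrak p)\ne\dim R$; 6. $e(R_{\mathfrak p})=t>1=e(R)$. In particular, for analytically unramified primes $\mathfrak p$ of a local ring $R$ the inequality $e(R_{\mathfrak p})\le e(R)$ can fail when the condition $\mathrm{ht}(\mathfrak p)+\dim(R/\mathfrak p)=\dim R$ is dropped. -/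

import Mathlib

open Polynomial PowerSeries

/-! ### Multiplicities, analytically unramified primes, catenary rings -/

/-- `e` is the Hilbert-Samuel multiplicity `e(𝔞, M)`: with `d = dim M`, the function
`n ↦ len (M / 𝔞 ^ (n + 1) M)` agrees for `n ≫ 0` with a rational polynomial of degree `d`
whose leading coefficient is `e / d!`. -/
def IsHilbertSamuelMultiplicity {R : Type*} [CommRing R] (𝔞 : Ideal R)
    (M : Type*) [AddCommGroup M] [Module R M] (e : ℕ) : Prop :=
  ∃ (d : ℕ) (H : ℚ[X]), Module.supportDim R M = d ∧ H.degree = d ∧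
    (d.factorial : ℚ) * H.leadingCoeff = e ∧
    ∀ᶠ n : ℕ in Filter.atTop, ∃ l : ℕ,
      Module.length R (M ⧸ (𝔞 ^ (n + 1) • (⊤ : Submodule R M))) = l ∧ (l : ℚ) = H.eval (n : ℚ)

/-- The Hilbert-Samuel multiplicity is unique. -/
theorem IsHilbertSamuelMultiplicity.unique {R : Type*} [CommRing R] {𝔞 : Ideal R}
    {M : Type*} [AddCommGroup M] [Module R M] {e e' : ℕ}
    (h : IsHilbertSamuelMultiplicity 𝔞 M e) (h' : IsHilbertSamuelMultiplicity 𝔞 M e') :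
    e = e' := by
  obtain ⟨d, H, hd, -, he, hH⟩ := h
  obtain ⟨d', H', hd', -, he', hH'⟩ := h'
  have hdd : d = d' := by
    have := hd.symm.trans hd'
    exact_mod_cast this
  subst hdd
  have hev : ∀ᶠ n : ℕ in Filter.atTop, H.eval (n : ℚ) = H'.eval (n : ℚ) := by
    filter_upwards [hH, hH'] with n ⟨l, hl, hlH⟩ ⟨l', hl', hlH'⟩
    have : l = l' := by exact_mod_cast hl.symm.trans hl'
    rw [← hlH, ← hlH', this]
  have hinf : Set.Infinite {q : ℚ | H.eval q = H'.eval q} := by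
    obtain ⟨N, hN⟩ := Filter.eventually_atTop.1 hev
    refine ((Set.Ici_infinite N).image (Nat.cast_injective (R := ℚ)).injOn).mono ?_
    rintro _ ⟨n, hn, rfl⟩
    exact hN n hn
  have hHH : H = H' := Polynomial.eq_of_infinite_eval_eq H H' hinf
  subst hHH
  exact_mod_cast he.symm.trans he'

/-- `e(R) = e`: the multiplicity of a local ring with respect to its maximal ideal. -/
def HasMultiplicity (R : Type*) [CommRing R] [IsLocalRing R] (e : ℕ) : Prop :=
  IsHilbertSamuelMultiplicity (IsLocalRing.maximalIdeal R) R e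

/-- A local ring is analytically unramified if its completion has no nonzero nilpotents. -/
def IsAnalyticallyUnramified (R : Type*) [CommRing R] [IsLocalRing R] : Prop :=
  IsReduced (AdicCompletion (IsLocalRing.maximalIdeal R) R)

/-- An ideal `p` (in practice a prime of a local ring) is analytically unramified if the local
ring `R / p` is. -/
def Ideal.IsAnalyticallyUnramifiedIdeal {R : Type*} [CommRing R] (p : Ideal R) : Prop :=
  ∃ _ : IsLocalRing (R ⧸ p), IsAnalyticallyUnramified (R ⧸ p)

/-- A ring is catenary if for all primes `p ⊆ q` the lengths of the chains of primes from `p`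
to `q` are bounded and all saturated chains from `p` to `q` have the same length. -/
def IsCatenaryRing (R : Type*) [CommRing R] : Prop :=
  ∀ p q : PrimeSpectrum R, p ≤ q → ∃ N : ℕ,
    (∀ c : LTSeries (PrimeSpectrum R), c.head = p → c.last = q → c.length ≤ N) ∧
    (∀ c : LTSeries (PrimeSpectrum R), c.head = p → c.last = q →
      (∀ i : Fin c.length, c i.castSucc ⋖ c i.succ) → c.length = N)

/-! ### Nagata's construction

Here `z : Fin r → K⟦X⟧` are the power series `z_1, …, z_r`, the series variable `X` is `x`, and
the polynomial variables are `y_1, …, y_m` with `m = n + 1`, indexed by `Fin (n + 1)`; the last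
one, `Fin.last n`, is `y_m`. -/

namespace Nagata

variable {K : Type*} [Field K] {r : ℕ}

open scoped RatFunc in
/-- `z_1, …, z_r` are algebraically independent over `K(x)`, inside the Laurent series field. -/
def AlgIndep (z : Fin r → K⟦X⟧) : Prop :=
  AlgebraicIndependent (RatFunc K) (A := LaurentSeries K)
    (fun i => HahnSeries.ofPowerSeries ℤ K (z i))

/-- For `w = ∑ a_k x^k` this is `∑_{k ≥ j} a_k x^(k - j + 1)`. -/
noncomputable def tail (w : K⟦X⟧) (j : ℕ) : K⟦X⟧ :=
  PowerSeries.X * PowerSeries.mk fun k => PowerSeries.coeff (k + j) w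

/-- `tail w j = (w - ∑_{k < j} a_k x^k) / x^(j - 1)` for `j > 0`, where `j = i + 1`. -/
theorem X_pow_mul_tail (w : K⟦X⟧) (i : ℕ) :
    PowerSeries.X ^ i * tail w (i + 1) =
      w - ((PowerSeries.trunc (i + 1) w : K[X]) : K⟦X⟧) := by
  have h := PowerSeries.eq_X_pow_mul_shift_add_trunc (i + 1) w
  rw [eq_sub_iff_add_eq]
  conv_rhs => rw [h]
  rw [tail, ← mul_assoc, ← pow_succ]

/-- `R_0 = K[x, {z_{ij}}]`, with `j > 0`, as a subalgebra of `K⟦x⟧`. -/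
noncomputable def R₀sub (z : Fin r → K⟦X⟧) : Subalgebra K K⟦X⟧ :=
  Algebra.adjoin K ({PowerSeries.X} ∪ {w | ∃ (i : Fin r) (j : ℕ), 0 < j ∧ w = tail (z i) j})

theorem X_mem_R₀sub (z : Fin r → K⟦X⟧) : (PowerSeries.X : K⟦X⟧) ∈ R₀sub z :=
  Algebra.subset_adjoin (Or.inl rfl)

theorem z_mem_R₀sub (z : Fin r → K⟦X⟧) (i : Fin r) : z i ∈ R₀sub z := by
  have h := PowerSeries.eq_X_mul_shift_add_const (z i)
  rw [h]
  exact add_mem (Algebra.subset_adjoin (Or.inr ⟨i, 1, one_pos, rfl⟩))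
    ((R₀sub z).algebraMap_mem (PowerSeries.constantCoeff (z i)))

/-- `R_0` as a ring. -/
def R₀ (z : Fin r → K⟦X⟧) : Type _ := R₀sub z

noncomputable instance (z : Fin r → K⟦X⟧) : CommRing (R₀ z) :=
  inferInstanceAs (CommRing (R₀sub z))

noncomputable instance (z : Fin r → K⟦X⟧) : Algebra K (R₀ z) :=
  inferInstanceAs (Algebra K (R₀sub z))

/-- `R_m = R_0[y_1, …, y_m]`, where `m = n + 1`. -/
abbrev Rm (z : Fin r → K⟦X⟧) (n : ℕ) : Type _ := MvPolynomial (Fin (n + 1)) (R₀ z)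

/-- The element `x` of `R_m`. -/
noncomputable def x (z : Fin r → K⟦X⟧) (n : ℕ) : Rm z n :=
  MvPolynomial.C ⟨PowerSeries.X, X_mem_R₀sub z⟩

/-- The element `z_i` of `R_m`. -/
noncomputable def zel (z : Fin r → K⟦X⟧) (n : ℕ) (i : Fin r) : Rm z n :=
  MvPolynomial.C ⟨z i, z_mem_R₀sub z i⟩

/-- The element `y_i` of `R_m`. -/
noncomputable def y (z : Fin r → K⟦X⟧) (n : ℕ) (i : Fin (n + 1)) : Rm z n :=
  MvPolynomial.X i

/-- `𝔪_m = (x, y_1, …, y_m) R_m`. -/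
noncomputable def 𝔪 (z : Fin r → K⟦X⟧) (n : ℕ) : Ideal (Rm z n) :=
  Ideal.span ({x z n} ∪ Set.range (y z n))

/-- `𝔫_m = (x - 1, z_1, …, z_r, y_1, …, y_m) R_m`. -/
noncomputable def 𝔫 (z : Fin r → K⟦X⟧) (n : ℕ) : Ideal (Rm z n) :=
  Ideal.span ({x z n - 1} ∪ Set.range (zel z n) ∪ Set.range (y z n))

/-- The multiplicative set `S_m = R_m ∖ (𝔪_m ∪ 𝔫_m)`. The closure only spares the definition a
proof that `𝔪_m` and `𝔫_m` are prime, see `coe_closure_compl_union`. -/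
noncomputable def S (z : Fin r → K⟦X⟧) (n : ℕ) : Submonoid (Rm z n) :=
  Submonoid.closure ((𝔪 z n : Set (Rm z n)) ∪ (𝔫 z n : Set (Rm z n)))ᶜ

/-- The complement of a union of two primes is already multiplicatively closed. -/
theorem coe_closure_compl_union {B : Type*} [CommRing B] (I I' : Ideal B) [I.IsPrime]
    [I'.IsPrime] :
    (Submonoid.closure ((I : Set B) ∪ (I' : Set B))ᶜ : Set B) = ((I : Set B) ∪ (I' : Set B))ᶜ := by
  have h : ((I : Set B) ∪ (I' : Set B))ᶜ = (I.primeCompl ⊓ I'.primeCompl : Submonoid B) := by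
    ext a
    simp [Ideal.primeCompl]
  rw [h, Submonoid.closure_eq]

/-- The semilocal ring `A_m`, the localization of `R_m` at `S_m`. -/
def Am (z : Fin r → K⟦X⟧) (n : ℕ) : Type _ := Localization (S z n)

section AmInstances

variable (z : Fin r → K⟦X⟧) (n : ℕ)

noncomputable instance : CommRing (Am z n) := inferInstanceAs (CommRing (Localization (S z n)))

noncomputable instance : Algebra (Rm z n) (Am z n) :=
  inferInstanceAs (Algebra (Rm z n) (Localization (S z n)))

noncomputable instance : Algebra K (Am z n) :=
  inferInstanceAs (Algebra K (Localization (S z n)))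

instance : IsScalarTower K (Rm z n) (Am z n) :=
  inferInstanceAs (IsScalarTower K (Rm z n) (Localization (S z n)))

instance : IsLocalization (S z n) (Am z n) :=
  inferInstanceAs (IsLocalization (S z n) (Localization (S z n)))

end AmInstances

/-- `f = y_m ^ s + x ^ t (x - 1)` in `A_m`. -/
noncomputable def f (z : Fin r → K⟦X⟧) (n s t : ℕ) : Am z n :=
  algebraMap (Rm z n) (Am z n) (y z n (Fin.last n) ^ s + x z n ^ t * (x z n - 1))

/-- `A = A_m / f A_m`. -/
def A (z : Fin r → K⟦X⟧) (n s t : ℕ) : Type _ := Am z n ⧸ Ideal.span {f z n s t}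

section AInstances

variable (z : Fin r → K⟦X⟧) (n s t : ℕ)

noncomputable instance : CommRing (A z n s t) :=
  inferInstanceAs (CommRing (Am z n ⧸ Ideal.span {f z n s t}))

noncomputable instance : Algebra (Am z n) (A z n s t) :=
  inferInstanceAs (Algebra (Am z n) (Am z n ⧸ Ideal.span {f z n s t}))

noncomputable instance : Algebra K (A z n s t) :=
  inferInstanceAs (Algebra K (Am z n ⧸ Ideal.span {f z n s t}))

instance : IsScalarTower K (Am z n) (A z n s t) :=
  inferInstanceAs (IsScalarTower K (Am z n) (Am z n ⧸ Ideal.span {f z n s t}))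

end AInstances

/-- The canonical map `R_m → A`. -/
noncomputable def toA (z : Fin r → K⟦X⟧) (n s t : ℕ) : Rm z n →+* A z n s t :=
  (algebraMap (Am z n) (A z n s t)).comp (algebraMap (Rm z n) (Am z n))

/-- The subring `K + J` of a `K`-algebra `B`, where `J` is the Jacobson radical of `B`. -/
def scalarsAddJacobson (K : Type*) [Field K] (B : Type*) [CommRing B] [Algebra K B] :
    Subalgebra K B where
  carrier := {b | ∃ c : K, ∃ j ∈ Ideal.jacobson (⊥ : Ideal B), b = algebraMap K B c + j}
  mul_mem' := by
    rintro _ _ ⟨c, j, hj, rfl⟩ ⟨c', j', hj', rfl⟩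
    refine ⟨c * c', algebraMap K B c * j' + (algebraMap K B c' + j') * j, ?_, ?_⟩
    · exact add_mem (Ideal.mul_mem_left _ _ hj') (Ideal.mul_mem_left _ _ hj)
    · rw [map_mul]; ring
  add_mem' := by
    rintro _ _ ⟨c, j, hj, rfl⟩ ⟨c', j', hj', rfl⟩
    exact ⟨c + c', j + j', add_mem hj hj', by rw [map_add]; ring⟩
  algebraMap_mem' c := ⟨c, 0, zero_mem _, by simp⟩

/-- `R = K + J`, where `J` is the Jacobson radical of `A`. -/
def R (z : Fin r → K⟦X⟧) (n s t : ℕ) : Type _ := scalarsAddJacobson K (A z n s t)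

section RInstances

variable (z : Fin r → K⟦X⟧) (n s t : ℕ)

noncomputable instance : CommRing (R z n s t) :=
  inferInstanceAs (CommRing (scalarsAddJacobson K (A z n s t)))

noncomputable instance : Algebra K (R z n s t) :=
  inferInstanceAs (Algebra K (scalarsAddJacobson K (A z n s t)))

noncomputable instance : Algebra (R z n s t) (A z n s t) :=
  inferInstanceAs (Algebra (scalarsAddJacobson K (A z n s t)) (A z n s t))

instance : IsScalarTower K (R z n s t) (A z n s t) :=
  inferInstanceAs (IsScalarTower K (scalarsAddJacobson K (A z n s t)) (A z n s t))

end RInstances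

/-- `P = (x, y_m) A`. -/
noncomputable def P (z : Fin r → K⟦X⟧) (n s t : ℕ) : Ideal (A z n s t) :=
  Ideal.span {toA z n s t (x z n), toA z n s t (y z n (Fin.last n))}

/-- `p = P ∩ R`. -/
noncomputable def p (z : Fin r → K⟦X⟧) (n s t : ℕ) : Ideal (R z n s t) :=
  (P z n s t).comap (algebraMap (R z n s t) (A z n s t))

end Nagata

/-! Write `m = n + 1`. The ring `A` has exactly two maximal ideals, both with residue field `K`, and
`R = K + J` glues the two points into one. The points have different dimensions. At `x = 0` every
tail `z_{ij}` is a multiple of `x`, so `R_0` localized at `x` is a discrete valuation ring and the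
`z_i` contribute nothing. At `x = 1` the element `x` is invertible, `R_0[1/x] = K[x, 1/x, z_1, …,
z_r]`, and the `z_i` are `r` further coordinates. So the branch of `A` above `𝔪_m` has dimension `n
+ 1` and the branch above `𝔫_m` has dimension `r + n + 1`, which is also `dim R`. At `𝔪_m` the
factor `x - 1` is a unit, and `f` has order `t` because `t ≤ s`. At `𝔫_m` the factor `x - 1` is a
coordinate occurring linearly, so `f` has order 1. The Hilbert function of `R` is the sum of those
of the two branches minus 1 (`finite_and_finrank_quotient_maximalIdeal_R_pow`). Only the larger
branch reaches the leading term, whence `e(R) = 1`. The prime `P = (x, y_m)` lies on the small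
branch only. There `R / p = A / P` has the coordinates `y_1, …, y_n`, so it is analytically
unramified of dimension at most `n`. Since `y_1 ∈ J` lies outside `P` and carries `A` into `R`,
localizing at `p` identifies `R_p` with `A_P`. This is the local ring of the plane curve `y^s + x^t
(x - 1)` over `K(y_1, …, y_n)`, of multiplicity `t`. As `ht p = 1`, the sum `ht p + dim R/p ≤ n + 1`
is smaller than `dim R`, which in a local domain also excludes being catenary
(`not_isCatenaryRing_of_height_add_lt`). Colengths are computed without passing to completions. If a
ring has a coefficient field, coordinates `b_i` and a map to `κ⟦X⟧ / (F)` sending `b_i` to `X_i`,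
where `F` is a polynomial vanishing at `b`, then truncating power series shows that powers of
`(b_i)` are detected by the order (`mem_span_range_pow_iff`). Their colengths then follow from
`finrank_quotient_span_sup_orderIdeal`. The maps needed at `𝔫_m` exist by `R₀.exists_algHom`, where
the algebraic independence of the `z_i` enters. -/

/-! ### Hilbert functions of hypersurfaces in power series rings -/

namespace MvPowerSeries

section OrderIdeal

variable (σ κ : Type*) [Field κ]

/-- The ideal of power series of order at least `k`. -/
noncomputable def orderIdeal (k : ℕ) : Ideal (MvPowerSeries σ κ) where
  carrier := {w | (k : ℕ∞) ≤ w.order}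
  add_mem' ha hb := (le_min ha hb).trans min_order_le_add
  zero_mem' := by simp
  smul_mem' a b hb := by
    rw [smul_eq_mul]
    exact (hb.trans le_add_self).trans le_order_mul

variable {σ κ}

theorem mem_orderIdeal {k : ℕ} {w : MvPowerSeries σ κ} :
    w ∈ orderIdeal σ κ k ↔ (k : ℕ∞) ≤ w.order := Iff.rfl

theorem mem_orderIdeal_iff_coeff {k : ℕ} {w : MvPowerSeries σ κ} :
    w ∈ orderIdeal σ κ k ↔ ∀ d : σ →₀ ℕ, d.degree < k → coeff d w = 0 :=
  ⟨fun h _ hd => coeff_of_lt_order ((Nat.cast_lt.2 hd).trans_le h), fun h => nat_le_order h⟩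

theorem X_mem_orderIdeal_one (i : σ) : (X i : MvPowerSeries σ κ) ∈ orderIdeal σ κ 1 := by
  rw [mem_orderIdeal, Nat.cast_one, one_le_order_iff_constCoeff_eq_zero]
  simp

theorem orderIdeal_one_pow_le (k : ℕ) : orderIdeal σ κ 1 ^ k ≤ orderIdeal σ κ k := by
  induction k with
  | zero => intro w _; simp [mem_orderIdeal]
  | succ k ih =>
    rw [pow_succ]
    refine Ideal.mul_le.2 fun a ha b hb => ?_
    rw [mem_orderIdeal, order_mul]
    push_cast
    exact add_le_add (ih ha) (by simpa [mem_orderIdeal] using hb)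

theorem sub_truncTotal_mem_orderIdeal [Finite σ] (k : ℕ) (w : MvPowerSeries σ κ) :
    w - ((truncTotal k w : MvPolynomial σ κ) : MvPowerSeries σ κ) ∈ orderIdeal σ κ k := by
  rw [mem_orderIdeal_iff_coeff]
  intro d hd
  rw [map_sub, MvPolynomial.coeff_coe, coeff_truncTotal _ hd, sub_self]

variable [Fintype σ]

/-- Homogenization: a slack variable `none` takes the missing degree, so exponents of degree at most
`k` become exponents of degree exactly `k` in one more variable. -/
theorem card_setOf_degree_lt_succ (k : ℕ) :
    Nat.card {d : σ →₀ ℕ // d.degree < k + 1} =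
      (k + Fintype.card σ).choose (Fintype.card σ) := by
  classical
  have e : {d : σ →₀ ℕ // d.degree < k + 1} ≃
      (Finset.univ : Finset (Option σ)).finsuppAntidiag k :=
    { toFun := fun d => ⟨d.1.optionElim (k - d.1.degree), by
        have := d.2
        rw [Finset.mem_finsuppAntidiag]
        refine ⟨?_, by simp⟩
        rw [Fintype.sum_option]
        have h2 : ∑ i, d.1 i = d.1.degree := by
          rw [Finsupp.degree_eq_sum]
        simp [h2]
        omega⟩
      invFun := fun d => ⟨d.1.some, by
        have := (Finset.mem_finsuppAntidiag.1 d.2).1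
        rw [Fintype.sum_option] at this
        rw [Finsupp.degree_eq_sum]
        simp
        omega⟩
      left_inv := fun d => by
        ext i
        simp
      right_inv := fun d => by
        have := (Finset.mem_finsuppAntidiag.1 d.2).1
        rw [Fintype.sum_option] at this
        ext i
        cases i with
        | none => simp [Finsupp.degree_eq_sum]; omega
        | some i => simp }
  rw [Nat.card_congr e, Nat.card_eq_fintype_card, Fintype.card_coe,
    Finset.card_finsuppAntidiag_nat_eq_choose, Finset.card_univ, Fintype.card_option,
    show Fintype.card σ + 1 + k - 1 = k + Fintype.card σ by omega]
  rw [← Nat.choose_symm (by omega)]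
  congr 1
  omega

theorem finite_setOf_degree_lt (k : ℕ) : Finite {d : σ →₀ ℕ // d.degree < k} := by
  cases k with
  | zero => exact @Finite.of_subsingleton _ ⟨fun d => absurd d.2 (Nat.not_lt_zero _)⟩
  | succ k =>
    -- `Nat.card` is 0 on infinite types, so a positive count proves finiteness.
    apply Nat.finite_of_card_ne_zero
    rw [card_setOf_degree_lt_succ]
    exact (Nat.choose_pos (by omega)).ne'

/-- The quotient by the power series of order at least `k` is spanned by the monomials of degree
less than `k`. -/
noncomputable def quotientOrderIdealEquiv (k : ℕ) :
    (MvPowerSeries σ κ ⧸ (orderIdeal σ κ k).restrictScalars κ) ≃ₗ[κ]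
      ({d : σ →₀ ℕ // d.degree < k} → κ) :=
  (Submodule.quotEquivOfEq _ _ (by
    ext w
    simp only [Submodule.restrictScalars_mem, mem_orderIdeal_iff_coeff, LinearMap.mem_ker]
    constructor
    · intro h
      funext d
      exact h d.1 d.2
    · intro h d hd
      exact congrFun h ⟨d, hd⟩)).trans
  (LinearMap.quotKerEquivOfSurjective
    (LinearMap.pi fun d : {d : σ →₀ ℕ // d.degree < k} => (coeff d.1 : MvPowerSeries σ κ →ₗ[κ] κ))
    (fun v => by
      classical
      refine ⟨(fun d => if h : d.degree < k then v ⟨d, h⟩ else 0 : (σ →₀ ℕ) → κ), ?_⟩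
      funext d
      exact dif_pos d.2))

instance (k : ℕ) :
    Module.Finite κ (MvPowerSeries σ κ ⧸ (orderIdeal σ κ k).restrictScalars κ) :=
  have := finite_setOf_degree_lt (σ := σ) k
  Module.Finite.equiv (quotientOrderIdealEquiv k).symm

theorem finrank_quotient_orderIdeal (k : ℕ) :
    Module.finrank κ (MvPowerSeries σ κ ⧸ (orderIdeal σ κ (k + 1)).restrictScalars κ) =
      (k + Fintype.card σ).choose (Fintype.card σ) := by
  have := finite_setOf_degree_lt (σ := σ) (k + 1)
  have := Fintype.ofFinite {d : σ →₀ ℕ // d.degree < k + 1}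
  rw [(quotientOrderIdealEquiv (k + 1)).finrank_eq, Module.finrank_pi,
    ← card_setOf_degree_lt_succ, Nat.card_eq_fintype_card]

/-- The Hilbert function of the hypersurface `F = 0` of order `t`. -/
theorem finrank_quotient_span_sup_orderIdeal {F : MvPowerSeries σ κ} {t k : ℕ} (hF : F.order = t)
    (htk : t ≤ k) :
    Module.finrank κ
        (MvPowerSeries σ κ ⧸ (Ideal.span {F} ⊔ orderIdeal σ κ (k + 1)).restrictScalars κ) +
        (k - t + Fintype.card σ).choose (Fintype.card σ) =
      (k + Fintype.card σ).choose (Fintype.card σ) := by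
  set O := (orderIdeal σ κ (k + 1)).restrictScalars κ with hO
  set O' := (orderIdeal σ κ (k - t + 1)).restrictScalars κ with hO'
  -- Order is additive over a field, so multiplication by `F` shifts it by exactly `t`.
  have hmul : ∀ g, F * g ∈ orderIdeal σ κ (k + 1) ↔ g ∈ orderIdeal σ κ (k - t + 1) := by
    intro g
    have : ((k + 1 : ℕ) : ℕ∞) = t + (k - t + 1 : ℕ) := by
      rw [← Nat.cast_add]; congr 1; omega
    rw [mem_orderIdeal, mem_orderIdeal, order_mul, hF, this]
    exact ENat.add_le_add_iff_left (ENat.natCast_ne_top t)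
  -- Multiplication by `F` into the quotient by `O`: its kernel is `O'`, its image is `((F) + O) /
  -- O`. The dimension of the image is what passing to `F = 0` removes.
  let μ : MvPowerSeries σ κ →ₗ[κ] MvPowerSeries σ κ ⧸ O := O.mkQ ∘ₗ LinearMap.mulLeft κ F
  have hker : LinearMap.ker μ = O' := by
    ext g
    simp only [μ, LinearMap.mem_ker, LinearMap.comp_apply, Submodule.mkQ_apply,
      Submodule.Quotient.mk_eq_zero, LinearMap.mulLeft_apply, hO, hO',
      Submodule.restrictScalars_mem, hmul]
  have hrange : LinearMap.range μ =
      Submodule.map O.mkQ ((Ideal.span {F} ⊔ orderIdeal σ κ (k + 1)).restrictScalars κ) := by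
    ext w
    constructor
    · rintro ⟨g, rfl⟩
      exact ⟨F * g, (Ideal.mem_sup_left (Ideal.mul_mem_right _ _ (Ideal.mem_span_singleton_self _))),
        rfl⟩
    · rintro ⟨v, hv, rfl⟩
      obtain ⟨a, ha, b, hb, rfl⟩ := Submodule.mem_sup.1 hv
      obtain ⟨g, rfl⟩ := Ideal.mem_span_singleton'.1 ha
      refine ⟨g, ?_⟩
      simp only [μ, LinearMap.comp_apply, LinearMap.mulLeft_apply, map_add]
      rw [(Submodule.Quotient.mk_eq_zero O (x := b)).2 hb |> fun h => (h : O.mkQ b = 0), add_zero,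
        mul_comm]
  have h1 := Submodule.finrank_quotient_add_finrank (LinearMap.range μ)
  have h2 : Module.finrank κ (LinearMap.range μ) =
      (k - t + Fintype.card σ).choose (Fintype.card σ) := by
    rw [← finrank_quotient_orderIdeal (κ := κ), ← (LinearMap.quotKerEquivRange μ).finrank_eq]
    exact (Submodule.quotEquivOfEq _ _ hker).finrank_eq
  rw [h2, finrank_quotient_orderIdeal] at h1
  rw [← h1]
  congr 1
  rw [hrange]
  refine ((Submodule.quotientQuotientEquivQuotient O _ ?_).finrank_eq).symm
  intro w hw
  exact Ideal.mem_sup_right hw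

end OrderIdeal

end MvPowerSeries

/-! ### Local rings with a coefficient field that embed into a hypersurface -/

section Coordinates

variable {σ κ L : Type*} [Field κ] [CommRing L] [Algebra κ L] {b : σ → L}

open MvPowerSeries (orderIdeal mem_orderIdeal mem_orderIdeal_iff_coeff truncTotal)

theorem MvPolynomial.aeval_mem_span_range_pow {q : MvPolynomial σ κ} {k : ℕ}
    (hq : (q : MvPowerSeries σ κ) ∈ orderIdeal σ κ k) :
    MvPolynomial.aeval b q ∈ Ideal.span (Set.range b) ^ k := by
  rw [q.as_sum, map_sum]
  refine sum_mem fun d hd => ?_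
  rw [MvPolynomial.aeval_monomial]
  refine Ideal.mul_mem_left _ _ ?_
  have hk : k ≤ d.degree := by
    by_contra! h
    exact MvPolynomial.mem_support_iff.1 hd
      (by simpa using mem_orderIdeal_iff_coeff.1 hq d h)
  refine Ideal.pow_le_pow_right hk ?_
  rw [Finsupp.prod, Finsupp.degree_apply, ← Finset.prod_pow_eq_pow_sum]
  exact Ideal.prod_mem_prod fun i _ => Ideal.pow_mem_pow (Ideal.subset_span (Set.mem_range_self i)) _

/-- Taylor expansion: split off the constant term, write the rest as a combination of the `b i`, and
expand its coefficients to one order less. -/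
theorem exists_sub_aeval_mem_span_range_pow [Fintype σ]
    (hL : ∀ a : L, ∃ c : κ, a - algebraMap κ L c ∈ Ideal.span (Set.range b)) (k : ℕ) (a : L) :
    ∃ q : MvPolynomial σ κ, a - MvPolynomial.aeval b q ∈ Ideal.span (Set.range b) ^ k := by
  induction k generalizing a with
  | zero => exact ⟨0, by simp⟩
  | succ k ih =>
    obtain ⟨c, hc⟩ := hL a
    obtain ⟨v, hv⟩ := Ideal.mem_span_range_iff_exists_fun.1 hc
    choose q hq using fun i => ih (v i)
    refine ⟨MvPolynomial.C c + ∑ i, q i * MvPolynomial.X i, ?_⟩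
    have : a - MvPolynomial.aeval b (MvPolynomial.C c + ∑ i, q i * MvPolynomial.X i) =
        ∑ i, (v i - MvPolynomial.aeval b (q i)) * b i := by
      simp only [map_add, map_sum, map_mul, MvPolynomial.aeval_X, MvPolynomial.aeval_C, sub_mul,
        Finset.sum_sub_distrib, hv]
      ring
    rw [this, pow_succ]
    exact sum_mem fun i _ => Ideal.mul_mem_mul (hq i) (Ideal.subset_span ⟨i, rfl⟩)

variable {F : MvPolynomial σ κ}
  (Φ : L →ₐ[κ] MvPowerSeries σ κ ⧸ Ideal.span {(F : MvPowerSeries σ κ)})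

theorem AlgHom.apply_aeval_eq_mk (hΦ : ∀ i, Φ (b i) = Ideal.Quotient.mk _ (MvPowerSeries.X i))
    (q : MvPolynomial σ κ) :
    Φ (MvPolynomial.aeval b q) = Ideal.Quotient.mk _ (q : MvPowerSeries σ κ) := by
  have : Φ.comp (MvPolynomial.aeval b) =
      (Ideal.Quotient.mkₐ κ (Ideal.span {(F : MvPowerSeries σ κ)})).comp
        (MvPolynomial.coeToMvPowerSeries.algHom κ) := by
    ext i
    simp [hΦ]
  simpa using DFunLike.congr_fun this q

/-- The powers of an ideal generated by coordinates are detected by the order of power series. -/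
theorem mem_span_range_pow_iff [Fintype σ]
    (hL : ∀ a : L, ∃ c : κ, a - algebraMap κ L c ∈ Ideal.span (Set.range b))
    (hF : MvPolynomial.aeval b F = 0)
    (hΦ : ∀ i, Φ (b i) = Ideal.Quotient.mk _ (MvPowerSeries.X i)) {k : ℕ} {a : L} :
    a ∈ Ideal.span (Set.range b) ^ k ↔
      Φ a ∈ (orderIdeal σ κ k).map (Ideal.Quotient.mk (Ideal.span {(F : MvPowerSeries σ κ)})) := by
  have h1 : ∀ a ∈ Ideal.span (Set.range b) ^ k,
      Φ a ∈ (orderIdeal σ κ k).map (Ideal.Quotient.mk (Ideal.span {(F : MvPowerSeries σ κ)})) := by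
    intro a ha
    have h2 := Ideal.mem_map_of_mem Φ ha
    rw [Ideal.map_pow] at h2
    have h3 : (Ideal.span (Set.range b)).map Φ ≤ (orderIdeal σ κ 1).map
        (Ideal.Quotient.mk (Ideal.span {(F : MvPowerSeries σ κ)})) := by
      rw [Ideal.map_span, Ideal.span_le]
      rintro _ ⟨_, ⟨i, rfl⟩, rfl⟩
      rw [hΦ]
      exact Ideal.mem_map_of_mem _ (MvPowerSeries.X_mem_orderIdeal_one i)
    have h4 := Ideal.pow_right_mono h3 k h2
    rw [← Ideal.map_pow] at h4
    exact Ideal.map_mono (MvPowerSeries.orderIdeal_one_pow_le k) h4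
  refine ⟨h1 a, fun ha => ?_⟩
  obtain ⟨q, hq⟩ := exists_sub_aeval_mem_span_range_pow hL k a
  have h2 := sub_mem ha (h1 _ hq)
  rw [map_sub, sub_sub_cancel, AlgHom.apply_aeval_eq_mk Φ hΦ, Ideal.mem_quotient_iff_mem_sup] at h2
  obtain ⟨o, ho, w, hw, how⟩ := Submodule.mem_sup.1 h2
  obtain ⟨g, rfl⟩ := Ideal.mem_span_singleton'.1 hw
  -- The cofactor `g` is only a power series. Replacing it by its truncation costs terms of order at
  -- least `k` and leaves a polynomial multiple of `F`, which vanishes at `b`.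
  have h5 : ((q - truncTotal k g * F : MvPolynomial σ κ) : MvPowerSeries σ κ) ∈
      orderIdeal σ κ k := by
    have : ((q - truncTotal k g * F : MvPolynomial σ κ) : MvPowerSeries σ κ) =
        o + (g - (truncTotal k g : MvPolynomial σ κ)) * F := by
      have : ((q - truncTotal k g * F : MvPolynomial σ κ) : MvPowerSeries σ κ) =
          (q : MvPowerSeries σ κ) - (truncTotal k g : MvPolynomial σ κ) * F := by
        have := map_sub (MvPolynomial.coeToMvPowerSeries.ringHom (σ := σ) (R := κ)) q
          (truncTotal k g * F)
        simpa using this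
      rw [this, ← how]
      ring
    rw [this]
    exact add_mem ho (Ideal.mul_mem_right _ _ (MvPowerSeries.sub_truncTotal_mem_orderIdeal k g))
  have h6 := MvPolynomial.aeval_mem_span_range_pow (b := b) h5
  rw [map_sub, map_mul, hF, mul_zero, sub_zero] at h6
  simpa using add_mem hq h6

/-- The powers of the ideal generated by the coordinates of a hypersurface have the same
colength as in the power series ring. -/
noncomputable def quotientSpanRangePowEquiv [Fintype σ]
    (hL : ∀ a : L, ∃ c : κ, a - algebraMap κ L c ∈ Ideal.span (Set.range b))
    (hF : MvPolynomial.aeval b F = 0)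
    (hΦ : ∀ i, Φ (b i) = Ideal.Quotient.mk _ (MvPowerSeries.X i)) (k : ℕ) :
    (L ⧸ (Ideal.span (Set.range b) ^ k).restrictScalars κ) ≃ₗ[κ]
      MvPowerSeries σ κ ⧸ (Ideal.span {(F : MvPowerSeries σ κ)} ⊔
        orderIdeal σ κ k).restrictScalars κ := by
  let I := Ideal.span {(F : MvPowerSeries σ κ)}
  let O := ((orderIdeal σ κ k).map (Ideal.Quotient.mk I)).restrictScalars κ
  refine (Submodule.quotEquivOfEq _ (LinearMap.ker (O.mkQ ∘ₗ Φ.toLinearMap)) ?_).trans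
    ((LinearMap.quotKerEquivOfSurjective (O.mkQ ∘ₗ Φ.toLinearMap) ?_).trans
    (((LinearMap.quotKerEquivOfSurjective
      (O.mkQ ∘ₗ (Ideal.Quotient.mkₐ κ I).toLinearMap) ?_).symm).trans
      (Submodule.quotEquivOfEq _ _ ?_)))
  · ext a
    simp only [Submodule.restrictScalars_mem, LinearMap.mem_ker, LinearMap.comp_apply,
      Submodule.mkQ_apply, Submodule.Quotient.mk_eq_zero, AlgHom.toLinearMap_apply, O]
    exact mem_span_range_pow_iff Φ hL hF hΦ
  · intro w
    obtain ⟨w, rfl⟩ := O.mkQ_surjective w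
    obtain ⟨w, rfl⟩ := Ideal.Quotient.mk_surjective w
    -- Modulo order `k` every power series is a polynomial, and polynomials are reached from `L`.
    refine ⟨MvPolynomial.aeval b (truncTotal k w), ?_⟩
    rw [LinearMap.comp_apply, AlgHom.toLinearMap_apply, AlgHom.apply_aeval_eq_mk Φ hΦ,
      ← sub_eq_zero, ← map_sub, ← map_sub, Submodule.mkQ_apply, Submodule.Quotient.mk_eq_zero,
      ← neg_mem_iff, ← map_neg, neg_sub]
    exact Ideal.mem_map_of_mem _ (MvPowerSeries.sub_truncTotal_mem_orderIdeal k w)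
  · exact (O.mkQ_surjective).comp (Ideal.Quotient.mk_surjective)
  · ext w
    simp only [Submodule.restrictScalars_mem, LinearMap.mem_ker, LinearMap.comp_apply,
      Submodule.mkQ_apply, Submodule.Quotient.mk_eq_zero, AlgHom.toLinearMap_apply, O,
      Ideal.Quotient.mkₐ_eq_mk]
    rw [Ideal.mem_quotient_iff_mem_sup, sup_comm]

theorem finite_quotient_span_range_pow [Fintype σ]
    (hL : ∀ a : L, ∃ c : κ, a - algebraMap κ L c ∈ Ideal.span (Set.range b))
    (hF : MvPolynomial.aeval b F = 0)
    (hΦ : ∀ i, Φ (b i) = Ideal.Quotient.mk _ (MvPowerSeries.X i)) (k : ℕ) :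
    Module.Finite κ (L ⧸ (Ideal.span (Set.range b) ^ k).restrictScalars κ) := by
  have : Module.Finite κ (MvPowerSeries σ κ ⧸ (Ideal.span {(F : MvPowerSeries σ κ)} ⊔
        orderIdeal σ κ k).restrictScalars κ) :=
    Module.Finite.of_surjective (Submodule.factor (p := (orderIdeal σ κ k).restrictScalars κ)
      (p' := (Ideal.span {(F : MvPowerSeries σ κ)} ⊔ orderIdeal σ κ k).restrictScalars κ)
      (fun w hw => Ideal.mem_sup_right hw)) (Submodule.factor_surjective _)
  exact Module.Finite.equiv (quotientSpanRangePowEquiv Φ hL hF hΦ k).symm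

theorem finrank_quotient_span_range_pow [Fintype σ]
    (hL : ∀ a : L, ∃ c : κ, a - algebraMap κ L c ∈ Ideal.span (Set.range b))
    (hF : MvPolynomial.aeval b F = 0)
    (hΦ : ∀ i, Φ (b i) = Ideal.Quotient.mk _ (MvPowerSeries.X i)) {t k : ℕ}
    (ht : (F : MvPowerSeries σ κ).order = t) (htk : t ≤ k) :
    Module.finrank κ (L ⧸ (Ideal.span (Set.range b) ^ (k + 1)).restrictScalars κ) +
        (k - t + Fintype.card σ).choose (Fintype.card σ) =
      (k + Fintype.card σ).choose (Fintype.card σ) := by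
  rw [(quotientSpanRangePowEquiv Φ hL hF hΦ (k + 1)).finrank_eq]
  exact MvPowerSeries.finrank_quotient_span_sup_orderIdeal ht htk

end Coordinates

/-! ### Auxiliary results of commutative algebra -/

/-! ### Reducedness of completions. -/

/-- A square-zero `α` has at level `2k + 1` a representative `a` with `a ^ 2 ∈ I ^ (2k + 1)`. The
hypothesis then places `a` in `I ^ (k + 1)`, so `α` vanishes at level `k + 1` and below. -/
theorem AdicCompletion.isReduced_of_forall_sq_mem {B : Type*} [CommRing B] (I : Ideal B)
    (h : ∀ (k : ℕ) (a : B), a ^ 2 ∈ I ^ (2 * k + 1) → a ∈ I ^ (k + 1)) :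
    IsReduced (AdicCompletion I B) := by
  refine (isReduced_iff_pow_one_lt 2 one_lt_two).2 fun α hα => ?_
  refine AdicCompletion.ext fun k => ?_
  obtain ⟨a, ha⟩ := Submodule.mkQ_surjective _ (α.val (2 * k + 1))
  have h1 : a ^ 2 ∈ I ^ (2 * k + 1) := by
    have := congrArg (fun β => β.val (2 * k + 1)) hα
    simp only [AdicCompletion.val_zero] at this
    have h2 : (α ^ 2).val (2 * k + 1) = (α.val (2 * k + 1)) ^ 2 := by
      rw [sq, sq]; rfl
    rw [h2, ← ha] at this
    have h3 : Submodule.Quotient.mk (p := (I ^ (2 * k + 1) • ⊤ : Ideal B)) (a ^ 2) = 0 := this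
    rw [Submodule.Quotient.mk_eq_zero] at h3
    simpa using h3
  have h2 : α.val (k + 1) = 0 := by
    have h3 := AdicCompletion.transitionMap_comp_eval_apply (I := I) (M := B)
      (show k + 1 ≤ 2 * k + 1 by omega) α
    rw [← h3, ← ha]
    change Submodule.Quotient.mk (p := (I ^ (k + 1) • ⊤ : Ideal B)) a = 0
    rw [Submodule.Quotient.mk_eq_zero]
    simpa using h k a h1
  have h3 := AdicCompletion.transitionMap_comp_eval_apply (I := I) (M := B)
      (show k ≤ k + 1 by omega) α
  rw [h2] at h3
  exact h3.symm.trans (LinearMap.map_zero _)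

/-! ### Length and dimension over a coefficient field. -/

section Length

open IsLocalRing

variable {κ L : Type*} [Field κ] [CommRing L] [IsLocalRing L] [Algebra κ L]

/-- Over a local ring with coefficient field `κ`, the length of a module killed by a power of the
maximal ideal is its dimension over `κ`. -/
theorem Module.length_eq_length_of_coefficient_field
    (hL : ∀ a : L, ∃ c : κ, a - algebraMap κ L c ∈ maximalIdeal L) (k : ℕ)
    (M : Type*) [AddCommGroup M] [Module L M] [Module κ M] [IsScalarTower κ L M]
    (hM : ∀ a ∈ maximalIdeal L ^ k, ∀ v : M, a • v = 0) :
    Module.length L M = Module.length κ M := by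
  induction k generalizing M with
  | zero =>
    have : Subsingleton M := ⟨fun v w => by
      rw [← one_smul L v, ← one_smul L w, hM 1 (by simp), hM 1 (by simp)]⟩
    rw [Module.length_eq_zero, Module.length_eq_zero]
  | succ k ih =>
    let N : Submodule L M := maximalIdeal L • ⊤
    have h1 : Module.length L N = Module.length κ N := by
      refine ih N fun a ha v => Subtype.ext ?_
      obtain ⟨v, hv⟩ := v
      simp only [Submodule.coe_smul, ZeroMemClass.coe_zero]
      refine Submodule.smul_induction_on hv (fun c hc w _ => ?_) fun v w hv hw => ?_
      · rw [smul_smul]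
        exact hM _ (by rw [pow_succ]; exact Ideal.mul_mem_mul ha hc) w
      · rw [smul_add, hv, hw, add_zero]
    -- On `M / 𝔪M` every `a` acts as its constant `c`, so submodules over `L` and over `κ` coincide.
    have h2 : Module.length L (M ⧸ N) = Module.length κ (M ⧸ N) := by
      let e : Submodule L (M ⧸ N) ≃o Submodule κ (M ⧸ N) :=
        { toFun := fun U => U.restrictScalars κ
          invFun := fun U =>
            { U with
              smul_mem' := fun a u hu => by
                obtain ⟨c, hc⟩ := hL a
                have : (a - algebraMap κ L c) • u = 0 := by
                  obtain ⟨v, rfl⟩ := N.mkQ_surjective u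
                  rw [← map_smul, Submodule.mkQ_apply, Submodule.Quotient.mk_eq_zero]
                  exact Submodule.smul_mem_smul hc trivial
                rw [sub_smul, sub_eq_zero, algebraMap_smul] at this
                rw [this]
                exact U.smul_mem c hu }
          left_inv := fun U => rfl
          right_inv := fun U => rfl
          map_rel_iff' := Iff.rfl }
      rw [Module.length, Module.length, WithBot.unbot_inj, Order.krullDim_eq_of_orderIso e]
    rw [Module.length_eq_add_of_exact N.subtype N.mkQ N.injective_subtype N.mkQ_surjective
      (LinearMap.exact_subtype_mkQ N),
      Module.length_eq_add_of_exact (N.subtype.restrictScalars κ) (N.mkQ.restrictScalars κ)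
        N.injective_subtype N.mkQ_surjective (LinearMap.exact_subtype_mkQ N), h1, h2]

theorem IsLocalRing.length_quotient_maximalIdeal_pow
    (hL : ∀ a : L, ∃ c : κ, a - algebraMap κ L c ∈ maximalIdeal L) (k : ℕ)
    (hfin : Module.Finite κ (L ⧸ (maximalIdeal L ^ k).restrictScalars κ)) :
    Module.length L (L ⧸ (maximalIdeal L ^ k • (⊤ : Submodule L L))) =
      Module.finrank κ (L ⧸ (maximalIdeal L ^ k).restrictScalars κ) := by
  have h1 : (maximalIdeal L ^ k • (⊤ : Submodule L L)) = maximalIdeal L ^ k := by simp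
  rw [h1]
  rw [Module.length_eq_length_of_coefficient_field (κ := κ) hL k]
  · exact Module.length_eq_finrank κ (L ⧸ (maximalIdeal L ^ k).restrictScalars κ)
  · intro a ha v
    obtain ⟨v, rfl⟩ := Ideal.Quotient.mk_surjective v
    change Ideal.Quotient.mk _ (a • v) = 0
    rw [Ideal.Quotient.eq_zero_iff_mem]
    exact Ideal.mul_mem_right _ _ ha

end Length

/-! ### Criteria for a ring to be Noetherian. -/

section Noetherian

/-- A ring is Noetherian if up to units all its elements come from a Noetherian ring. -/
theorem isNoetherianRing_of_forall_exists_isUnit_mul {B T : Type*} [CommRing B] [CommRing T]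
    [IsNoetherianRing B] (g : B →+* T) (h : ∀ a : T, ∃ u : T, IsUnit u ∧ u * a ∈ g.range) :
    IsNoetherianRing T := by
  refine (isNoetherianRing_iff_ideal_fg T).2 fun I => ?_
  have : I = (I.comap g).map g := by
    refine le_antisymm (fun a ha => ?_) Ideal.map_comap_le
    obtain ⟨u, hu, b, hb⟩ := h a
    rw [← Ideal.unit_mul_mem_iff_mem _ hu, ← hb]
    exact Ideal.mem_map_of_mem _ (by rw [Ideal.mem_comap, hb]; exact I.mul_mem_left _ ha)
  rw [this]
  exact Ideal.FG.map (IsNoetherian.noetherian (I.comap g)) g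

/-- A semilocal ring is Noetherian if its localizations at the maximal ideals are. -/
theorem isNoetherianRing_of_localization_maximal {B : Type*} [CommRing B]
    [Finite (MaximalSpectrum B)]
    (h : ∀ (m : Ideal B) (_ : m.IsMaximal), IsNoetherianRing (Localization.AtPrime m)) :
    IsNoetherianRing B := by
  refine (isNoetherianRing_iff_ideal_fg B).2 fun I => ?_
  -- Finitely many elements of `I` generate it at each of the finitely many maximal ideals; their
  -- union generates `I` locally everywhere.
  have h1 : ∀ m : MaximalSpectrum B, ∃ s : Finset B, (s : Set B) ⊆ I ∧
      I.map (algebraMap B (Localization.AtPrime m.asIdeal)) =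
        (Ideal.span s).map (algebraMap B (Localization.AtPrime m.asIdeal)) := by
    classical
    intro m
    have := h m.asIdeal m.isMaximal
    have h2 : (Submodule.span (Localization.AtPrime m.asIdeal)
        (algebraMap B (Localization.AtPrime m.asIdeal) '' I)).FG :=
      IsNoetherian.noetherian (I.map (algebraMap B (Localization.AtPrime m.asIdeal)))
    obtain ⟨s, hs, hs'⟩ := Submodule.fg_span_iff_fg_span_finset_subset _ |>.1 h2
    obtain ⟨t, ht, rfl⟩ := Finset.subset_set_image_iff.1 hs
    refine ⟨t, ht, ?_⟩
    rw [Ideal.map_span, ← Finset.coe_image]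
    exact hs'
  choose s hs hs' using h1
  have := Fintype.ofFinite (MaximalSpectrum B)
  classical
  refine ⟨Finset.univ.biUnion s, ?_⟩
  refine le_antisymm (Ideal.span_le.2 fun a ha => ?_)
    (Ideal.le_of_localization_maximal fun m hm => ?_)
  · simp only [Finset.coe_biUnion, Finset.coe_univ, Set.mem_univ, Set.iUnion_true,
      Set.mem_iUnion] at ha
    obtain ⟨m, ha⟩ := ha
    exact hs m ha
  · rw [hs' ⟨m, hm⟩]
    refine Ideal.map_mono (Ideal.span_mono ?_)
    exact_mod_cast Finset.subset_biUnion_of_mem s (Finset.mem_univ (⟨m, hm⟩ : MaximalSpectrum B))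

end Noetherian

/-! ### Catenary local domains and lower bounds for the dimension. -/

section Dimension

/-- In a catenary local domain, the codimension and the dimension of a prime are
complementary. -/
theorem not_isCatenaryRing_of_height_add_lt {B : Type*} [CommRing B] [IsDomain B] [IsLocalRing B]
    [IsNoetherianRing B] (q : Ideal B) [q.IsPrime]
    (h : (q.height : WithBot ℕ∞) + ringKrullDim (B ⧸ q) < ringKrullDim B) :
    ¬ IsCatenaryRing B := by
  intro hB
  -- In a local domain `⊥` and `⊤` of the spectrum are the zero ideal and the maximal ideal. The
  -- length `N` bounds the dimension, and it is attained by every saturated chain between them.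
  obtain ⟨N, hN, hN'⟩ := hB ⊥ ⊤ bot_le
  have hfd : FiniteDimensionalOrder (PrimeSpectrum B) :=
    inferInstanceAs (FiniteRingKrullDim B)
  have : WellFoundedLT (PrimeSpectrum B) := 
    ⟨SetRel.IsWellFounded.of_finiteDimensional {(a, b) : PrimeSpectrum B × PrimeSpectrum B | a < b}⟩
  have : WellFoundedGT (PrimeSpectrum B) := 
    ⟨SetRel.IsWellFounded.inv_of_finiteDimensional
      {(a, b) : PrimeSpectrum B × PrimeSpectrum B | a < b}⟩
  -- Finite dimension lets every chain be refined to a saturated one from `⊥` to `⊤`.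
  have key : ∀ s : LTSeries (PrimeSpectrum B), ∃ (c : LTSeries (PrimeSpectrum B))
      (i : Fin (s.length + 1) ↪ Fin (c.length + 1)), c ∘ i = s ∧ c.head = ⊥ ∧ c.last = ⊤ ∧
        ∀ i : Fin c.length, c i.castSucc ⋖ c i.succ := by
    intro s
    obtain ⟨t, i, hi, h1, h2⟩ := s.exists_relSeries_covBy_and_head_eq_bot_and_last_eq_bot
    exact ⟨⟨t.length, t.toFun, fun j => (t.step j).lt⟩, i, hi, h1, h2, fun j => t.step j⟩
  have hdim : ringKrullDim B ≤ N := by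
    rw [ringKrullDim, Order.krullDim_eq_length_of_finiteDimensionalOrder]
    obtain ⟨c, i, -, h1, h2, -⟩ := key (LTSeries.longestOf (PrimeSpectrum B))
    have h3 := Fintype.card_le_of_embedding i
    simp only [Fintype.card_fin, add_le_add_iff_right] at h3
    exact_mod_cast h3.trans (hN c h1 h2)
  have hN'' : (N : WithBot ℕ∞) ≤ q.height + ringKrullDim (B ⧸ q) := by
    -- Refining the one-point chain `q`: the part below `q` is bounded by its height, the part above
    -- by its coheight.
    obtain ⟨c, i, hi, h1, h2, h3⟩ := key (RelSeries.singleton _ (⟨q, ‹_›⟩ : PrimeSpectrum B))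
    have h4 : c (i 0) = ⟨q, ‹_›⟩ := congrFun hi 0
    have h5 := Order.index_le_height c (i 0)
    have h6 := Order.rev_index_le_coheight c (i 0)
    rw [h4] at h5 h6
    rw [← PrimeSpectrum.height_eq_orderHeight] at h5
    have h7 : ringKrullDim (B ⧸ q) =
        Order.coheight (⟨q, ‹_›⟩ : PrimeSpectrum B) := by
      rw [ringKrullDim_quotient, Order.coheight_eq_krullDim_Ici]
      rfl
    rw [h7, ← hN' c h1 h2 h3]
    have h8 : c.length = (i 0 : ℕ) + ((i 0).rev : ℕ) := by
      rw [Fin.val_rev]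
      omega
    rw [h8]
    push_cast
    exact add_le_add (WithBot.coe_le_coe.2 h5) (WithBot.coe_le_coe.2 h6)
  exact absurd (h.trans_le hdim) (not_lt.2 hN'')

instance MvPowerSeries.instIsDomain {σ K : Type*} [Field K] : IsDomain (MvPowerSeries σ K) :=
  NoZeroDivisors.to_isDomain _

/-- Killing the variables one at a time gives a growing chain of kernels, all prime. Each inclusion
is strict because the variable just killed is in the image of `ψ`. -/
theorem le_coheight_ker_of_mvPowerSeries {B K : Type*} [CommRing B] [Field K] {d : ℕ}
    (ψ : B →+* MvPowerSeries (Fin d) K) (hX : ∀ i, MvPowerSeries.X i ∈ ψ.range) :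
    (d : ℕ∞) ≤ Order.coheight (⟨RingHom.ker ψ, RingHom.ker_isPrime ψ⟩ : PrimeSpectrum B) := by
  induction d with
  | zero => simp
  | succ d ih =>
    let π : MvPowerSeries (Fin (d + 1)) K →ₐ[K] MvPowerSeries (Fin d) K :=
      MvPowerSeries.killCompl (Fin.succEmb d)
    have h1 := ih (π.toRingHom.comp ψ) fun i => by
      obtain ⟨b, hb⟩ := hX i.succ
      refine ⟨b, ?_⟩
      rw [RingHom.comp_apply, hb]
      exact MvPowerSeries.killCompl_X (e := Fin.succEmb d) i
    push_cast
    refine (add_le_add_left h1 1).trans (Order.coheight_add_one_le ?_)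
    rw [← PrimeSpectrum.asIdeal_lt_asIdeal]
    refine lt_of_le_of_ne (fun b hb => ?_) fun h => ?_
    · rw [RingHom.mem_ker] at hb ⊢
      rw [RingHom.comp_apply, hb, map_zero]
    · obtain ⟨b, hb⟩ := hX 0
      have h2 : b ∈ RingHom.ker (π.toRingHom.comp ψ) := by
        rw [RingHom.mem_ker, RingHom.comp_apply, hb]
        refine MvPowerSeries.killCompl_X_eq_zero (e := Fin.succEmb d) ?_
        rintro ⟨i, hi⟩
        exact Fin.succ_ne_zero i hi
      have h3 : b ∈ RingHom.ker ψ := h.ge h2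
      rw [RingHom.mem_ker, hb] at h3
      have h4 := congrArg (MvPowerSeries.coeff (Finsupp.single 0 1)) h3
      rw [MvPowerSeries.coeff_index_single_self_X, map_zero] at h4
      exact one_ne_zero h4

/-- The zero ideal lies strictly below the kernel and adds one more step to the chain. -/
theorem le_ringKrullDim_of_mvPowerSeries {B K : Type*} [CommRing B] [IsDomain B] [Field K] {d : ℕ}
    (ψ : B →+* MvPowerSeries (Fin d) K) (hψ : ¬ Function.Injective ψ)
    (hX : ∀ i, MvPowerSeries.X i ∈ ψ.range) : (d + 1 : ℕ) ≤ ringKrullDim B := by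
  have h1 := le_coheight_ker_of_mvPowerSeries ψ hX
  have h2 : (⊥ : PrimeSpectrum B) < ⟨RingHom.ker ψ, RingHom.ker_isPrime ψ⟩ := by
    rw [← PrimeSpectrum.asIdeal_lt_asIdeal]
    exact bot_lt_iff_ne_bot.2 fun h => hψ ((RingHom.injective_iff_ker_eq_bot ψ).2 h)
  refine le_trans ?_ (Order.coheight_le_krullDim (⊥ : PrimeSpectrum B))
  push_cast
  exact_mod_cast (add_le_add_left h1 1).trans (Order.coheight_add_one_le h2)

end Dimension

/-! ### Existence of algebraically independent power series -/

section Existence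

/-- Algebraic independence of power series is preserved by extensions of the field of
coefficients. -/
theorem AlgebraicIndependent.powerSeries_map {k K ι : Type*} [Field k] [Field K] [Algebra k K]
    {v : ι → k⟦X⟧} (hv : AlgebraicIndependent k v) :
    AlgebraicIndependent K (fun i => PowerSeries.map (algebraMap k K) (v i)) := by
  rw [algebraicIndependent_iff]
  intro G hG
  ext d
  rw [MvPolynomial.coeff_zero, ← Module.forall_dual_apply_eq_zero_iff k]
  intro l
  -- A `k`-linear functional `l` applied to the coefficients turns a relation over `K` into one over
  -- `k`, which is trivial. Functionals separate points of `K`, so `G` itself vanishes.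
  let G' : MvPolynomial ι k := ∑ e ∈ G.support, MvPolynomial.monomial e (l (G.coeff e))
  have hG' : MvPolynomial.aeval v G' = 0 := by
    ext n
    have h1 := congrArg (fun w => l (PowerSeries.coeff n w)) hG
    simp only [map_zero] at h1
    rw [G.as_sum, map_sum, map_sum, map_sum] at h1
    rw [map_sum, map_sum, map_zero, ← h1]
    refine Finset.sum_congr rfl fun e _ => ?_
    rw [MvPolynomial.aeval_monomial, MvPolynomial.aeval_monomial]
    have h2 : (e.prod fun i m => PowerSeries.map (algebraMap k K) (v i) ^ m) =
        PowerSeries.map (algebraMap k K) (e.prod fun i m => v i ^ m) := by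
      rw [Finsupp.prod, Finsupp.prod, map_prod]
      simp
    rw [h2, ← Algebra.smul_def, ← Algebra.smul_def, PowerSeries.coeff_smul, PowerSeries.coeff_smul,
      PowerSeries.coeff_map, smul_eq_mul, smul_eq_mul, mul_comm (MvPolynomial.coeff e G),
      ← Algebra.smul_def, map_smul, smul_eq_mul, mul_comm]
  have h3 := congrArg (MvPolynomial.coeff d) ((algebraicIndependent_iff.1 hv) G' hG')
  rw [MvPolynomial.coeff_zero, MvPolynomial.coeff_sum] at h3
  by_cases hd : d ∈ G.support
  · classical
    rw [Finset.sum_eq_single d (fun e _ he => by simp [MvPolynomial.coeff_monomial, he])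
      (fun h => absurd hd h)] at h3
    simpa using h3
  · rw [MvPolynomial.notMem_support_iff.1 hd, map_zero]

theorem PowerSeries.uncountable (k : Type*) [Field k] : Uncountable k⟦X⟧ := by
  have h : Function.Injective (fun b : ℕ → Bool =>
      PowerSeries.mk fun n => if b n then (1 : k) else 0) := by
    intro b b' h
    funext n
    have := congrArg (PowerSeries.coeff n) h
    simp only [PowerSeries.coeff_mk] at this
    cases hb : b n <;> cases hb' : b' n <;> simp_all
  have : Uncountable (ℕ → Bool) := by
    rw [← Cardinal.aleph0_lt_mk_iff]
    simpa using Cardinal.cantor Cardinal.aleph0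
  exact h.uncountable

/-- By cardinality: over the countable ring `k[X]`, a finite transcendence basis would leave `k⟦X⟧`
countable. -/
theorem exists_algebraicIndependent_polynomial_of_countable (k : Type*) [Field k] [Countable k]
    (r : ℕ) : ∃ w : Fin r → k⟦X⟧, AlgebraicIndependent k[X] w := by
  have : FaithfulSMul k[X] k⟦X⟧ := (faithfulSMul_iff_algebraMap_injective _ _).2
    (Polynomial.coe_injective k)
  obtain ⟨ι, b, hb⟩ := exists_isTranscendenceBasis' k[X] k⟦X⟧
  have hunc := PowerSeries.uncountable k
  rw [← Cardinal.aleph0_lt_mk_iff] at hunc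
  have hpoly : Cardinal.mk k[X] ≤ Cardinal.aleph0 :=
    Polynomial.cardinalMk_le_max.trans (max_le (Cardinal.mk_le_aleph0) le_rfl)
  have hinf : Infinite ι := by
    by_contra hfin
    rw [not_infinite_iff_finite] at hfin
    rcases isEmpty_or_nonempty ι with hι | hι
    · have := hb.isEmpty_iff_isAlgebraic.1 hι
      exact absurd hunc (not_lt.2 ((Algebra.IsAlgebraic.cardinalMk_le_max k[X] k⟦X⟧).trans
        (max_le hpoly le_rfl)))
    · have h1 := hb.lift_cardinalMk_eq_max_lift
      refine absurd hunc (not_lt.2 ?_)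
      rw [← Cardinal.lift_le_aleph0, h1]
      exact max_le (max_le (by simp) (by simp)) le_rfl
  exact ⟨fun i => b (Infinite.natEmbedding ι i), hb.1.comp _
    ((Infinite.natEmbedding ι).injective.comp Fin.val_injective)⟩

/-- The series are found over the prime field, which is countable, and carried to `K`. Extension of
scalars concerns independence over a field, so `X` joins the family before it and is split off again
into the base ring afterwards. -/
theorem exists_algebraicIndependent_polynomial (K : Type*) [Field K] (r : ℕ) :
    ∃ z : Fin r → K⟦X⟧, AlgebraicIndependent K[X] z := by
  let k := Subfield.closure (∅ : Set K)
  have : Countable k := by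
    rw [← Cardinal.mk_le_aleph0_iff]
    exact (Subfield.cardinalMk_closure_le_max (∅ : Set K)).trans (by simp)
  obtain ⟨w, hw⟩ := exists_algebraicIndependent_polynomial_of_countable k r
  have h1 : AlgebraicIndependent k (fun _ : Unit => (PowerSeries.X : k⟦X⟧)) := by
    have h2 : AlgebraicIndependent k (fun _ : Unit => (Polynomial.X : k[X])) := by
      rw [algebraicIndependent_unique_type_iff]
      exact Polynomial.transcendental_X k
    have := h2.map' (f := Polynomial.coeToPowerSeries.algHom k) (by
      intro a b h
      simpa using h)
    simpa [Function.comp_def] using this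
  have h2 : AlgebraicIndependent k (Sum.elim w (fun _ : Unit => (PowerSeries.X : k⟦X⟧))) := by
    refine h1.sumElim_of_tower (S := k[X]) ?_ hw
    rintro _ ⟨_, rfl⟩
    exact ⟨Polynomial.X, by simp [PowerSeries.algebraMap_apply']⟩
  have h3 := h2.powerSeries_map (K := K)
  let z := fun i => PowerSeries.map (algebraMap k K) (w i)
  have h4 : (fun i => PowerSeries.map (algebraMap k K) (Sum.elim w (fun _ : Unit => X) i)) =
      Sum.elim z (fun _ : Unit => (PowerSeries.X : K⟦X⟧)) := by
    funext i
    cases i <;> simp [z]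
  rw [h4, AlgebraicIndependent.sumElim_iff] at h3
  refine ⟨z, ?_⟩
  let B := Algebra.adjoin K (Set.range fun _ : Unit => (PowerSeries.X : K⟦X⟧))
  let g : K[X] →ₐ[K] B := Polynomial.aeval ⟨PowerSeries.X, Algebra.subset_adjoin ⟨(), rfl⟩⟩
  have hg : B.val.comp g = Polynomial.coeToPowerSeries.algHom K := by
    ext
    simp [g]
  have h5 : ∀ q, ((g q : B) : K⟦X⟧) = q := fun q => by
    simpa using DFunLike.congr_fun hg q
  refine AlgebraicIndependent.of_ringHom_of_comp_eq (g : K[X] →+* B) (RingHom.id K⟦X⟧)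
    (S := B) (x := z) h3.2 ?_ ?_
  · intro a b h
    have := congrArg (Subtype.val) h
    simpa [h5] using this
  · ext q
    · simp [h5, PowerSeries.algebraMap_apply']
    · simp [h5, PowerSeries.algebraMap_apply']

open scoped RatFunc in
theorem AlgebraicIndependent.algIndep {K : Type*} [Field K] {r : ℕ} {z : Fin r → K⟦X⟧}
    (hz : AlgebraicIndependent K[X] z) : Nagata.AlgIndep z := by
  have h1 : AlgebraicIndependent K[X] (A := LaurentSeries K)
      (fun i => HahnSeries.ofPowerSeries ℤ K (z i)) := by
    refine AlgebraicIndependent.ringHom_of_comp_eq (RingHom.id K[X])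
      (HahnSeries.ofPowerSeries ℤ K) (B := LaurentSeries K) (x := z) hz Function.surjective_id
      HahnSeries.ofPowerSeries_injective ?_
    ext <;> rfl
  have : Algebra.IsAlgebraic K[X] (RatFunc K) :=
    IsLocalization.isAlgebraic _ (nonZeroDivisors K[X])
  exact h1.extendScalars _

open scoped RatFunc in
theorem Nagata.AlgIndep.algebraicIndependent {K : Type*} [Field K] {r : ℕ} {z : Fin r → K⟦X⟧}
    (hz : Nagata.AlgIndep z) : AlgebraicIndependent K[X] z := by
  have h1 : AlgebraicIndependent K[X] (A := LaurentSeries K)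
      (fun i => HahnSeries.ofPowerSeries ℤ K (z i)) :=
    AlgebraicIndependent.restrictScalars (K := RatFunc K) (IsFractionRing.injective _ _) hz
  refine AlgebraicIndependent.of_ringHom_of_comp_eq (RingHom.id K[X])
      (HahnSeries.ofPowerSeries ℤ K) (B := LaurentSeries K) (x := z) h1 Function.injective_id ?_
  ext <;> rfl

end Existence

/-! ### The ring `R_0` -/

namespace Nagata

variable {K : Type*} [Field K] {r : ℕ} (z : Fin r → K⟦X⟧)

namespace R₀

/-- The inclusion of `R_0` into the power series ring. -/
noncomputable def incl : R₀ z →ₐ[K] K⟦X⟧ := (R₀sub z).val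

theorem incl_injective : Function.Injective (incl z) := Subtype.val_injective

instance : IsDomain (R₀ z) := (incl_injective z).isDomain (incl z).toRingHom

/-- The element `x` of `R_0`. -/
noncomputable def xR : R₀ z := ⟨PowerSeries.X, X_mem_R₀sub z⟩

/-- The element `z_i` of `R_0`. -/
noncomputable def zR (i : Fin r) : R₀ z := ⟨z i, z_mem_R₀sub z i⟩

/-- The element `z_{ij}` of `R_0`, with index shifted by one. -/
noncomputable def tl (i : Fin r) (j : ℕ) : R₀ z :=
  ⟨tail (z i) (j + 1), Algebra.subset_adjoin (Or.inr ⟨i, j + 1, j.succ_pos, rfl⟩)⟩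

@[simp] theorem incl_xR : incl z (xR z) = PowerSeries.X := rfl

@[simp] theorem incl_zR (i : Fin r) : incl z (zR z i) = z i := rfl

@[simp] theorem incl_tl (i : Fin r) (j : ℕ) : incl z (tl z i j) = tail (z i) (j + 1) := rfl

theorem xR_ne_zero : xR z ≠ 0 := fun h => PowerSeries.X_ne_zero (R := K) (congrArg (incl z) h)

/-- An induction principle for `R_0`: a property that defines a subalgebra need only be checked on
`x` and on the tails. -/
theorem adjoin_eq_top {U : Subalgebra K (R₀ z)} (hx : xR z ∈ U) (ht : ∀ i j, tl z i j ∈ U) :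
    U = ⊤ := by
  have h1 : (R₀sub z) ≤ U.map (incl z) := by
    refine Algebra.adjoin_le ?_
    rintro w (rfl | ⟨i, j, hj, rfl⟩)
    · exact ⟨xR z, hx, rfl⟩
    · obtain ⟨j, rfl⟩ := Nat.exists_eq_succ_of_ne_zero hj.ne'
      exact ⟨tl z i j, ht i j, rfl⟩
  refine eq_top_iff.2 fun g _ => ?_
  obtain ⟨g', hg', h⟩ := h1 g.2
  rwa [← incl_injective z h]

theorem zR_eq (i : Fin r) :
    zR z i = tl z i 0 + algebraMap K (R₀ z) (PowerSeries.constantCoeff (z i)) := by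
  apply incl_injective z
  rw [map_add, AlgHom.commutes, incl_zR, incl_tl]
  conv_lhs => rw [PowerSeries.eq_X_mul_shift_add_const (z i)]
  rfl

/-- This recursion separates the two points. It puts every tail into `(x)`, and where `x` is
invertible it expresses each tail through the preceding one. -/
theorem tl_eq (i : Fin r) (j : ℕ) :
    tl z i j = xR z * (tl z i (j + 1) + algebraMap K (R₀ z) (PowerSeries.coeff (j + 1) (z i))) := by
  apply incl_injective z
  rw [map_mul, map_add, AlgHom.commutes, incl_tl, incl_tl, incl_xR, tail, tail]
  congr 1
  conv_lhs => rw [PowerSeries.eq_X_mul_shift_add_const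
    (PowerSeries.mk fun k => PowerSeries.coeff (k + (j + 1)) (z i))]
  congr 2
  · ext k
    simp only [PowerSeries.coeff_mk]
    congr 2
    omega
  · simp

/-- `R_0 / (x) = K`, because `tl_eq` makes all tails multiples of `x`. -/
theorem exists_eq_add_xR_mul (g : R₀ z) :
    ∃ (c : K) (g' : R₀ z), g = algebraMap K (R₀ z) c + xR z * g' := by
  let U : Subalgebra K (R₀ z) :=
    { carrier := {g | ∃ (c : K) (g' : R₀ z), g = algebraMap K (R₀ z) c + xR z * g'}
      mul_mem' := by
        rintro _ _ ⟨c, g, rfl⟩ ⟨d, h, rfl⟩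
        refine ⟨c * d, algebraMap K _ c * h + algebraMap K _ d * g + g * (xR z * h), ?_⟩
        rw [map_mul]
        ring
      add_mem' := by
        rintro _ _ ⟨c, g, rfl⟩ ⟨d, h, rfl⟩
        exact ⟨c + d, g + h, by rw [map_add]; ring⟩
      algebraMap_mem' := fun c => ⟨c, 0, by simp⟩ }
  have : U = ⊤ := adjoin_eq_top z ⟨0, 1, by simp⟩ fun i j => ⟨0, _, by rw [map_zero, zero_add]; exact tl_eq z i j⟩
  exact this.ge (Algebra.mem_top (x := g))

/-- Modulo `x - 1` the recursion `tl_eq` says that consecutive tails differ by a constant, and the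
first tail differs from `z_i` by a constant. -/
theorem exists_sub_mem_span (g : R₀ z) :
    ∃ c : K, g - algebraMap K (R₀ z) c ∈ Ideal.span ({xR z - 1} ∪ Set.range (zR z)) := by
  set I := Ideal.span ({xR z - 1} ∪ Set.range (zR z))
  let U : Subalgebra K (R₀ z) :=
    { carrier := {g | ∃ c : K, g - algebraMap K (R₀ z) c ∈ I}
      mul_mem' := by
        rintro a b ⟨c, hc⟩ ⟨d, hd⟩
        refine ⟨c * d, ?_⟩
        have : a * b - algebraMap K (R₀ z) (c * d) =
            a * (b - algebraMap K (R₀ z) d) + algebraMap K (R₀ z) d * (a - algebraMap K _ c) := by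
          rw [map_mul]; ring
        rw [this]
        exact add_mem (I.mul_mem_left _ hd) (I.mul_mem_left _ hc)
      add_mem' := by
        rintro a b ⟨c, hc⟩ ⟨d, hd⟩
        refine ⟨c + d, ?_⟩
        rw [map_add, add_sub_add_comm]
        exact add_mem hc hd
      algebraMap_mem' := fun c => ⟨c, by simp⟩ }
  have hx : xR z - 1 ∈ I := Ideal.subset_span (Or.inl rfl)
  have : U = ⊤ := by
    refine adjoin_eq_top z ⟨1, by rw [map_one]; exact hx⟩ fun i j => ?_
    induction j with
    | zero =>
      refine ⟨-(PowerSeries.constantCoeff (z i)), ?_⟩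
      have h1 := zR_eq z i
      have h2 : zR z i ∈ I := Ideal.subset_span (Or.inr ⟨i, rfl⟩)
      rw [h1] at h2
      simpa using h2
    | succ j ih =>
      obtain ⟨c, hc⟩ := ih
      refine ⟨c - PowerSeries.coeff (j + 1) (z i), ?_⟩
      have h1 := tl_eq z i j
      have h2 : tl z i (j + 1) - algebraMap K (R₀ z) (c - PowerSeries.coeff (j + 1) (z i)) =
          (tl z i j - algebraMap K (R₀ z) c) - (xR z - 1) *
            (tl z i (j + 1) + algebraMap K (R₀ z) (PowerSeries.coeff (j + 1) (z i))) := by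
        rw [h1, map_sub]
        ring
      rw [h2]
      exact sub_mem hc (I.mul_mem_right _ hx)
  exact this.ge (Algebra.mem_top (x := g))

/-- The map from the polynomial ring in `x, z_1, …, z_r` to `R_0`. -/
noncomputable def ofPoly : MvPolynomial (Fin r) K[X] →ₐ[K] R₀ z :=
  MvPolynomial.aevalTower (Polynomial.aeval (xR z)) (zR z)

@[simp] theorem ofPoly_C_X : ofPoly z (MvPolynomial.C Polynomial.X) = xR z := by
  simp [ofPoly]

@[simp] theorem ofPoly_X (i : Fin r) : ofPoly z (MvPolynomial.X i) = zR z i := by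
  simp [ofPoly]

theorem incl_ofPoly (q : MvPolynomial (Fin r) K[X]) :
    incl z (ofPoly z q) = MvPolynomial.aeval z q := by
  have : (incl z).comp (ofPoly z) =
      ((MvPolynomial.aeval z : MvPolynomial (Fin r) K[X] →ₐ[K[X]] K⟦X⟧).restrictScalars K) := by
    apply MvPolynomial.algHom_ext'
    · ext
      simp [ofPoly, PowerSeries.algebraMap_apply']
    · intro i
      simp [ofPoly]
  exact DFunLike.congr_fun this q

/-- `R_0[1/x]` is generated by `x`, `1/x` and the `z_i`: solving the recursion for the next tail
costs one division by `x`. -/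
theorem exists_xR_pow_mul_eq_ofPoly (g : R₀ z) :
    ∃ (k : ℕ) (q : MvPolynomial (Fin r) K[X]), xR z ^ k * g = ofPoly z q := by
  let U : Subalgebra K (R₀ z) :=
    { carrier := {g | ∃ (k : ℕ) (q : MvPolynomial (Fin r) K[X]), xR z ^ k * g = ofPoly z q}
      mul_mem' := by
        rintro a b ⟨k, q, hq⟩ ⟨l, q', hq'⟩
        refine ⟨k + l, q * q', ?_⟩
        rw [map_mul, ← hq, ← hq']
        ring
      add_mem' := by
        rintro a b ⟨k, q, hq⟩ ⟨l, q', hq'⟩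
        refine ⟨k + l, MvPolynomial.C Polynomial.X ^ l * q + MvPolynomial.C Polynomial.X ^ k * q',
          ?_⟩
        rw [map_add, map_mul, map_mul, map_pow, map_pow, ofPoly_C_X, ← hq, ← hq']
        ring
      algebraMap_mem' := fun c => ⟨0, algebraMap K _ c, by rw [AlgHom.commutes, pow_zero, one_mul]⟩ }
  have hx : xR z ∈ U := ⟨0, MvPolynomial.C Polynomial.X, by simp⟩
  have : U = ⊤ := by
    refine adjoin_eq_top z hx fun i j => ?_
    induction j with
    | zero =>
      have : tl z i 0 = zR z i - algebraMap K (R₀ z) (PowerSeries.constantCoeff (z i)) := by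
        rw [zR_eq]; ring
      rw [this]
      exact sub_mem ⟨0, MvPolynomial.X i, by simp⟩ (U.algebraMap_mem _)
    | succ j ih =>
      have h1 : xR z * tl z i (j + 1) ∈ U := by
        have : xR z * tl z i (j + 1) = tl z i j -
            xR z * algebraMap K (R₀ z) (PowerSeries.coeff (j + 1) (z i)) := by
          rw [tl_eq z i j]; ring
        rw [this]
        exact sub_mem ih (mul_mem hx (U.algebraMap_mem _))
      obtain ⟨k, q, hq⟩ := h1
      exact ⟨k + 1, q, by rw [← hq]; ring⟩
  exact this.ge (Algebra.mem_top (x := g))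

/-- The value at `x = 0`. -/
noncomputable def ev : R₀ z →ₐ[K] K :=
  { (PowerSeries.constantCoeff (R := K)).comp (incl z).toRingHom with
    commutes' := fun c => by
      change PowerSeries.constantCoeff (incl z (algebraMap K _ c)) = _
      rw [AlgHom.commutes, PowerSeries.algebraMap_apply]
      simp }

theorem ev_apply (g : R₀ z) : ev z g = PowerSeries.constantCoeff (incl z g) := rfl

@[simp] theorem ev_xR : ev z (xR z) = 0 := by simp [ev_apply]

theorem xR_dvd_iff {g : R₀ z} : xR z ∣ g ↔ ev z g = 0 := by
  constructor
  · rintro ⟨g, rfl⟩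
    simp
  · intro h
    obtain ⟨c, g', rfl⟩ := exists_eq_add_xR_mul z g
    rw [map_add, map_mul, ev_xR, zero_mul, add_zero, AlgHom.commutes] at h
    rw [show c = 0 from h, map_zero, zero_add]
    exact dvd_mul_right _ _

theorem prime_xR : Prime (xR z) := by
  refine ⟨xR_ne_zero z, fun h => ?_, fun a b h => ?_⟩
  · simpa using (h.map (ev z))
  · simpa [xR_dvd_iff] using h

instance : (Ideal.span {xR z}).IsPrime :=
  (Ideal.span_singleton_prime (xR_ne_zero z)).2 (prime_xR z)

/-- A nonzero power series has finite order, so `x` can be divided out only finitely often. -/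
theorem exists_eq_xR_pow_mul {g : R₀ z} (hg : g ≠ 0) :
    ∃ (k : ℕ) (g' : R₀ z), g = xR z ^ k * g' ∧ ev z g' ≠ 0 := by
  have hfin : FiniteMultiplicity (xR z) g := by
    by_contra h
    rw [FiniteMultiplicity.not_iff_forall] at h
    refine hg (incl_injective z ?_)
    rw [map_zero]
    ext k
    obtain ⟨g', hg'⟩ := h (k + 1)
    rw [hg', map_mul, map_pow, incl_xR, PowerSeries.coeff_X_pow_mul']
    simp
  obtain ⟨g', h1, h2⟩ := hfin.exists_eq_pow_mul_and_not_dvd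
  exact ⟨_, g', h1, fun h => h2 ((xR_dvd_iff z).2 h)⟩

/-- A nonzero prime contains a power of `x` times a unit, hence `x`, so it is the principal maximal
ideal. It suffices that nonzero primes are finitely generated. -/
instance : IsNoetherianRing (Localization.AtPrime (Ideal.span {xR z})) := by
  set D := Localization.AtPrime (Ideal.span {xR z})
  have hm : IsLocalRing.maximalIdeal D = Ideal.span {algebraMap (R₀ z) D (xR z)} := by
    rw [← Localization.AtPrime.map_eq_maximalIdeal, Ideal.map_span, Set.image_singleton]
  refine IsNoetherianRing.of_prime_ne_bot fun Q hQ hQ0 => ?_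
  have hx : algebraMap (R₀ z) D (xR z) ∈ Q := by
    obtain ⟨q, hq, hq0⟩ := Submodule.exists_mem_ne_zero_of_ne_bot hQ0
    obtain ⟨g, s, rfl⟩ := IsLocalization.exists_mk'_eq (Ideal.span {xR z}).primeCompl q
    have hg : algebraMap (R₀ z) D g ∈ Q := by
      rw [← IsLocalization.mk'_spec D g s]
      exact Q.mul_mem_right _ hq
    have hg0 : g ≠ 0 := by
      rintro rfl
      exact hq0 (IsLocalization.mk'_zero _)
    obtain ⟨k, g', rfl, hg'⟩ := exists_eq_xR_pow_mul z hg0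
    have hu : IsUnit (algebraMap (R₀ z) D g') := by
      refine IsLocalization.map_units D (⟨g', fun h => hg' ?_⟩ : (Ideal.span {xR z}).primeCompl)
      exact (xR_dvd_iff z).1 (Ideal.mem_span_singleton.1 h)
    rw [map_mul, map_pow, mul_comm, Ideal.unit_mul_mem_iff_mem _ hu] at hg
    exact hQ.mem_of_pow_mem _ hg
  have : Q = IsLocalRing.maximalIdeal D := by
    refine le_antisymm (IsLocalRing.le_maximalIdeal hQ.ne_top) ?_
    rw [hm, Ideal.span_singleton_le_iff_mem]
    exact hx
  rw [this, hm]
  exact ⟨{algebraMap (R₀ z) D (xR z)}, by simp only [Finset.coe_singleton]; rfl⟩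

variable {z} (hz : AlgIndep z)
include hz

theorem ofPoly_injective : Function.Injective (ofPoly z) := by
  have h1 : Function.Injective (MvPolynomial.aeval z : MvPolynomial (Fin r) K[X] →ₐ[K[X]] K⟦X⟧) :=
    hz.algebraicIndependent
  refine Function.Injective.of_comp (f := incl z) ?_
  have : incl z ∘ ofPoly z = MvPolynomial.aeval z := funext (incl_ofPoly z)
  rwa [this]

/-- Homomorphisms from `R_0` that invert `x` may be prescribed on `x, z_1, …, z_r`. -/
theorem exists_algHom {C : Type*} [CommRing C] [Algebra K C] {u : C} (hu : IsUnit u)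
    (ζ : Fin r → C) : ∃ θ : R₀ z →ₐ[K] C, θ (xR z) = u ∧ ∀ i, θ (zR z i) = ζ i := by
  let E := Localization.Away (xR z)
  let a : MvPolynomial (Fin r) K[X] →+* E := (algebraMap (R₀ z) E).comp (ofPoly z).toRingHom
  let : Algebra (MvPolynomial (Fin r) K[X]) E := a.toAlgebra
  have ha : ∀ q, algebraMap (MvPolynomial (Fin r) K[X]) E q =
    algebraMap (R₀ z) E (ofPoly z q) := fun _ => rfl
  have hinj : Function.Injective (algebraMap (R₀ z) E) :=
    IsLocalization.injective E (powers_le_nonZeroDivisors_of_noZeroDivisors (xR_ne_zero z))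
  have hxu : IsUnit (algebraMap (R₀ z) E (xR z)) := IsLocalization.Away.algebraMap_isUnit (xR z)
  -- By independence of the `z_i`, the ring `R_0[1/x]` is also the localization at `x` of a
  -- polynomial ring in `x, z_1, …, z_r`, where values can be prescribed freely.
  have hloc : IsLocalization.Away (MvPolynomial.C Polynomial.X : MvPolynomial (Fin r) K[X]) E := by
    constructor
    constructor
    · rintro ⟨_, k, rfl⟩
      rw [ha]
      simpa using hxu.pow k
    · intro e
      obtain ⟨g, ⟨_, k, rfl⟩, rfl⟩ := IsLocalization.exists_mk'_eq (Submonoid.powers (xR z)) e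
      obtain ⟨l, q, hq⟩ := exists_xR_pow_mul_eq_ofPoly z g
      refine ⟨(q, ⟨MvPolynomial.C Polynomial.X ^ (l + k), l + k, rfl⟩), ?_⟩
      rw [ha, ha]
      simp only [map_pow, ofPoly_C_X, ← hq, map_mul]
      have h2 := IsLocalization.mk'_spec E g (⟨xR z ^ k, k, rfl⟩ : Submonoid.powers (xR z))
      rw [← h2]
      simp only [map_pow]
      ring
    · intro q q' h
      exact ⟨1, by rw [ofPoly_injective hz (hinj h)]⟩
  let ψ : MvPolynomial (Fin r) K[X] →ₐ[K] C := MvPolynomial.aevalTower (Polynomial.aeval u) ζ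
  have hψ : IsUnit (ψ.toRingHom (MvPolynomial.C Polynomial.X)) := by
    simpa [ψ] using hu
  let θ' : E →+* C := IsLocalization.Away.lift
    (MvPolynomial.C Polynomial.X : MvPolynomial (Fin r) K[X]) hψ
  have hθ : ∀ q, θ' (algebraMap (R₀ z) E (ofPoly z q)) = ψ q := fun q => by
    rw [← ha]
    exact IsLocalization.Away.lift_eq _ hψ q
  refine ⟨{ θ'.comp (algebraMap (R₀ z) E) with commutes' := fun c => ?_ }, ?_, fun i => ?_⟩
  · have := hθ (algebraMap K _ c)
    rw [AlgHom.commutes, AlgHom.commutes] at this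
    exact this
  · have := hθ (MvPolynomial.C Polynomial.X)
    rw [ofPoly_C_X] at this
    refine Eq.trans this ?_
    simp [ψ]
  · have := hθ (MvPolynomial.X i)
    rw [ofPoly_X] at this
    refine Eq.trans this ?_
    simp [ψ]

end R₀

end Nagata

/-! ### The polynomial `f` is prime -/

namespace Nagata

variable {K : Type*} [Field K] {r : ℕ}

/-- Eisenstein's criterion at `π`, which divides the constant term exactly once. -/
theorem prime_X_pow_add_C {B : Type*} [CommRing B] [IsDomain B] [UniqueFactorizationMonoid B]
    {s t : ℕ} (hs : 0 < s) {a π : B} (hπ : Prime π) (ha : ¬ π ∣ a) :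
    Prime (Polynomial.X ^ s + Polynomial.C (a ^ t * π) : B[X]) := by
  rw [← UniqueFactorizationMonoid.irreducible_iff_prime]
  have hmonic := Polynomial.monic_X_pow_add_C (a ^ t * π) hs.ne'
  have hprime := (Ideal.span_singleton_prime hπ.ne_zero).2 hπ
  refine Polynomial.irreducible_of_eisenstein_criterion hprime ?_ ?_ ?_ ?_ hmonic.isPrimitive
  · rw [hmonic.leadingCoeff]
    exact fun h => hprime.ne_top ((Ideal.eq_top_iff_one _).2 h)
  · intro k hk
    rw [Polynomial.degree_X_pow_add_C hs, Nat.cast_lt] at hk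
    rw [Polynomial.coeff_add, Polynomial.coeff_X_pow, if_neg hk.ne, zero_add, Polynomial.coeff_C]
    split_ifs
    · exact Ideal.mem_span_singleton.2 (dvd_mul_left _ _)
    · exact zero_mem _
  · rw [Polynomial.degree_X_pow_add_C hs]
    exact_mod_cast hs
  · rw [Polynomial.coeff_add, Polynomial.coeff_X_pow, if_neg hs.ne, zero_add,
      Polynomial.coeff_C_zero, Ideal.span_singleton_pow, Ideal.mem_span_singleton, sq]
    intro h
    exact ha (hπ.dvd_of_dvd_pow ((mul_dvd_mul_iff_right hπ.ne_zero).1 h))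

/-- The equation `y_m ^ s + x ^ t (x - 1)` in a polynomial ring. -/
noncomputable def eqn {B : Type*} [CommRing B] (b : B) (n s t : ℕ) :
    MvPolynomial (Fin (n + 1)) B :=
  MvPolynomial.X (Fin.last n) ^ s +
    MvPolynomial.C b ^ t * (MvPolynomial.C b - 1)

theorem map_eqn {B B' : Type*} [CommRing B] [CommRing B'] (g : B →+* B') (b : B) (n s t : ℕ) :
    MvPolynomial.map g (eqn b n s t) = eqn (g b) n s t := by
  simp [eqn]

theorem prime_eqn_of_prime {B : Type*} [CommRing B] [IsDomain B] [UniqueFactorizationMonoid B]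
    (b : B) (hb : Prime (b - 1)) (n : ℕ) {s : ℕ} (hs : 0 < s) (t : ℕ) :
    Prime (eqn b n s t) := by
  let e : MvPolynomial (Fin (n + 1)) B ≃ₐ[B] Polynomial (MvPolynomial (Fin n) B) :=
    (MvPolynomial.renameEquiv B finSuccEquivLast).trans (MvPolynomial.optionEquivLeft B (Fin n))
  have he : e (eqn b n s t) = Polynomial.X ^ s +
      Polynomial.C (MvPolynomial.C b ^ t * MvPolynomial.C (b - 1)) := by
    simp [e, eqn, MvPolynomial.optionEquivLeft_C, MvPolynomial.optionEquivLeft_X_none]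
  rw [← MulEquiv.prime_iff e.toMulEquiv]
  change Prime (e _)
  rw [he]
  refine prime_X_pow_add_C hs ((MvPolynomial.prime_C_iff _).2 hb) ?_
  rw [MvPolynomial.C_dvd_iff_dvd_coeff]
  intro h
  have h1 : b - 1 ∣ b := by simpa using h 0
  exact hb.not_isUnit (isUnit_of_dvd_one (by simpa using dvd_sub h1 (dvd_refl (b - 1))))

variable (z : Fin r → K⟦X⟧) (n : ℕ)

/-- The polynomial `y_m ^ s + x ^ t (x - 1)` in `R_m`. -/
noncomputable abbrev fR (s t : ℕ) : Rm z n := eqn (R₀.xR z) n s t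

theorem fR_eq (s t : ℕ) :
    fR z n s t = y z n (Fin.last n) ^ s + x z n ^ t * (x z n - 1) := rfl

theorem x_eq : x z n = MvPolynomial.C (R₀.xR z) := rfl

theorem prime_x : Prime (x z n) := (MvPolynomial.prime_C_iff _).2 (R₀.prime_xR z)

theorem exists_x_pow_mul_eq_map (g : Rm z n) :
    ∃ (k : ℕ) (q : MvPolynomial (Fin (n + 1)) (MvPolynomial (Fin r) K[X])),
      x z n ^ k * g = MvPolynomial.map (R₀.ofPoly z).toRingHom q := by
  induction g using MvPolynomial.induction_on with
  | C a =>
    obtain ⟨k, q, hq⟩ := R₀.exists_xR_pow_mul_eq_ofPoly z a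
    refine ⟨k, MvPolynomial.C q, ?_⟩
    rw [MvPolynomial.map_C, x_eq, ← map_pow, ← map_mul, hq]
    rfl
  | add a b ha hb =>
    obtain ⟨k, q, hq⟩ := ha
    obtain ⟨l, q', hq'⟩ := hb
    let X' : MvPolynomial (Fin (n + 1)) (MvPolynomial (Fin r) K[X]) :=
      MvPolynomial.C (MvPolynomial.C Polynomial.X)
    have hX : MvPolynomial.map (R₀.ofPoly z).toRingHom X' = x z n := by
      rw [MvPolynomial.map_C, x_eq]
      exact congrArg _ (R₀.ofPoly_C_X z)
    refine ⟨k + l, X' ^ l * q + X' ^ k * q', ?_⟩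
    rw [map_add, map_mul, map_mul, map_pow, map_pow, hX, ← hq, ← hq']
    ring
  | mul_X a i ha =>
    obtain ⟨k, q, hq⟩ := ha
    exact ⟨k, q * MvPolynomial.X i, by rw [map_mul, ← hq, MvPolynomial.map_X, mul_assoc]⟩

variable {z}

/-- Over `K[x, z_1, …, z_r]` the polynomial is prime by Eisenstein at `x - 1`. This passes to `R_m`
because elements of `R_m` become polynomial after multiplication by a power of `x`. Those powers can
be cancelled again, as `x` is prime in `R_m` and does not divide `f`. -/
theorem prime_fR (hz : AlgIndep z) {s t : ℕ} (hs : 0 < s) (ht : 0 < t) :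
    Prime (fR z n s t) := by
  set ι := MvPolynomial.map (σ := Fin (n + 1)) (R₀.ofPoly z).toRingHom with hι
  have hinj : Function.Injective ι := MvPolynomial.map_injective _ (R₀.ofPoly_injective hz)
  let X' : MvPolynomial (Fin (n + 1)) (MvPolynomial (Fin r) K[X]) :=
    MvPolynomial.C (MvPolynomial.C Polynomial.X)
  have hX : ι X' = x z n := by
    rw [hι, MvPolynomial.map_C, x_eq]
    exact congrArg _ (R₀.ofPoly_C_X z)
  let f' : MvPolynomial (Fin (n + 1)) (MvPolynomial (Fin r) K[X]) :=
    eqn (MvPolynomial.C Polynomial.X) n s t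
  have hf' : ι f' = fR z n s t := by
    rw [hι, map_eqn]
    exact congrArg (fun b => eqn b n s t) (R₀.ofPoly_C_X z)
  have hf'p : Prime f' := by
    refine prime_eqn_of_prime _ ?_ n hs t
    have : (MvPolynomial.C Polynomial.X - 1 : MvPolynomial (Fin r) K[X]) =
        MvPolynomial.C (Polynomial.X - Polynomial.C 1) := by simp
    rw [this]
    exact (MvPolynomial.prime_C_iff _).2 (Polynomial.prime_X_sub_C 1)
  have hxf' : ¬ f' ∣ X' := by
    intro h
    -- Evaluation at `x = 1`, `z = 0`, `y = 0` kills `f'` but not `x`.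
    let e : MvPolynomial (Fin (n + 1)) (MvPolynomial (Fin r) K[X]) →+* K :=
      MvPolynomial.eval₂Hom (MvPolynomial.eval₂Hom (Polynomial.evalRingHom 1) (fun _ => 0))
        (fun _ => 0)
    have h1 := map_dvd e h
    have h2 : e f' = 0 := by simp [e, f', eqn, hs.ne']
    have h3 : e X' = 1 := by simp [e, X']
    rw [h2, h3] at h1
    exact zero_ne_one (zero_dvd_iff.1 h1).symm
  have hxf : ¬ x z n ∣ fR z n s t := by
    intro h
    let e : Rm z n →+* K := MvPolynomial.eval₂Hom (R₀.ev z).toRingHom (fun _ => 1)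
    have h1 := map_dvd e h
    have h4 : (R₀.ev z).toRingHom (R₀.xR z) = 0 := R₀.ev_xR z
    have h2 : e (x z n) = 0 := by
      simp only [e, x_eq, MvPolynomial.coe_eval₂Hom, MvPolynomial.eval₂_C, h4]
    have h3 : e (fR z n s t) = 1 + 0 ^ t * (0 - 1) := by
      simp only [fR, eqn, e, map_add, map_mul, map_pow, map_sub, map_one,
        MvPolynomial.coe_eval₂Hom, MvPolynomial.eval₂_C, MvPolynomial.eval₂_X, h4, one_pow]
    rw [h2, h3, zero_dvd_iff, zero_pow ht.ne', zero_mul, add_zero] at h1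
    exact one_ne_zero h1
  have hcancel : ∀ (k : ℕ) (a : Rm z n), fR z n s t ∣ x z n ^ k * a → fR z n s t ∣ a := by
    intro k
    induction k with
    | zero => intro a h; simpa using h
    | succ k ih =>
      intro a h
      refine ih a ?_
      obtain ⟨q, hq⟩ := h
      have h1 : x z n ∣ fR z n s t * q := ⟨x z n ^ k * a, by rw [← hq]; ring⟩
      obtain ⟨q', rfl⟩ := ((prime_x z n).dvd_or_dvd h1).resolve_left hxf
      refine ⟨q', mul_left_cancel₀ (prime_x z n).ne_zero ?_⟩
      linear_combination hq
  refine ⟨fun h => hf'p.ne_zero (hinj (by rw [hf', h, map_zero])), fun h => ?_, fun a b h => ?_⟩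
  · let e : Rm z n →+* K := MvPolynomial.eval₂Hom (R₀.ev z).toRingHom (fun _ => 0)
    have h4 : (R₀.ev z).toRingHom (R₀.xR z) = 0 := R₀.ev_xR z
    have h3 : e (fR z n s t) = 0 := by
      simp only [fR, eqn, e, map_add, map_mul, map_pow, map_sub, map_one,
        MvPolynomial.coe_eval₂Hom, MvPolynomial.eval₂_C, MvPolynomial.eval₂_X, h4]
      rw [zero_pow hs.ne', zero_pow ht.ne']
      simp
    exact not_isUnit_zero (h3 ▸ h.map e)
  · obtain ⟨q, hq⟩ := h
    obtain ⟨k, a', ha'⟩ := exists_x_pow_mul_eq_map z n a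
    obtain ⟨l, b', hb'⟩ := exists_x_pow_mul_eq_map z n b
    obtain ⟨j, q', hq'⟩ := exists_x_pow_mul_eq_map z n q
    have h1 : a' * b' * X' ^ j = f' * (q' * X' ^ (k + l)) := by
      apply hinj
      simp only [map_mul, map_pow, hX, hf']
      rw [← hι] at ha' hb' hq'
      rw [← ha', ← hb', ← hq']
      linear_combination (x z n ^ (k + l + j)) * hq
    rcases hf'p.dvd_or_dvd (Dvd.intro _ h1.symm) with h2 | h2
    · rcases hf'p.dvd_or_dvd h2 with h3 | h3
      · left
        refine hcancel k a ?_
        rw [ha', ← hι, ← hf']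
        exact map_dvd ι h3
      · right
        refine hcancel l b ?_
        rw [hb', ← hι, ← hf']
        exact map_dvd ι h3
    · exact absurd (hf'p.dvd_of_dvd_pow h2) hxf'

end Nagata

/-! ### The semilocal domain `A` -/

namespace Nagata

theorem exists_sub_algebraMap_mem_of_C {K B σ : Type*} [Field K] [CommRing B] [Algebra K B]
    {I : Ideal (MvPolynomial σ B)} (hX : ∀ i, MvPolynomial.X i ∈ I)
    (hC : ∀ b : B, ∃ c : K, MvPolynomial.C b - algebraMap K _ c ∈ I) (g : MvPolynomial σ B) :
    ∃ c : K, g - algebraMap K _ c ∈ I := by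
  induction g using MvPolynomial.induction_on with
  | C b => exact hC b
  | add a b ha hb =>
    obtain ⟨c, hc⟩ := ha
    obtain ⟨d, hd⟩ := hb
    exact ⟨c + d, by rw [map_add, add_sub_add_comm]; exact add_mem hc hd⟩
  | mul_X a i _ => exact ⟨0, by simpa using I.mul_mem_left _ (hX i)⟩

/-- `I` has codimension at most 1 over `K` and lies in the kernel of `ε`, a proper ideal; hence the
two agree. -/
theorem mem_iff_of_forall_exists_sub_algebraMap_mem {K B : Type*} [Field K] [CommRing B]
    [Algebra K B] {I : Ideal B} (hI : ∀ b : B, ∃ c : K, b - algebraMap K B c ∈ I)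
    (ε : B →ₐ[K] K) (hε : ∀ b ∈ I, ε b = 0) {b : B} : b ∈ I ↔ ε b = 0 := by
  refine ⟨hε b, fun h => ?_⟩
  obtain ⟨c, hc⟩ := hI b
  have h1 := hε _ hc
  rw [map_sub, AlgHom.commutes, h, zero_sub, neg_eq_zero] at h1
  simpa [show c = 0 from h1] using hc

variable {K : Type*} [Field K] {r : ℕ} (z : Fin r → K⟦X⟧) (n : ℕ)

theorem exists_sub_mem_𝔪 (g : Rm z n) : ∃ c : K, g - algebraMap K _ c ∈ 𝔪 z n := by
  refine exists_sub_algebraMap_mem_of_C (fun i => Ideal.subset_span (Or.inr ⟨i, rfl⟩))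
    (fun b => ?_) g
  obtain ⟨c, b', rfl⟩ := R₀.exists_eq_add_xR_mul z b
  refine ⟨c, ?_⟩
  rw [map_add, map_mul, MvPolynomial.algebraMap_apply, add_sub_cancel_left]
  exact Ideal.mul_mem_right _ _ (Ideal.subset_span (Or.inl rfl))

theorem exists_sub_mem_𝔫 (g : Rm z n) : ∃ c : K, g - algebraMap K _ c ∈ 𝔫 z n := by
  refine exists_sub_algebraMap_mem_of_C (fun i => Ideal.subset_span (Or.inr ⟨i, rfl⟩))
    (fun b => ?_) g
  obtain ⟨c, hc⟩ := R₀.exists_sub_mem_span z b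
  refine ⟨c, ?_⟩
  rw [MvPolynomial.algebraMap_apply, ← map_sub]
  have h1 := Ideal.mem_map_of_mem (MvPolynomial.C (σ := Fin (n + 1))) hc
  rw [Ideal.map_span] at h1
  refine Ideal.span_mono ?_ h1
  rintro _ ⟨b, rfl | ⟨i, rfl⟩, rfl⟩
  · exact Or.inl (Or.inl (by rw [map_sub, map_one]; rfl))
  · exact Or.inl (Or.inr ⟨i, rfl⟩)

/-- Algebra homomorphisms from `R_m`. -/
noncomputable def liftRm {C : Type*} [CommRing C] [Algebra K C] (θ : R₀ z →ₐ[K] C)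
    (η : Fin (n + 1) → C) : Rm z n →ₐ[K] C :=
  MvPolynomial.aevalTower θ η

section liftRm

variable {z n} {C : Type*} [CommRing C] [Algebra K C] (θ : R₀ z →ₐ[K] C) (η : Fin (n + 1) → C)

@[simp] theorem liftRm_C (b : R₀ z) : liftRm z n θ η (MvPolynomial.C b) = θ b := by
  simp [liftRm]

@[simp] theorem liftRm_x : liftRm z n θ η (x z n) = θ (R₀.xR z) := liftRm_C θ η _

@[simp] theorem liftRm_zel (i : Fin r) : liftRm z n θ η (zel z n i) = θ (R₀.zR z i) :=
  liftRm_C θ η _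

@[simp] theorem liftRm_y (i : Fin (n + 1)) : liftRm z n θ η (y z n i) = η i := by
  simp [liftRm, y]

theorem liftRm_fR (s t : ℕ) : liftRm z n θ η (fR z n s t) =
    η (Fin.last n) ^ s + θ (R₀.xR z) ^ t * (θ (R₀.xR z) - 1) := by
  rw [fR_eq]
  simp

end liftRm

/-- The residue map at `𝔪_m`. -/
noncomputable def εm : Rm z n →ₐ[K] K := liftRm z n (R₀.ev z) fun _ => 0

theorem mem_𝔪_iff {g : Rm z n} : g ∈ 𝔪 z n ↔ εm z n g = 0 := by
  refine mem_iff_of_forall_exists_sub_algebraMap_mem (exists_sub_mem_𝔪 z n) _ fun b hb => ?_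
  have : 𝔪 z n ≤ RingHom.ker (εm z n) := by
    refine Ideal.span_le.2 ?_
    rintro _ (rfl | ⟨i, rfl⟩)
    · simp [RingHom.mem_ker, εm]
    · simp [RingHom.mem_ker, εm]
  exact this hb

instance : (𝔪 z n).IsPrime := by
  have : 𝔪 z n = RingHom.ker (εm z n) := Ideal.ext fun g => mem_𝔪_iff z n
  rw [this]
  exact RingHom.ker_isPrime (εm z n).toRingHom

section

variable {z} (hz : AlgIndep z)

/-- The residue map at `𝔫_m`. -/
noncomputable def εn : Rm z n →ₐ[K] K :=
  liftRm z n (R₀.exists_algHom hz (isUnit_one (M := K)) fun _ => 0).choose fun _ => 0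

theorem mem_𝔫_iff {g : Rm z n} : g ∈ 𝔫 z n ↔ εn n hz g = 0 := by
  have h := (R₀.exists_algHom hz (isUnit_one (M := K)) fun _ => 0).choose_spec
  refine mem_iff_of_forall_exists_sub_algebraMap_mem (exists_sub_mem_𝔫 z n) _ fun b hb => ?_
  have : 𝔫 z n ≤ RingHom.ker (εn n hz) := by
    refine Ideal.span_le.2 ?_
    rintro _ ((rfl | ⟨i, rfl⟩) | ⟨i, rfl⟩)
    · simp [RingHom.mem_ker, εn, h.1]
    · simp [RingHom.mem_ker, εn, h.2]
    · simp [RingHom.mem_ker, εn]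
  exact this hb

include hz in
theorem isPrime_𝔫 : (𝔫 z n).IsPrime := by
  have : 𝔫 z n = RingHom.ker (εn n hz) := Ideal.ext fun g => mem_𝔫_iff n hz
  rw [this]
  exact RingHom.ker_isPrime (εn n hz).toRingHom

theorem mem_S_iff {g : Rm z n} : g ∈ S z n ↔ εm z n g ≠ 0 ∧ εn n hz g ≠ 0 := by
  have := isPrime_𝔫 n hz
  rw [← SetLike.mem_coe, S, coe_closure_compl_union, Set.mem_compl_iff, Set.mem_union, not_or,
    SetLike.mem_coe, SetLike.mem_coe, mem_𝔪_iff, mem_𝔫_iff n hz]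

end

variable (s t : ℕ)

/-- The canonical map `R_m → A` as an algebra homomorphism. -/
noncomputable def toAₐ : Rm z n →ₐ[K] A z n s t :=
  { toA z n s t with
    commutes' := fun c => by
      change algebraMap (Am z n) (A z n s t) (algebraMap (Rm z n) (Am z n) (algebraMap K _ c)) = _
      rw [← IsScalarTower.algebraMap_apply K (Rm z n) (Am z n),
        ← IsScalarTower.algebraMap_apply K (Am z n) (A z n s t)] }

theorem toA_algebraMap (c : K) : toA z n s t (algebraMap K _ c) = algebraMap K _ c :=
  (toAₐ z n s t).commutes c

theorem f_eq : f z n s t = algebraMap (Rm z n) (Am z n) (fR z n s t) := rfl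

theorem algebraMap_Am_surjective : Function.Surjective (algebraMap (Am z n) (A z n s t)) :=
  Ideal.Quotient.mk_surjective

theorem algebraMap_Am_eq_zero_iff {a : Am z n} :
    algebraMap (Am z n) (A z n s t) a = 0 ↔ f z n s t ∣ a :=
  Ideal.Quotient.eq_zero_iff_mem.trans Ideal.mem_span_singleton

theorem isUnit_toA {g : Rm z n} (hg : g ∈ S z n) : IsUnit (toA z n s t g) :=
  (IsLocalization.map_units (Am z n) (⟨g, hg⟩ : S z n)).map (algebraMap (Am z n) (A z n s t))

theorem exists_toA_mul_eq (a : A z n s t) :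
    ∃ u ∈ S z n, ∃ g, toA z n s t u * a = toA z n s t g := by
  obtain ⟨a, rfl⟩ := algebraMap_Am_surjective z n s t a
  obtain ⟨g, u, rfl⟩ := IsLocalization.exists_mk'_eq (S z n) a
  refine ⟨u, u.2, g, ?_⟩
  rw [toA, RingHom.comp_apply, RingHom.comp_apply, ← map_mul, mul_comm, IsLocalization.mk'_spec]

@[simp] theorem toA_fR : toA z n s t (fR z n s t) = 0 :=
  (algebraMap_Am_eq_zero_iff z n s t).2 dvd_rfl

theorem toA_relation : toA z n s t (y z n (Fin.last n)) ^ s +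
    toA z n s t (x z n) ^ t * (toA z n s t (x z n) - 1) = 0 := by
  rw [← toA_fR z n s t, fR_eq, map_add, map_mul, map_pow, map_pow, map_sub, map_one]

/-- Homomorphisms from `A` are given by homomorphisms from `R_m`. -/
theorem exists_lift_A {C : Type*} [CommRing C] [Algebra K C] (φ : Rm z n →ₐ[K] C)
    (hS : ∀ g, g ∉ 𝔪 z n → g ∉ 𝔫 z n → IsUnit (φ g)) (hf : φ (fR z n s t) = 0) :
    ∃ Φ : A z n s t →ₐ[K] C, ∀ g, Φ (toA z n s t g) = φ g := by
  have hS' : ∀ g : S z n, IsUnit (φ.toRingHom g) := by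
    rintro ⟨g, hg⟩
    refine Submonoid.closure_induction (fun g hg => ?_) ?_ (fun a b _ _ ha hb => ?_) hg
    · exact hS g (fun h => hg (Or.inl h)) (fun h => hg (Or.inr h))
    · simp
    · rw [map_mul]; exact ha.mul hb
  let φ' : Am z n →+* C := IsLocalization.lift hS'
  have hφ' : ∀ g, φ' (algebraMap (Rm z n) (Am z n) g) = φ g := IsLocalization.lift_eq hS'
  have hker : ∀ a ∈ Ideal.span {f z n s t}, φ' a = 0 := by
    intro a ha
    obtain ⟨b, rfl⟩ := Ideal.mem_span_singleton.1 ha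
    rw [map_mul, f_eq, hφ', hf, zero_mul]
  let Φ : A z n s t →+* C := Ideal.Quotient.lift _ φ' hker
  have hΦ : ∀ g, Φ (toA z n s t g) = φ g := fun g => hφ' g
  have hc : ∀ c, Φ (algebraMap K _ c) = algebraMap K C c := fun c => by
    rw [← toA_algebraMap]
    exact (hΦ _).trans (φ.commutes c)
  exact ⟨{ Φ with commutes' := hc }, hΦ⟩

variable {z s t} (hz : AlgIndep z) (hs : 0 < s) (ht : 0 < t)

include hs ht in
theorem εm_fR : εm z n (fR z n s t) = 0 := by
  rw [εm, liftRm_fR, R₀.ev_xR, zero_pow hs.ne', zero_pow ht.ne']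
  simp

include hs in
theorem εn_fR : εn n hz (fR z n s t) = 0 := by
  have h := (R₀.exists_algHom hz (isUnit_one (M := K)) fun _ => 0).choose_spec
  rw [εn, liftRm_fR, h.1, zero_pow hs.ne']
  simp

include hz hs ht in
-- `f` is prime and lies in `𝔪_m`, so it divides no denominator, and localizing adds nothing to the
-- kernel.
theorem toA_eq_zero_iff {g : Rm z n} : toA z n s t g = 0 ↔ fR z n s t ∣ g := by
  have hp := prime_fR n hz hs ht
  constructor
  · intro h
    obtain ⟨a, ha⟩ := (algebraMap_Am_eq_zero_iff z n s t).1 h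
    obtain ⟨b, u, rfl⟩ := IsLocalization.exists_mk'_eq (S z n) a
    change algebraMap (Rm z n) (Am z n) g = _ at ha
    have h1 : algebraMap (Rm z n) (Am z n) (g * u) =
        algebraMap (Rm z n) (Am z n) (fR z n s t * b) := by
      rw [map_mul, ha, map_mul, f_eq, mul_assoc, IsLocalization.mk'_spec]
    obtain ⟨v, hv⟩ := (IsLocalization.eq_iff_exists (S z n) _).1 h1
    have h2 : fR z n s t ∣ (v * u : Rm z n) * g := ⟨v * b, by linear_combination hv⟩
    refine (hp.dvd_or_dvd h2).resolve_left fun h3 => ?_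
    have h4 := ((mem_S_iff n hz).1 (mul_mem v.2 u.2)).1
    obtain ⟨w, hw⟩ := h3
    rw [hw, map_mul, εm_fR n hs ht, zero_mul] at h4
    exact h4 rfl
  · rintro ⟨b, rfl⟩
    rw [map_mul, toA_fR, zero_mul]

include hz hs ht in
theorem exists_toA_mul_eq_ne_zero {a : A z n s t} (ha : a ≠ 0) :
    ∃ u ∈ S z n, ∃ g, toA z n s t u * a = toA z n s t g ∧ ¬ fR z n s t ∣ g := by
  obtain ⟨u, hu, g, hg⟩ := exists_toA_mul_eq z n s t a
  refine ⟨u, hu, g, hg, fun h => ha ?_⟩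
  rw [← toA_eq_zero_iff n hz hs ht, ← hg] at h
  exact (isUnit_toA z n s t hu).mul_right_eq_zero.1 h

include hz hs ht in
theorem isDomain_A : IsDomain (A z n s t) := by
  have hp := prime_fR n hz hs ht
  have h1 : Nontrivial (A z n s t) := by
    refine ⟨1, 0, fun h => hp.not_isUnit ?_⟩
    rw [← map_one (toA z n s t), toA_eq_zero_iff n hz hs ht] at h
    exact isUnit_of_dvd_one h
  have h2 : NoZeroDivisors (A z n s t) := by
    refine ⟨fun {a b} hab => ?_⟩
    by_contra! hne
    obtain ⟨u, hu, g, hg, hg'⟩ := exists_toA_mul_eq_ne_zero n hz hs ht hne.1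
    obtain ⟨v, hv, h, hh, hh'⟩ := exists_toA_mul_eq_ne_zero n hz hs ht hne.2
    have h3 : toA z n s t (g * h) = 0 := by
      rw [map_mul, ← hg, ← hh]
      linear_combination (toA z n s t u * toA z n s t v) * hab
    rw [toA_eq_zero_iff n hz hs ht] at h3
    exact (hp.dvd_or_dvd h3).elim hg' hh'
  exact NoZeroDivisors.to_isDomain _

section

include hs ht in
variable (z) in
theorem exists_χm : ∃ χ : A z n s t →ₐ[K] K, ∀ g, χ (toA z n s t g) = εm z n g :=
  exists_lift_A z n s t (εm z n) (fun _ hg _ => isUnit_iff_ne_zero.2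
    (fun h => hg ((mem_𝔪_iff z n).2 h))) (εm_fR n hs ht)

include hs in
theorem exists_χn : ∃ χ : A z n s t →ₐ[K] K, ∀ g, χ (toA z n s t g) = εn n hz g :=
  exists_lift_A z n s t (εn n hz) (fun _ _ hg => isUnit_iff_ne_zero.2
    (fun h => hg ((mem_𝔫_iff n hz).2 h))) (εn_fR n hz hs)

/-- The residue map of `A` at the maximal ideal above `𝔪_m`. -/
noncomputable def χm : A z n s t →ₐ[K] K := (exists_χm z n hs ht).choose

theorem χm_toA (g : Rm z n) : χm n hs ht (toA z n s t g) = εm z n g :=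
  (exists_χm z n hs ht).choose_spec g

/-- The residue map of `A` at the maximal ideal above `𝔫_m`. -/
noncomputable def χn : A z n s t →ₐ[K] K := (exists_χn n hz hs).choose

theorem χn_toA (g : Rm z n) : χn n hz hs (t := t) (toA z n s t g) = εn n hz g :=
  (exists_χn n hz hs).choose_spec g

theorem isUnit_A_iff {a : A z n s t} : IsUnit a ↔ χm n hs ht a ≠ 0 ∧ χn n hz hs a ≠ 0 := by
  refine ⟨fun h => ⟨(h.map (χm n hs ht)).ne_zero, (h.map (χn n hz hs)).ne_zero⟩, fun h => ?_⟩
  obtain ⟨u, hu, g, hg⟩ := exists_toA_mul_eq z n s t a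
  have hu' := (mem_S_iff n hz).1 hu
  have hgS : g ∈ S z n := by
    rw [mem_S_iff n hz, ← χm_toA n hs ht, ← χn_toA n hz hs (t := t), ← hg, map_mul, map_mul,
      χm_toA, χn_toA]
    exact ⟨mul_ne_zero hu'.1 h.1, mul_ne_zero hu'.2 h.2⟩
  have h1 := isUnit_toA z n s t hgS
  rw [← hg] at h1
  exact isUnit_of_mul_isUnit_right h1

theorem mem_jacobson_iff {a : A z n s t} :
    a ∈ Ideal.jacobson (⊥ : Ideal (A z n s t)) ↔ χm n hs ht a = 0 ∧ χn n hz hs a = 0 := by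
  rw [Ideal.mem_jacobson_bot]
  constructor
  · intro h
    constructor
    · by_contra h0
      -- With this scalar `y`, the element `a * y + 1` vanishes under `χm` and cannot be a unit.
      have h1 := h (algebraMap K _ (-(χm n hs ht a)⁻¹))
      rw [isUnit_A_iff n hz hs ht] at h1
      refine h1.1 ?_
      simp [h0]
    · by_contra h0
      have h1 := h (algebraMap K _ (-(χn n hz hs a)⁻¹))
      rw [isUnit_A_iff n hz hs ht] at h1
      refine h1.2 ?_
      simp [h0]
  · rintro ⟨h1, h2⟩ b
    rw [isUnit_A_iff n hz hs ht]
    simp [h1, h2]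

end

end Nagata

/-! ### The ring `A` is Noetherian -/

namespace Nagata

variable {K : Type*} [Field K] {r : ℕ} {z : Fin r → K⟦X⟧} (n : ℕ) {s t : ℕ}

theorem isNoetherianRing_localization_A (Q : Ideal (A z n s t)) [Q.IsPrime] {B : Type*}
    [CommRing B] [IsNoetherianRing B] (β : B →+* Localization.AtPrime Q)
    (h : ∀ g : Rm z n, ∃ u : Localization.AtPrime Q, IsUnit u ∧
      u * algebraMap (A z n s t) _ (toA z n s t g) ∈ β.range) :
    IsNoetherianRing (Localization.AtPrime Q) := by
  refine isNoetherianRing_of_forall_exists_isUnit_mul β fun v => ?_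
  obtain ⟨a, w, rfl⟩ := IsLocalization.exists_mk'_eq Q.primeCompl v
  obtain ⟨u, hu, g, hg⟩ := exists_toA_mul_eq z n s t a
  obtain ⟨u', hu', hr⟩ := h g
  refine ⟨u' * algebraMap _ _ (toA z n s t u) * algebraMap _ _ (w : A z n s t),
    (hu'.mul ((isUnit_toA z n s t hu).map _)).mul (IsLocalization.map_units _ w), ?_⟩
  rw [mul_assoc, mul_comm (algebraMap (A z n s t) (Localization.AtPrime Q) (w : A z n s t)),
    IsLocalization.mk'_spec, mul_assoc, ← map_mul, hg]
  exact hr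

variable (hz : AlgIndep z) (hs : 0 < s) (ht : 0 < t)

instance isMaximal_ker_χm : (RingHom.ker (χm (z := z) n hs ht).toRingHom).IsMaximal :=
  RingHom.ker_isMaximal_of_surjective _ fun c => ⟨algebraMap K _ c, (χm n hs ht).commutes c⟩

instance isMaximal_ker_χn : (RingHom.ker (χn n hz hs (t := t)).toRingHom).IsMaximal :=
  RingHom.ker_isMaximal_of_surjective _ fun c => ⟨algebraMap K _ c, (χn n hz hs).commutes c⟩

theorem eq_ker_of_isMaximal {Q : Ideal (A z n s t)} (hQ : Q.IsMaximal) :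
    Q = RingHom.ker (χm n hs ht).toRingHom ∨ Q = RingHom.ker (χn n hz hs).toRingHom := by
  have h1 : (Q : Set (A z n s t)) ⊆
      (RingHom.ker (χm (z := z) n hs ht).toRingHom : Set (A z n s t)) ∪
      (RingHom.ker (χn n hz hs (t := t)).toRingHom : Set (A z n s t)) := by
    intro a ha
    by_contra h
    rw [Set.mem_union, not_or] at h
    exact hQ.ne_top (Ideal.eq_top_of_isUnit_mem _ ha ((isUnit_A_iff n hz hs ht).2 h))
  rw [Ideal.subset_union] at h1
  exact h1.imp (hQ.eq_of_le (isMaximal_ker_χm n hs ht).ne_top)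
    (hQ.eq_of_le (isMaximal_ker_χn n hz hs).ne_top)

include hz hs ht in
-- It suffices to look at the two maximal ideals. At the first, elements of `R_m` come from a
-- polynomial ring over `R_0` localized at `x`. At the second, `x` is a unit and elements come, up
-- to powers of it, from `K[x, z_1, …, z_r, y_1, …, y_m]`.
theorem isNoetherianRing_A : IsNoetherianRing (A z n s t) := by
  have hfin : Finite (MaximalSpectrum (A z n s t)) := by
    have : (Set.univ : Set (MaximalSpectrum (A z n s t))) ⊆
        {⟨_, isMaximal_ker_χm n hs ht⟩, ⟨_, isMaximal_ker_χn n hz hs⟩} := by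
      intro Q _
      exact (eq_ker_of_isMaximal n hz hs ht Q.isMaximal).imp
        (MaximalSpectrum.ext ·) (MaximalSpectrum.ext ·)
    exact Set.finite_univ_iff.1 ((Set.toFinite _).subset this)
  refine isNoetherianRing_of_localization_maximal fun Q hQ => ?_
  let γ : Rm z n →+* Localization.AtPrime Q := (algebraMap _ _).comp (toA z n s t)
  have hγ : ∀ a : A z n s t, a ∉ Q → IsUnit (algebraMap (A z n s t) (Localization.AtPrime Q) a) :=
    fun a ha => IsLocalization.map_units _ (⟨a, ha⟩ : Q.primeCompl)
  rcases eq_ker_of_isMaximal n hz hs ht hQ with h | h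
  · have h1 : ∀ b : (Ideal.span {R₀.xR z}).primeCompl,
        IsUnit ((γ.comp MvPolynomial.C) (b : R₀ z)) := by
      intro b
      refine hγ _ fun hb => b.2 ?_
      rw [h] at hb
      have h2 : χm n hs ht (toA z n s t (MvPolynomial.C b)) = 0 := hb
      rw [χm_toA, εm, liftRm_C] at h2
      exact Ideal.mem_span_singleton.2 ((R₀.xR_dvd_iff z).2 h2)
    let β : MvPolynomial (Fin (n + 1)) (Localization.AtPrime (Ideal.span {R₀.xR z})) →+*
        Localization.AtPrime Q :=
      MvPolynomial.eval₂Hom (IsLocalization.lift h1) fun i => γ (MvPolynomial.X i)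
    have hβ : β.comp (MvPolynomial.map (algebraMap (R₀ z) _)) = γ := by
      ext i
      · simp [β, IsLocalization.lift_eq h1]
      · simp [β]
    refine isNoetherianRing_localization_A n Q β fun g => ⟨1, isUnit_one, ?_⟩
    rw [one_mul]
    exact ⟨_, RingHom.congr_fun hβ g⟩
  · let m : MvPolynomial (Fin (n + 1)) (MvPolynomial (Fin r) K[X]) →+* Rm z n :=
      MvPolynomial.map (R₀.ofPoly z).toRingHom
    have hx : IsUnit (γ (x z n)) := by
      refine hγ _ fun hb => ?_
      rw [h] at hb
      have h2 : χn n hz hs (toA z n s t (x z n)) = 0 := hb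
      have h3 := (R₀.exists_algHom hz (isUnit_one (M := K)) fun _ => 0).choose_spec
      rw [χn_toA, εn, liftRm_x, h3.1] at h2
      exact one_ne_zero h2
    refine isNoetherianRing_localization_A n Q
      (B := MvPolynomial (Fin (n + 1)) (MvPolynomial (Fin r) K[X])) (γ.comp m) fun g => ?_
    obtain ⟨k, q, hq⟩ := exists_x_pow_mul_eq_map z n g
    refine ⟨γ (x z n) ^ k, hx.pow k, q, ?_⟩
    rw [RingHom.comp_apply, ← hq, map_mul, map_pow]
    rfl

/-! ### Coordinates of `A` at its two maximal ideals -/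

section Coordinates

open MvPowerSeries (orderIdeal)

theorem order_X {σ κ : Type*} [Field κ] (i : σ) :
    (MvPowerSeries.X i : MvPowerSeries σ κ).order = 1 := by
  rw [MvPowerSeries.X, MvPowerSeries.order_monomial_of_ne_zero one_ne_zero]
  simp

theorem order_pow {σ κ : Type*} [Field κ] (w : MvPowerSeries σ κ) (k : ℕ) :
    (w ^ k).order = k * w.order := by
  induction k with
  | zero => simp [MvPowerSeries.order, MvPowerSeries.weightedOrder_one]
  | succ k ih => rw [pow_succ, MvPowerSeries.order_mul, ih]; push_cast; ring

theorem order_eq_zero {σ κ : Type*} [Field κ] {w : MvPowerSeries σ κ}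
    (hw : MvPowerSeries.constantCoeff w ≠ 0) : w.order = 0 := by
  by_contra h
  exact hw (MvPowerSeries.order_ne_zero_iff_constCoeff_eq_zero.1 h)

/-- The local equation of `A` at the maximal ideal above `𝔪_m`. -/
noncomputable def eqm {σ : Type*} (κ : Type*) [Field κ] (i j : σ) (s t : ℕ) : MvPolynomial σ κ :=
  MvPolynomial.X j ^ s + MvPolynomial.X i ^ t * (MvPolynomial.X i - 1)

theorem coe_eqm {σ κ : Type*} [Field κ] (i j : σ) (s t : ℕ) :
    (eqm κ i j s t : MvPowerSeries σ κ) = MvPowerSeries.X j ^ s +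
      MvPowerSeries.X i ^ t * (MvPowerSeries.X i - 1) := by
  have := map_sub (MvPolynomial.coeToMvPowerSeries.ringHom (σ := σ) (R := κ))
    (MvPolynomial.X i) 1
  simp only [MvPolynomial.coeToMvPowerSeries.ringHom_apply, MvPolynomial.coe_X,
    MvPolynomial.coe_one] at this
  simp [eqm, this]

/-- The monomial `X_i ^ t` has coefficient `-1`, and `t ≤ s` keeps `X_j ^ s` from lowering the
order. -/
theorem order_eqm {σ κ : Type*} [Field κ] {i j : σ} (hij : i ≠ j) {s t : ℕ} (ht : 0 < t)
    (hts : t ≤ s) : (eqm κ i j s t : MvPowerSeries σ κ).order = t := by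
  classical
  rw [coe_eqm]
  refine le_antisymm ?_ ?_
  · refine (MvPowerSeries.order_le (d := Finsupp.single i t) ?_).trans ?_
    · rw [mul_sub, mul_one, ← pow_succ, map_add, map_sub, MvPowerSeries.coeff_X_pow,
        MvPowerSeries.coeff_X_pow, MvPowerSeries.coeff_X_pow, if_neg, if_neg, if_pos rfl]
      · simp
      · intro h
        have := DFunLike.congr_fun h i
        simp at this
      · intro h
        have := DFunLike.congr_fun h i
        simp [hij.symm] at this
        omega
    · simp
  · refine le_trans (le_min ?_ ?_) MvPowerSeries.min_order_le_add
    · rw [order_pow, order_X, mul_one]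
      exact_mod_cast hts
    · rw [MvPowerSeries.order_mul, order_pow, order_X, mul_one]
      exact le_self_add

/-- The local equation of `A` at the maximal ideal above `𝔫_m`. -/
noncomputable def eqn' {σ : Type*} (κ : Type*) [Field κ] (i j : σ) (s t : ℕ) : MvPolynomial σ κ :=
  MvPolynomial.X j ^ s + (1 + MvPolynomial.X i) ^ t * MvPolynomial.X i

theorem coe_eqn' {σ κ : Type*} [Field κ] (i j : σ) (s t : ℕ) :
    (eqn' κ i j s t : MvPowerSeries σ κ) = MvPowerSeries.X j ^ s +
      (1 + MvPowerSeries.X i) ^ t * MvPowerSeries.X i := by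
  simp [eqn']

/-- The coordinate `X_i` stands for `x - 1`, so `1 + X_i` is a unit and the second summand has order
1, less than `s`. -/
theorem order_eqn' {σ κ : Type*} [Field κ] (i j : σ) {s : ℕ} (hs : 1 < s) (t : ℕ) :
    (eqn' κ i j s t : MvPowerSeries σ κ).order = (1 : ℕ) := by
  have h1 : (MvPowerSeries.X j ^ s : MvPowerSeries σ κ).order = s := by
    rw [order_pow, order_X, mul_one]
  have h2 : ((1 + MvPowerSeries.X i) ^ t * MvPowerSeries.X i : MvPowerSeries σ κ).order = 1 := by
    rw [MvPowerSeries.order_mul, order_pow, order_X, order_eq_zero (by simp), mul_zero, zero_add]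
  rw [coe_eqn', MvPowerSeries.order_add_of_order_ne, h1, h2]
  · rw [Nat.cast_one]
    exact min_eq_right (by exact_mod_cast hs.le)
  · rw [h1, h2]
    exact_mod_cast hs.ne'

theorem isUnit_of_notMem_span {κ B σ : Type*} [CommRing B] [Algebra K B] [Field κ]
    [Algebra K κ] {G : Set B} (hG : ∀ b : B, ∃ c : K, b - algebraMap K B c ∈ Ideal.span G)
    (φ : B →ₐ[K] MvPowerSeries σ κ) (hφ : ∀ b ∈ G, MvPowerSeries.constantCoeff (φ b) = 0)
    {b : B} (hb : b ∉ Ideal.span G) : IsUnit (φ b) := by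
  obtain ⟨c, hc⟩ := hG b
  have h1 : Ideal.span G ≤ RingHom.ker ((MvPowerSeries.constantCoeff (σ := σ) (R := κ)).comp
      φ.toRingHom) := Ideal.span_le.2 hφ
  have h2 : MvPowerSeries.constantCoeff (φ (b - algebraMap K B c)) = 0 := h1 hc
  rw [map_sub, map_sub, AlgHom.commutes, sub_eq_zero, MvPowerSeries.algebraMap_apply,
    MvPowerSeries.constantCoeff_C] at h2
  rw [MvPowerSeries.isUnit_iff_constantCoeff, h2, isUnit_iff_ne_zero, ne_eq,
    _root_.map_eq_zero]
  rintro rfl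
  exact hb (by simpa using hc)

/-- The coordinates of `A` at the maximal ideal above `𝔪_m`. -/
noncomputable def bm (z : Fin r → K⟦X⟧) (n s t : ℕ) (i : Option (Fin (n + 1))) : A z n s t :=
  i.elim (toA z n s t (x z n)) fun i => toA z n s t (y z n i)

/-- The coordinates of `A` at the maximal ideal above `𝔫_m`. -/
noncomputable def bn (z : Fin r → K⟦X⟧) (n s t : ℕ) (i : Option (Fin r ⊕ Fin (n + 1))) :
    A z n s t :=
  i.elim (toA z n s t (x z n - 1))
    (Sum.elim (fun i => toA z n s t (zel z n i)) fun i => toA z n s t (y z n i))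

theorem exists_sub_algebraMap_mem_map {I : Ideal (Rm z n)}
    (hI : ∀ g : Rm z n, ∃ c : K, g - algebraMap K _ c ∈ I) (hS : ∀ g ∈ S z n, g ∉ I)
    (a : A z n s t) : ∃ c : K, a - algebraMap K _ c ∈ I.map (toA z n s t) := by
  obtain ⟨u, hu, g, hg⟩ := exists_toA_mul_eq z n s t a
  obtain ⟨c, hc⟩ := hI u
  obtain ⟨d, hd⟩ := hI g
  have hc0 : c ≠ 0 := by
    rintro rfl
    exact hS u hu (by simpa using hc)
  -- As `a = g / u`, its residue is the quotient of the residues of `g` and `u`.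
  refine ⟨d / c, (Ideal.unit_mul_mem_iff_mem _ (isUnit_toA z n s t hu)).1 ?_⟩
  have h1 : toA z n s t u * (a - algebraMap K _ (d / c)) =
      toA z n s t ((g - algebraMap K _ d) - (u - algebraMap K _ c) * algebraMap K _ (d / c)) := by
    have h2 : algebraMap K (Rm z n) d = algebraMap K _ c * algebraMap K _ (d / c) := by
      rw [← map_mul, mul_div_cancel₀ _ hc0]
    rw [h2, mul_sub, hg, ← toA_algebraMap, ← map_mul, ← map_sub]
    congr 1
    ring
  rw [h1]
  exact Ideal.mem_map_of_mem _ (sub_mem hd (I.mul_mem_right _ hc))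

theorem span_bm : Ideal.span (Set.range (bm z n s t)) = (𝔪 z n).map (toA z n s t) := by
  rw [𝔪, Ideal.map_span]
  congr 1
  ext a
  constructor
  · rintro ⟨_ | i, rfl⟩
    · exact ⟨_, Or.inl rfl, rfl⟩
    · exact ⟨_, Or.inr ⟨i, rfl⟩, rfl⟩
  · rintro ⟨_, rfl | ⟨i, rfl⟩, rfl⟩
    · exact ⟨none, rfl⟩
    · exact ⟨some i, rfl⟩

theorem span_bn : Ideal.span (Set.range (bn z n s t)) = (𝔫 z n).map (toA z n s t) := by
  rw [𝔫, Ideal.map_span]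
  congr 1
  ext a
  constructor
  · rintro ⟨_ | i | i, rfl⟩
    · exact ⟨_, Or.inl (Or.inl rfl), rfl⟩
    · exact ⟨_, Or.inl (Or.inr ⟨i, rfl⟩), rfl⟩
    · exact ⟨_, Or.inr ⟨i, rfl⟩, rfl⟩
  · rintro ⟨_, (rfl | ⟨i, rfl⟩) | ⟨i, rfl⟩, rfl⟩
    · exact ⟨none, rfl⟩
    · exact ⟨some (Sum.inl i), rfl⟩
    · exact ⟨some (Sum.inr i), rfl⟩

include hz in
theorem exists_sub_mem_span_bm (a : A z n s t) :
    ∃ c : K, a - algebraMap K _ c ∈ Ideal.span (Set.range (bm z n s t)) := by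
  rw [span_bm]
  exact exists_sub_algebraMap_mem_map n (exists_sub_mem_𝔪 z n) (fun g hg h =>
    ((mem_S_iff n hz).1 hg).1 ((mem_𝔪_iff z n).1 h)) a

include hz in
theorem exists_sub_mem_span_bn (a : A z n s t) :
    ∃ c : K, a - algebraMap K _ c ∈ Ideal.span (Set.range (bn z n s t)) := by
  rw [span_bn]
  exact exists_sub_algebraMap_mem_map n (exists_sub_mem_𝔫 z n) (fun g hg h =>
    ((mem_S_iff n hz).1 hg).2 ((mem_𝔫_iff n hz).1 h)) a

include hz in
theorem mem_span_bm_iff {a : A z n s t} :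
    a ∈ Ideal.span (Set.range (bm z n s t)) ↔ χm n hs ht a = 0 := by
  refine mem_iff_of_forall_exists_sub_algebraMap_mem (exists_sub_mem_span_bm n hz) _ fun b hb => ?_
  rw [span_bm] at hb
  have h : (𝔪 z n).map (toA z n s t) ≤ RingHom.ker (χm n hs ht) :=
    Ideal.map_le_iff_le_comap.2 fun g hg => (χm_toA n hs ht g).trans ((mem_𝔪_iff z n).1 hg)
  exact h hb

theorem mem_span_bn_iff {a : A z n s t} :
    a ∈ Ideal.span (Set.range (bn z n s t)) ↔ χn n hz hs a = 0 := by
  refine mem_iff_of_forall_exists_sub_algebraMap_mem (exists_sub_mem_span_bn n hz) _ fun b hb => ?_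
  rw [span_bn] at hb
  have h : (𝔫 z n).map (toA z n s t) ≤ RingHom.ker (χn n hz hs (t := t)) :=
    Ideal.map_le_iff_le_comap.2 fun g hg => (χn_toA n hz hs g).trans ((mem_𝔫_iff n hz).1 hg)
  exact h hb

theorem aeval_bm : MvPolynomial.aeval (bm z n s t) (eqm K none (some (Fin.last n)) s t) = 0 := by
  rw [← toA_relation z n s t]
  simp [eqm, bm]

theorem aeval_bn : MvPolynomial.aeval (bn z n s t)
    (eqn' K none (some (Sum.inr (Fin.last n))) s t) = 0 := by
  rw [← toA_relation z n s t]
  simp [eqn', bn]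

/-- The map from `A` to its completion at the maximal ideal above `𝔪_m`. -/
theorem exists_Φm : ∃ Φ : A z n s t →ₐ[K] MvPowerSeries (Option (Fin (n + 1))) K ⧸
      Ideal.span {(eqm K none (some (Fin.last n)) s t : MvPowerSeries (Option (Fin (n + 1))) K)},
    ∀ i, Φ (bm z n s t i) = Ideal.Quotient.mk _ (MvPowerSeries.X i) := by
  -- At `x = 0` elements of `R_0` are power series in `x`; substitute the variable `none`.
  let θ : R₀ z →ₐ[K] MvPowerSeries (Option (Fin (n + 1))) K :=
    (PowerSeries.substAlgHom (PowerSeries.HasSubst.X none)).comp (R₀.incl z)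
  have hθ : θ (R₀.xR z) = MvPowerSeries.X none :=
    (PowerSeries.substAlgHom_X (PowerSeries.HasSubst.X none))
  let φ := liftRm z n θ fun i => MvPowerSeries.X (some i)
  obtain ⟨Φ, hΦ⟩ := exists_lift_A z n s t ((Ideal.Quotient.mkₐ K _).comp φ)
    (fun g hg _ => IsUnit.map (Ideal.Quotient.mkₐ K _) (isUnit_of_notMem_span (exists_sub_mem_𝔪 z n) φ (by
      rintro _ (rfl | ⟨i, rfl⟩)
      · simp [φ, hθ]
      · simp [φ]) hg)) (by
      rw [AlgHom.comp_apply, liftRm_fR, hθ, ← coe_eqm]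
      exact Ideal.Quotient.eq_zero_iff_mem.2 (Ideal.mem_span_singleton_self _))
  refine ⟨Φ, ?_⟩
  rintro (_ | i)
  · refine (hΦ _).trans ?_
    simp [φ, hθ]
  · refine (hΦ _).trans ?_
    simp [φ]

include hz in
/-- The map from `A` to its completion at the maximal ideal above `𝔫_m`. -/
theorem exists_Φn : ∃ Φ : A z n s t →ₐ[K] MvPowerSeries (Option (Fin r ⊕ Fin (n + 1))) K ⧸
      Ideal.span {(eqn' (σ := Option (Fin r ⊕ Fin (n + 1))) K none (some (Sum.inr (Fin.last n))) s t :
        MvPowerSeries (Option (Fin r ⊕ Fin (n + 1))) K)},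
    ∀ i, Φ (bn z n s t i) = Ideal.Quotient.mk _ (MvPowerSeries.X i) := by
  -- At `x = 1` the image `1 + X none` of `x` is a unit, so the `z_i` may be sent to new variables.
  obtain ⟨θ, hθ, hθ'⟩ := R₀.exists_algHom hz
    (u := 1 + (MvPowerSeries.X none : MvPowerSeries (Option (Fin r ⊕ Fin (n + 1))) K))
    (by rw [MvPowerSeries.isUnit_iff_constantCoeff]; simp)
    fun i => MvPowerSeries.X (some (Sum.inl i))
  let φ := liftRm z n θ fun i => MvPowerSeries.X (some (Sum.inr i))
  obtain ⟨Φ, hΦ⟩ := exists_lift_A z n s t ((Ideal.Quotient.mkₐ K _).comp φ)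
    (fun g _ hg => IsUnit.map (Ideal.Quotient.mkₐ K _) (isUnit_of_notMem_span (exists_sub_mem_𝔫 z n) φ (by
      rintro _ ((rfl | ⟨i, rfl⟩) | ⟨i, rfl⟩)
      · simp [φ, hθ]
      · simp [φ, hθ']
      · simp [φ]) hg)) (by
      rw [AlgHom.comp_apply, liftRm_fR, hθ, add_sub_cancel_left, ← coe_eqn']
      exact Ideal.Quotient.eq_zero_iff_mem.2 (Ideal.mem_span_singleton_self _))
  refine ⟨Φ, ?_⟩
  rintro (_ | i | i)
  · refine (hΦ _).trans ?_
    simp [φ, hθ]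
  · refine (hΦ _).trans ?_
    simp [φ, hθ']
  · refine (hΦ _).trans ?_
    simp [φ]

include hz in
theorem finite_quotient_span_bm_pow (k : ℕ) : Module.Finite K
    (A z n s t ⧸ (Ideal.span (Set.range (bm z n s t)) ^ k).restrictScalars K) := by
  obtain ⟨Φ, hΦ⟩ := exists_Φm (z := z) n (s := s) (t := t)
  exact finite_quotient_span_range_pow Φ (exists_sub_mem_span_bm n hz) (aeval_bm n) hΦ k

include hz in
theorem finite_quotient_span_bn_pow (k : ℕ) : Module.Finite K
    (A z n s t ⧸ (Ideal.span (Set.range (bn z n s t)) ^ k).restrictScalars K) := by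
  obtain ⟨Φ, hΦ⟩ := exists_Φn n (s := s) (t := t) hz
  exact finite_quotient_span_range_pow Φ (exists_sub_mem_span_bn n hz) (aeval_bn n) hΦ k

include hz ht in
theorem finrank_quotient_span_bm_pow (hts : t ≤ s) {k : ℕ} (htk : t ≤ k) : Module.finrank K
      (A z n s t ⧸ (Ideal.span (Set.range (bm z n s t)) ^ (k + 1)).restrictScalars K) +
      (k - t + (n + 2)).choose (n + 2) = (k + (n + 2)).choose (n + 2) := by
  obtain ⟨Φ, hΦ⟩ := exists_Φm (z := z) n (s := s) (t := t)
  have h := finrank_quotient_span_range_pow Φ (exists_sub_mem_span_bm n hz) (aeval_bm n) hΦ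
    (order_eqm (by simp) ht hts) htk
  rwa [Fintype.card_option, Fintype.card_fin] at h

include hz in
theorem finrank_quotient_span_bn_pow (hs : 1 < s) {k : ℕ} (hk : 1 ≤ k) : Module.finrank K
      (A z n s t ⧸ (Ideal.span (Set.range (bn z n s t)) ^ (k + 1)).restrictScalars K) +
      (k - 1 + (r + n + 2)).choose (r + n + 2) = (k + (r + n + 2)).choose (r + n + 2) := by
  obtain ⟨Φ, hΦ⟩ := exists_Φn n (s := s) (t := t) hz
  have h := finrank_quotient_span_range_pow Φ (exists_sub_mem_span_bn n hz) (aeval_bn n) hΦ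
    (order_eqn' none (some (Sum.inr (Fin.last n))) hs t) hk
  rwa [Fintype.card_option, Fintype.card_sum, Fintype.card_fin, Fintype.card_fin] at h

end Coordinates

end Nagata

/-! ### The prime ideal `P` -/

namespace Nagata

section Prime

variable {K : Type*} [Field K] {r : ℕ} (z : Fin r → K⟦X⟧) (n : ℕ)

/-- The ideal `(x, y_m)` of `R_m`. -/
noncomputable def PRm : Ideal (Rm z n) := Ideal.span {x z n, y z n (Fin.last n)}

/-- The inclusion of `K[y_1, …, y_n]` into `R_m`, where `m = n + 1`. -/
noncomputable def ofPolyY : MvPolynomial (Fin n) K →ₐ[K] Rm z n :=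
  MvPolynomial.aeval fun i => y z n i.castSucc

@[simp] theorem ofPolyY_X (i : Fin n) : ofPolyY z n (MvPolynomial.X i) = y z n i.castSucc := by
  simp [ofPolyY]

theorem x_mem_PRm : x z n ∈ PRm z n := Ideal.subset_span (Or.inl rfl)

theorem y_last_mem_PRm : y z n (Fin.last n) ∈ PRm z n := Ideal.subset_span (Or.inr rfl)

theorem exists_sub_ofPolyY_mem_PRm (g : Rm z n) :
    ∃ q, g - ofPolyY z n q ∈ PRm z n := by
  induction g using MvPolynomial.induction_on with
  | C b =>
    obtain ⟨c, b', rfl⟩ := R₀.exists_eq_add_xR_mul z b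
    refine ⟨MvPolynomial.C c, ?_⟩
    have : ofPolyY z n (MvPolynomial.C c) = MvPolynomial.C (algebraMap K (R₀ z) c) := by
      simp [ofPolyY, MvPolynomial.algebraMap_apply]
    rw [this, ← map_sub, add_sub_cancel_left, map_mul]
    exact Ideal.mul_mem_right _ _ (x_mem_PRm z n)
  | add a b ha hb =>
    obtain ⟨c, hc⟩ := ha
    obtain ⟨d, hd⟩ := hb
    exact ⟨c + d, by rw [map_add, add_sub_add_comm]; exact add_mem hc hd⟩
  | mul_X a i ha =>
    obtain ⟨q, hq⟩ := ha
    induction i using Fin.lastCases with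
    | last => exact ⟨0, by rw [map_zero, sub_zero]; exact Ideal.mul_mem_left _ _ (y_last_mem_PRm z n)⟩
    | cast i =>
      refine ⟨q * MvPolynomial.X i, ?_⟩
      rw [map_mul, ofPolyY_X, y, ← sub_mul]
      exact Ideal.mul_mem_right _ _ hq

theorem PRm_le_𝔪 : PRm z n ≤ 𝔪 z n := by
  refine Ideal.span_le.2 ?_
  rintro _ (rfl | rfl)
  · exact Ideal.subset_span (Or.inl rfl)
  · exact Ideal.subset_span (Or.inr ⟨_, rfl⟩)

/-- Reduction modulo `(x, y_m)`, with values in a power series ring. -/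
noncomputable def redRm : Rm z n →ₐ[K] MvPowerSeries (Fin n) K :=
  liftRm z n ((Algebra.ofId K _).comp (R₀.ev z)) (Fin.lastCases 0 fun i => MvPowerSeries.X i)

theorem redRm_x : redRm z n (x z n) = 0 := by
  simp [redRm]

theorem redRm_y_last : redRm z n (y z n (Fin.last n)) = 0 := by
  simp [redRm]

theorem redRm_y_castSucc (i : Fin n) : redRm z n (y z n i.castSucc) = MvPowerSeries.X i := by
  simp [redRm]

theorem redRm_ofPolyY (q : MvPolynomial (Fin n) K) : redRm z n (ofPolyY z n q) = q := by
  have : (redRm z n).comp (ofPolyY z n) = MvPolynomial.coeToMvPowerSeries.algHom K := by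
    ext1 i
    rw [AlgHom.comp_apply, ofPolyY_X, redRm_y_castSucc]
    simp [MvPolynomial.coeToMvPowerSeries.algHom_apply]
  have h := DFunLike.congr_fun this q
  simpa [MvPolynomial.coeToMvPowerSeries.algHom_apply] using h

theorem redRm_eq_zero {g : Rm z n} (hg : g ∈ PRm z n) : redRm z n g = 0 := by
  have : PRm z n ≤ RingHom.ker (redRm z n) := by
    refine Ideal.span_le.2 ?_
    rintro _ (rfl | rfl)
    · exact redRm_x z n
    · exact redRm_y_last z n
  exact this hg

theorem redRm_eq_of_sub_mem {g : Rm z n} {q : MvPolynomial (Fin n) K}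
    (h : g - ofPolyY z n q ∈ PRm z n) : redRm z n g = q := by
  have := redRm_eq_zero z n h
  rwa [map_sub, redRm_ofPolyY, sub_eq_zero] at this

theorem mem_PRm_iff {g : Rm z n} : g ∈ PRm z n ↔ redRm z n g = 0 := by
  refine ⟨redRm_eq_zero z n, fun h => ?_⟩
  obtain ⟨q, hq⟩ := exists_sub_ofPolyY_mem_PRm z n g
  have h1 := redRm_eq_of_sub_mem z n hq
  rw [h, eq_comm, MvPolynomial.coe_eq_zero_iff] at h1
  simpa [h1] using hq

variable (s t : ℕ)

theorem P_eq_map : P z n s t = (PRm z n).map (toA z n s t) := by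
  rw [P, PRm, Ideal.map_span, Set.image_pair]

variable {s t} (hs : 0 < s) (ht : 0 < t)

include hs ht in
/-- Reduction modulo `P`, with values in a power series ring. -/
theorem exists_redA : ∃ ψ : A z n s t →ₐ[K] MvPowerSeries (Fin n) K,
    ∀ g, ψ (toA z n s t g) = redRm z n g := by
  -- Elements outside `𝔪_m` get a nonzero constant term, hence become units; a polynomial ring as
  -- target would not allow this.
  refine exists_lift_A z n s t (redRm z n) (fun g hg _ => isUnit_of_notMem_span
    (exists_sub_mem_𝔪 z n) (redRm z n) ?_ hg) ?_
  · rintro _ (rfl | ⟨i, rfl⟩)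
    · rw [redRm_x, map_zero]
    · induction i using Fin.lastCases with
      | last => rw [redRm_y_last, map_zero]
      | cast i => rw [redRm_y_castSucc]; simp
  · rw [fR_eq]
    simp [redRm_x, redRm_y_last, zero_pow hs.ne', zero_pow ht.ne']

variable {z n}

theorem mem_P_iff {ψ : A z n s t →ₐ[K] MvPowerSeries (Fin n) K}
    (hψ : ∀ g, ψ (toA z n s t g) = redRm z n g) {a : A z n s t} : a ∈ P z n s t ↔ ψ a = 0 := by
  constructor
  · intro h
    have : P z n s t ≤ RingHom.ker ψ := by
      rw [P_eq_map]
      exact Ideal.map_le_iff_le_comap.2 fun g hg => (hψ g).trans (redRm_eq_zero z n hg)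
    exact this h
  · intro h
    obtain ⟨u, hu, g, hg⟩ := exists_toA_mul_eq z n s t a
    have h1 : redRm z n g = 0 := by rw [← hψ, ← hg, map_mul, h, mul_zero]
    rw [P_eq_map]
    refine (Ideal.unit_mul_mem_iff_mem _ (isUnit_toA z n s t hu)).1 ?_
    rw [hg]
    exact Ideal.mem_map_of_mem _ ((mem_PRm_iff z n).2 h1)

variable (z n)

include hs ht in
theorem isPrime_P : (P z n s t).IsPrime := by
  obtain ⟨ψ, hψ⟩ := exists_redA z n hs ht
  have : P z n s t = RingHom.ker ψ.toRingHom := Ideal.ext fun a => mem_P_iff hψ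
  rw [this]
  exact RingHom.ker_isPrime _

include hs ht in
theorem toA_mem_P_iff {g : Rm z n} : toA z n s t g ∈ P z n s t ↔ g ∈ PRm z n := by
  obtain ⟨ψ, hψ⟩ := exists_redA z n hs ht
  rw [mem_P_iff hψ, hψ, mem_PRm_iff]

/-! ### Coordinates of `A` at `P` -/

/-- The residue field at `P`. -/
abbrev kP (K : Type*) [Field K] (n : ℕ) : Type _ := FractionRing (MvPolynomial (Fin n) K)

/-- The map from `A` to its completion at `P`. -/
theorem exists_ΦP : ∃ Φ : A z n s t →ₐ[K] MvPowerSeries (Fin 2) (kP K n) ⧸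
      Ideal.span {(eqm (σ := Fin 2) (kP K n) 0 1 s t : MvPowerSeries (Fin 2) (kP K n))},
    Φ (toA z n s t (x z n)) = Ideal.Quotient.mk _ (MvPowerSeries.X 0) ∧
    Φ (toA z n s t (y z n (Fin.last n))) = Ideal.Quotient.mk _ (MvPowerSeries.X 1) ∧
    (∀ q, Φ (toA z n s t (ofPolyY z n q)) = algebraMap (kP K n) _ (algebraMap _ _ q)) ∧
    ∀ a, a ∉ P z n s t → IsUnit (Φ a) := by
  let θ : R₀ z →ₐ[K] MvPowerSeries (Fin 2) (kP K n) :=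
    (PowerSeries.substAlgHom (PowerSeries.HasSubst.X 0)).comp (R₀.incl z)
  have hθ : θ (R₀.xR z) = MvPowerSeries.X 0 :=
    (PowerSeries.substAlgHom_X (PowerSeries.HasSubst.X 0))
  -- Only `x` and `y_m` remain variables; the other `y_i` go to the coefficient field.
  let φ := liftRm z n θ (Fin.lastCases (MvPowerSeries.X 1)
    fun i => algebraMap (kP K n) _ (algebraMap (MvPolynomial (Fin n) K) _ (MvPolynomial.X i)))
  have hx : φ (x z n) = MvPowerSeries.X 0 := by simp [φ, hθ]
  have hy : φ (y z n (Fin.last n)) = MvPowerSeries.X 1 := by simp [φ]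
  have hq : ∀ q, φ (ofPolyY z n q) = algebraMap (kP K n) _ (algebraMap _ _ q) := by
    have h1 : φ.comp (ofPolyY z n) = (Algebra.ofId (kP K n) _ |>.restrictScalars K).comp
        (IsScalarTower.toAlgHom K (MvPolynomial (Fin n) K) (kP K n)) := by
      ext1 i
      simpa [φ] using (IsScalarTower.algebraMap_apply _ _ _ _).symm
    exact fun q => DFunLike.congr_fun h1 q
  have hunit : ∀ g, g ∉ PRm z n → IsUnit (φ g) := by
    intro g hg
    obtain ⟨q, hgq⟩ := exists_sub_ofPolyY_mem_PRm z n g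
    have h1 : PRm z n ≤ RingHom.ker ((MvPowerSeries.constantCoeff (σ := Fin 2)
        (R := kP K n)).comp φ.toRingHom) := by
      refine Ideal.span_le.2 ?_
      rintro _ (rfl | rfl)
      · change MvPowerSeries.constantCoeff (φ (x z n)) = 0
        simp [hx]
      · change MvPowerSeries.constantCoeff (φ (y z n (Fin.last n))) = 0
        simp [hy]
    have h2 : MvPowerSeries.constantCoeff (φ (g - ofPolyY z n q)) = 0 := h1 hgq
    rw [map_sub, map_sub, hq, sub_eq_zero, MvPowerSeries.algebraMap_apply,
      MvPowerSeries.constantCoeff_C] at h2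
    rw [MvPowerSeries.isUnit_iff_constantCoeff, h2, isUnit_iff_ne_zero]
    intro h
    have hq0 : q = 0 := (IsFractionRing.injective (MvPolynomial (Fin n) K) (kP K n))
      (h.trans (map_zero (algebraMap (MvPolynomial (Fin n) K) (kP K n))).symm)
    exact hg (by simpa [hq0] using hgq)
  obtain ⟨Φ, hΦ⟩ := exists_lift_A z n s t ((Ideal.Quotient.mkₐ K (Ideal.span
    {(eqm (σ := Fin 2) (kP K n) 0 1 s t : MvPowerSeries (Fin 2) (kP K n))})).comp φ)
    (fun g hg _ => IsUnit.map (Ideal.Quotient.mkₐ K _) (hunit g fun h => hg (PRm_le_𝔪 z n h))) (by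
      rw [AlgHom.comp_apply, fR_eq, map_add, map_mul, map_pow, map_pow, map_sub, map_one, hx, hy,
        ← coe_eqm]
      exact Ideal.Quotient.eq_zero_iff_mem.2 (Ideal.mem_span_singleton_self _))
  refine ⟨Φ, ?_, ?_, fun q => ?_, fun a ha => ?_⟩
  · rw [hΦ, AlgHom.comp_apply, hx]; rfl
  · rw [hΦ, AlgHom.comp_apply, hy]; rfl
  · rw [hΦ, AlgHom.comp_apply, hq]; rfl
  · obtain ⟨u, hu, g, hg⟩ := exists_toA_mul_eq z n s t a
    have h1 : g ∉ PRm z n := by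
      intro h
      refine ha ?_
      rw [P_eq_map]
      refine (Ideal.unit_mul_mem_iff_mem _ (isUnit_toA z n s t hu)).1 ?_
      rw [hg]
      exact Ideal.mem_map_of_mem _ h
    have h2 : IsUnit (Φ (toA z n s t u * a)) := by
      rw [hg, hΦ]
      exact (hunit g h1).map (Ideal.Quotient.mkₐ K _)
    rw [map_mul] at h2
    exact isUnit_of_mul_isUnit_right h2

end Prime

end Nagata

/-! ### Subrings containing an ideal -/

section Conductor

variable {κ R A : Type*} [Field κ] [CommRing R] [CommRing A] [Algebra κ R] [Algebra κ A]
  [Algebra R A] [IsScalarTower κ R A]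

theorem Ideal.restrictScalars_span_eq_top_mul (G : Set A) :
    (Ideal.span G).restrictScalars κ = (⊤ : Submodule κ A) * Submodule.span κ G := by
  refine le_antisymm (fun a ha => ?_) ?_
  · change a ∈ Ideal.span G at ha
    induction ha using Submodule.span_induction with
    | mem a ha =>
      have := Submodule.mul_mem_mul (Submodule.mem_top (R := κ) (x := (1 : A)))
        (Submodule.subset_span (R := κ) ha)
      rwa [one_mul] at this
    | zero => exact zero_mem _
    | add a b ha hb iha ihb => exact add_mem iha ihb
    | smul b a ha iha =>
      have h1 := Submodule.mul_mem_mul (Submodule.mem_top (R := κ) (x := b)) iha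
      rw [← mul_assoc] at h1
      exact (mul_le_mul_left le_top (Submodule.span κ G) : _ ≤ _) h1
  · rw [Submodule.mul_le]
    intro a _ b hb
    refine Ideal.mul_mem_left _ a ?_
    exact Submodule.span_le_restrictScalars κ A G hb

variable {J : Ideal A} (hJ : ∀ a ∈ J, ∃ b : R, algebraMap R A b = a) {T : Submodule κ A}
  (hT : T.FG) (hTJ : ∀ a : A, ∃ b ∈ T, a - b ∈ J)

include hJ in
-- `J · IA ⊆ I`: coefficients from `A` are absorbed by `j`, which stays in the ideal `J` and hence
-- in `R`.
theorem exists_mem_algebraMap_eq_mul {I : Ideal R} {a j : A} (ha : a ∈ I.map (algebraMap R A))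
    (hj : j ∈ J) : ∃ i ∈ I, algebraMap R A i = j * a := by
  induction ha using Submodule.span_induction generalizing j with
  | mem a ha =>
    obtain ⟨i, hi, rfl⟩ := ha
    obtain ⟨j, rfl⟩ := hJ j hj
    exact ⟨j * i, I.mul_mem_left j hi, by simp⟩
  | zero => exact ⟨0, zero_mem _, by simp⟩
  | add a b _ _ iha ihb =>
    obtain ⟨i, hi, hi'⟩ := iha hj
    obtain ⟨i', hi2, hi2'⟩ := ihb hj
    exact ⟨i + i', add_mem hi hi2, by rw [map_add, mul_add, hi', hi2']⟩
  | smul b a _ iha =>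
    obtain ⟨i, hi, hi'⟩ := iha (J.mul_mem_right b hj)
    exact ⟨i, hi, by rw [hi', smul_eq_mul, mul_assoc]⟩

include hJ hT hTJ in
theorem Module.finite_of_ideal_subset : Module.Finite R A := by
  obtain ⟨G, rfl⟩ := hT
  have h : (⊤ : Submodule R A) = Submodule.span R G ⊔ Submodule.span R {1} := by
    refine (eq_top_iff.2 fun a _ => ?_).symm
    obtain ⟨b, hb, hab⟩ := hTJ a
    obtain ⟨c, hc⟩ := hJ _ hab
    rw [← sub_add_cancel a b, add_comm]
    refine Submodule.add_mem_sup (Submodule.span_le_restrictScalars κ R _ hb) ?_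
    rw [← hc, Algebra.algebraMap_eq_smul_one]
    exact Submodule.smul_mem _ _ (Submodule.mem_span_singleton_self _)
  exact ⟨h ▸ (Submodule.fg_span G.finite_toSet).sup (Submodule.fg_span_singleton 1)⟩

include hJ hT hTJ in
/-- A subring of a Noetherian `κ`-algebra containing an ideal of finite codimension is
Noetherian. -/
theorem isNoetherianRing_of_ideal_subset [IsNoetherianRing A]
    (hinj : Function.Injective (algebraMap R A)) : IsNoetherianRing R := by
  have hfin : Module.Finite R A := Module.finite_of_ideal_subset hJ hT hTJ
  refine ⟨fun (I : Ideal R) => ?_⟩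
  refine Submodule.fg_of_fg_map_injective (Algebra.linearMap R A) hinj ?_
  set N := Submodule.map (Algebra.linearMap R A) I
  have h1 : ∀ a ∈ I.map (algebraMap R A), ∀ j ∈ J, j * a ∈ N :=
    fun a ha j hj => exists_mem_algebraMap_eq_mul hJ ha hj
  have h2 : (J * I.map (algebraMap R A)).restrictScalars R ≤ N := fun a ha =>
    Submodule.mul_induction_on (show a ∈ J * I.map (algebraMap R A) from ha)
      (fun j hj b hb => h1 b hb j hj) fun a b ha hb => add_mem ha hb
  obtain ⟨G, hG⟩ := (isNoetherianRing_iff_ideal_fg A).1 inferInstance (I.map (algebraMap R A))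
  -- Sandwich `J · IA ⊆ I ⊆ IA`. The quotient of the outer two is finite-dimensional over `κ`, since
  -- `T` spans `A` modulo `J`. The left one is finitely generated over `A`, hence over `R`.
  refine Submodule.fg_of_fg_map_of_fg_inf_ker
    (Submodule.mkQ ((J * I.map (algebraMap R A)).restrictScalars R)) ?_ ?_
  · refine Submodule.FG.of_restrictScalars κ ?_
    let π : A →ₗ[κ] A ⧸ (J * I.map (algebraMap R A)).restrictScalars R :=
      (Submodule.mkQ ((J * I.map (algebraMap R A)).restrictScalars R)).restrictScalars κ
    have h3 : ((T * Submodule.span κ (G : Set A)).map π).FG :=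
      (hT.mul (Submodule.fg_span G.finite_toSet)).map π
    refine h3.of_le ?_
    rintro _ ⟨_, ⟨i, hi, rfl⟩, rfl⟩
    have h4 : algebraMap R A i ∈ (⊤ : Submodule κ A) * Submodule.span κ (G : Set A) := by
      rw [← Ideal.restrictScalars_span_eq_top_mul]
      change algebraMap R A i ∈ Ideal.span (G : Set A)
      rw [hG]
      exact Ideal.mem_map_of_mem _ hi
    have h5 : ∀ a ∈ (⊤ : Submodule κ A) * Submodule.span κ (G : Set A),
        ∃ b ∈ T * Submodule.span κ (G : Set A), a - b ∈ J * I.map (algebraMap R A) := by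
      intro a ha
      induction ha using Submodule.mul_induction_on' with
      | mem_mul_mem a _ g hg =>
        obtain ⟨b, hb, hab⟩ := hTJ a
        refine ⟨b * g, Submodule.mul_mem_mul hb hg, ?_⟩
        rw [← sub_mul]
        refine Ideal.mul_mem_mul hab ?_
        rw [← hG]
        exact Submodule.span_le_restrictScalars κ A _ hg
      | add a _ b _ iha ihb =>
        obtain ⟨a', ha', ha⟩ := iha
        obtain ⟨b', hb', hb⟩ := ihb
        exact ⟨a' + b', add_mem ha' hb', by rw [add_sub_add_comm]; exact add_mem ha hb⟩
    obtain ⟨b, hb, hab⟩ := h5 _ h4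
    refine ⟨b, hb, ?_⟩
    exact ((Submodule.Quotient.eq _).2 hab).symm
  · rw [Submodule.ker_mkQ, inf_eq_right.2 h2]
    exact Submodule.FG.restrictScalars ((isNoetherianRing_iff_ideal_fg A).1 inferInstance _)

end Conductor

/-! ### The local domain `R` -/

namespace Nagata

variable {K : Type*} [Field K] {r : ℕ} {z : Fin r → K⟦X⟧} (n : ℕ) {s t : ℕ}

theorem algebraMap_R_injective : Function.Injective (algebraMap (R z n s t) (A z n s t)) :=
  Subtype.val_injective

variable (hz : AlgIndep z) (hs : 0 < s) (ht : 0 < t)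

/-- `R` is `A` with its two points glued: an element with equal residues differs from that common
scalar by an element of `J`. -/
theorem exists_algebraMap_R_eq_iff {a : A z n s t} :
    (∃ b : R z n s t, algebraMap _ _ b = a) ↔ χm n hs ht a = χn n hz hs a := by
  constructor
  · rintro ⟨⟨_, c, j, hj, rfl⟩, rfl⟩
    rw [mem_jacobson_iff n hz hs ht] at hj
    change χm n hs ht (algebraMap K _ c + j) = χn n hz hs (algebraMap K _ c + j)
    rw [map_add, map_add, hj.1, hj.2, AlgHom.commutes, AlgHom.commutes]
  · intro h
    refine ⟨⟨a, χm n hs ht a, a - algebraMap K _ (χm n hs ht a), ?_, by ring⟩, rfl⟩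
    rw [mem_jacobson_iff n hz hs ht, map_sub, map_sub, AlgHom.commutes, AlgHom.commutes, ← h]
    simp

theorem χm_algebraMap_R (b : R z n s t) :
    χm n hs ht (algebraMap _ (A z n s t) b) = χn n hz hs (algebraMap _ (A z n s t) b) :=
  (exists_algebraMap_R_eq_iff n hz hs ht).1 ⟨b, rfl⟩

include hz in
theorem isUnit_R_iff {b : R z n s t} :
    IsUnit b ↔ χm n hs ht (algebraMap _ (A z n s t) b) ≠ 0 := by
  refine ⟨fun h => ((h.map (algebraMap _ (A z n s t))).map (χm n hs ht)).ne_zero, fun h => ?_⟩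
  have h1 : IsUnit (algebraMap _ (A z n s t) b) :=
    (isUnit_A_iff n hz hs ht).2 ⟨h, χm_algebraMap_R n hz hs ht b ▸ h⟩
  obtain ⟨a, ha⟩ := h1.exists_right_inv
  have h2 : χm n hs ht a = χn n hz hs a := by
    have h3 := congrArg (χm n hs ht) ha
    have h4 := congrArg (χn n hz hs) ha
    rw [map_mul, map_one] at h3 h4
    rw [← χm_algebraMap_R n hz hs ht] at h4
    exact mul_left_cancel₀ h (h3.trans h4.symm)
  obtain ⟨c, rfl⟩ := (exists_algebraMap_R_eq_iff n hz hs ht).2 h2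
  rw [← map_mul, ← map_one (algebraMap (R z n s t) (A z n s t))] at ha
  exact IsUnit.of_mul_eq_one _ (algebraMap_R_injective n ha)

theorem χm_x : χm (z := z) n hs ht (toA z n s t (x z n)) = 0 := by
  rw [χm_toA, ← mem_𝔪_iff]
  exact Ideal.subset_span (Or.inl rfl)

theorem χm_y (i) : χm (z := z) n hs ht (toA z n s t (y z n i)) = 0 := by
  rw [χm_toA, ← mem_𝔪_iff]
  exact Ideal.subset_span (Or.inr ⟨i, rfl⟩)

theorem χn_x : χn n hz hs (t := t) (toA z n s t (x z n)) = 1 := by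
  have h : x z n - 1 ∈ 𝔫 z n := Ideal.subset_span (Or.inl (Or.inl rfl))
  rw [mem_𝔫_iff n hz, ← χn_toA n hz hs (t := t), map_sub, map_sub, map_one, map_one,
    sub_eq_zero] at h
  exact h

theorem χn_y (i) : χn n hz hs (t := t) (toA z n s t (y z n i)) = 0 := by
  rw [χn_toA, ← mem_𝔫_iff]
  exact Ideal.subset_span (Or.inr ⟨i, rfl⟩)

theorem χn_zel (i) : χn n hz hs (t := t) (toA z n s t (zel z n i)) = 0 := by
  rw [χn_toA, ← mem_𝔫_iff]
  exact Ideal.subset_span (Or.inl (Or.inr ⟨i, rfl⟩))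

section

include hz hs ht

theorem isDomain_R : IsDomain (R z n s t) := by
  have := isDomain_A n hz hs ht
  exact (algebraMap_R_injective n).isDomain (algebraMap (R z n s t) (A z n s t))

theorem isLocalRing_R : IsLocalRing (R z n s t) := by
  have := isDomain_R n hz hs ht
  refine IsLocalRing.of_nonunits_add fun a b ha hb => ?_
  rw [mem_nonunits_iff, isUnit_R_iff n hz hs ht, not_not] at ha hb ⊢
  rw [map_add, map_add, ha, hb, add_zero]

theorem mem_maximalIdeal_R_iff [IsLocalRing (R z n s t)] {b : R z n s t} :
    b ∈ IsLocalRing.maximalIdeal _ ↔ χm n hs ht (algebraMap _ (A z n s t) b) = 0 := by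
  rw [IsLocalRing.mem_maximalIdeal, mem_nonunits_iff, isUnit_R_iff n hz hs ht, not_not]

theorem maximalIdeal_R_eq [IsLocalRing (R z n s t)] :
    IsLocalRing.maximalIdeal (R z n s t) =
      (Ideal.jacobson (⊥ : Ideal (A z n s t))).comap (algebraMap _ _) := by
  ext b
  rw [mem_maximalIdeal_R_iff n hz hs ht, Ideal.mem_comap, mem_jacobson_iff n hz hs ht,
    ← χm_algebraMap_R n hz hs ht, and_self]

theorem exists_sub_mem_maximalIdeal_R [IsLocalRing (R z n s t)] (b : R z n s t) :
    ∃ c : K, b - algebraMap K _ c ∈ IsLocalRing.maximalIdeal _ := by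
  refine ⟨χm n hs ht (algebraMap _ (A z n s t) b), ?_⟩
  rw [mem_maximalIdeal_R_iff n hz hs ht, map_sub, map_sub, ← IsScalarTower.algebraMap_apply,
    AlgHom.commutes]
  exact sub_self _

theorem bijective_algebraMap_residueField [IsLocalRing (R z n s t)] :
    Function.Bijective (algebraMap K (IsLocalRing.ResidueField (R z n s t))) := by
  refine ⟨RingHom.injective _, fun b => ?_⟩
  obtain ⟨b, rfl⟩ := IsLocalRing.residue_surjective b
  obtain ⟨c, hc⟩ := exists_sub_mem_maximalIdeal_R n hz hs ht b
  refine ⟨c, ?_⟩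
  rw [← IsLocalRing.residue_eq_zero_iff, map_sub, sub_eq_zero] at hc
  rw [hc]
  rfl

/-- `A / J = K × K` is spanned by `1` and `x`, as `x` has residues 0 and 1. -/
theorem exists_mem_span_sub_mem_jacobson (a : A z n s t) :
    ∃ b ∈ Submodule.span K {1, toA z n s t (x z n)}, a - b ∈ Ideal.jacobson (⊥ : Ideal (A z n s t)) := by
  refine ⟨χm n hs ht a • 1 + (χn n hz hs a - χm n hs ht a) • toA z n s t (x z n),
    Submodule.mem_span_pair.2 ⟨_, _, rfl⟩, (mem_jacobson_iff n hz hs ht).2 ?_⟩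
  simp [χm_x n hs ht, χn_x n hz hs]

theorem exists_algebraMap_R_eq_of_mem_jacobson (a : A z n s t)
    (ha : a ∈ Ideal.jacobson (⊥ : Ideal (A z n s t))) : ∃ b : R z n s t, algebraMap _ _ b = a := by
  rw [mem_jacobson_iff n hz hs ht] at ha
  rw [exists_algebraMap_R_eq_iff n hz hs ht, ha.1, ha.2]

theorem finite_R_A : Module.Finite (R z n s t) (A z n s t) :=
  Module.finite_of_ideal_subset (κ := K) (exists_algebraMap_R_eq_of_mem_jacobson n hz hs ht)
    (Submodule.fg_span (Set.toFinite _)) (exists_mem_span_sub_mem_jacobson n hz hs ht)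

theorem isNoetherianRing_R : IsNoetherianRing (R z n s t) := by
  have := isNoetherianRing_A n hz hs ht
  exact isNoetherianRing_of_ideal_subset (κ := K)
    (exists_algebraMap_R_eq_of_mem_jacobson n hz hs ht)
    (Submodule.fg_span (Set.toFinite _)) (exists_mem_span_sub_mem_jacobson n hz hs ht)
    (algebraMap_R_injective n)

end

end Nagata

/-! ### The dimension of `R` -/

theorem IsLocalRing.ringKrullDim_le_card {B ι : Type*} [CommRing B] [IsLocalRing B]
    [IsNoetherianRing B] [Fintype ι] (b : ι → B) (hb : ∀ i, b i ∈ maximalIdeal B)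
    (h : ∀ q : Ideal B, q.IsPrime → (∀ i, b i ∈ q) → maximalIdeal B ≤ q) :
    ringKrullDim B ≤ Fintype.card ι := by
  classical
  rw [← IsLocalRing.maximalIdeal_height_eq_ringKrullDim]
  have h1 : maximalIdeal B ∈ (Ideal.span ((Finset.univ.image b : Finset B) : Set B)).minimalPrimes := by
    refine ⟨⟨inferInstance, Ideal.span_le.2 ?_⟩, fun q hq _ => h q hq.1 fun i => ?_⟩
    · intro a ha
      simp only [Finset.coe_image, Finset.coe_univ, Set.image_univ, Set.mem_range] at ha
      obtain ⟨i, rfl⟩ := ha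
      exact hb i
    · exact hq.2 (Ideal.subset_span (by simp))
  have h2 := (Ideal.height_le_card_of_mem_minimalPrimes_span_finset h1).trans
    (Nat.cast_le.2 (Finset.card_image_le (s := Finset.univ) (f := b)))
  rw [Finset.card_univ] at h2
  exact_mod_cast h2

namespace Nagata

/-- The relation times `(a - 1) ^ (t - 1)`. It makes `x (x - 1)` nilpotent modulo `y_m`. -/
theorem mul_sub_one_pow_eq {B : Type*} [CommRing B] {a b : B} {s t : ℕ} (hs : 0 < s) (ht : 0 < t)
    (h : b ^ s + a ^ t * (a - 1) = 0) :
    (a * (a - 1)) ^ t = -b ^ (s - 1) * (a - 1) ^ (t - 1) * b := by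
  obtain ⟨s, rfl⟩ := Nat.exists_eq_add_of_lt hs
  obtain ⟨t, rfl⟩ := Nat.exists_eq_add_of_lt ht
  simp only [zero_add, Nat.add_sub_cancel, mul_pow] at h ⊢
  linear_combination (a - 1) ^ t * h

variable {K : Type*} [Field K] {r : ℕ} {z : Fin r → K⟦X⟧} (n : ℕ) {s t : ℕ}
variable (hz : AlgIndep z) (hs : 0 < s) (ht : 0 < t)

/-- A coordinate has order 1 and cannot be a multiple of the local equation at `𝔪_m`, which has
order `t > 1`. -/
theorem y_last_ne_zero (hts : t ≤ s) (h1t : 1 < t) : toA z n s t (y z n (Fin.last n)) ≠ 0 := by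
  obtain ⟨Φ, hΦ⟩ := exists_Φm (z := z) n (s := s) (t := t)
  intro h
  have h1 := hΦ (some (Fin.last n))
  rw [show bm z n s t (some (Fin.last n)) = 0 from h, map_zero, eq_comm,
    Ideal.Quotient.eq_zero_iff_mem, Ideal.mem_span_singleton] at h1
  obtain ⟨w, hw⟩ := h1
  have h2 := congrArg MvPowerSeries.order hw
  rw [MvPowerSeries.order_mul, order_X, order_eqm (by simp) (by omega) hts] at h2
  have h3 : ((t : ℕ) : ℕ∞) ≤ 1 := h2 ▸ le_self_add
  exact absurd h3 (by simpa using h1t)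

theorem exists_R_eq_y (hz : AlgIndep z) (hs : 0 < s) (ht : 0 < t) (i : Fin (n + 1)) :
    ∃ b : R z n s t, algebraMap _ (A z n s t) b = toA z n s t (y z n i) :=
  (exists_algebraMap_R_eq_iff n hz hs ht).2 ((χm_y n hs ht i).trans (χn_y n hz hs i).symm)

theorem exists_R_eq_x_mul_zel (hz : AlgIndep z) (hs : 0 < s) (ht : 0 < t) (i : Fin r) :
    ∃ b : R z n s t, algebraMap _ (A z n s t) b = toA z n s t (x z n * zel z n i) := by
  refine (exists_algebraMap_R_eq_iff n hz hs ht).2 ?_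
  rw [map_mul, map_mul, map_mul, χm_x, χn_zel, zero_mul, mul_zero]

include hz hs ht in
-- Setting `x = 1` and `y_m = 0` on the large branch leaves `r + n` free variables. They are already
-- hit by `x z_i` and `y_j`, which lie in `R`. The nonzero element `y_m` of the kernel supplies one
-- more dimension.
theorem le_ringKrullDim_R (hts : t ≤ s) (h1t : 1 < t) :
    (r + n + 1 : ℕ) ≤ ringKrullDim (R z n s t) := by
  have := isDomain_R n hz hs ht
  obtain ⟨θ, hθ, hθ'⟩ := R₀.exists_algHom hz
    (isUnit_one (M := MvPowerSeries (Fin (r + n)) K)) fun i => MvPowerSeries.X (Fin.castAdd n i)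
  let φ := liftRm z n θ (Fin.lastCases 0 fun i => MvPowerSeries.X (Fin.natAdd r i))
  obtain ⟨Φ, hΦ⟩ := exists_lift_A z n s t φ
    (fun g _ hg => isUnit_of_notMem_span (exists_sub_mem_𝔫 z n) φ (by
      rintro _ ((rfl | ⟨i, rfl⟩) | ⟨i, rfl⟩)
      · simp [φ, hθ]
      · simp [φ, hθ']
      · induction i using Fin.lastCases <;> simp [φ]) hg) (by
      rw [liftRm_fR, hθ]
      simp [hs.ne'])
  refine le_ringKrullDim_of_mvPowerSeries
    (Φ.toRingHom.comp (algebraMap (R z n s t) (A z n s t))) (fun h => ?_) fun i => ?_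
  · obtain ⟨b, hb⟩ := exists_R_eq_y n hz hs ht (Fin.last n)
    have h1 : (Φ.toRingHom.comp (algebraMap (R z n s t) (A z n s t))) b = 0 := by
      change Φ (algebraMap _ _ b) = 0
      rw [hb, hΦ]
      simp [φ]
    have h2 : b = 0 := h (h1.trans (map_zero _).symm)
    rw [h2, map_zero, eq_comm] at hb
    exact y_last_ne_zero n hts h1t hb
  · induction i using Fin.addCases with
    | left i =>
      obtain ⟨b, hb⟩ := exists_R_eq_x_mul_zel n hz hs ht i
      refine ⟨b, ?_⟩
      change Φ (algebraMap _ _ b) = _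
      rw [hb, hΦ]
      simp [φ, hθ, hθ']
    | right i =>
      obtain ⟨b, hb⟩ := exists_R_eq_y n hz hs ht i.castSucc
      refine ⟨b, ?_⟩
      change Φ (algebraMap _ _ b) = _
      rw [hb, hΦ]
      simp [φ]

include hz hs ht in
-- The `r + n + 1` elements `x z_i` and `y_j` generate an ideal primary to the maximal ideal, giving
-- the upper bound for the dimension. Modulo these elements, the product of the two maximal ideals
-- of `A` reduces to the single generator `x (x - 1)`.
theorem maximalIdeal_R_le [IsLocalRing (R z n s t)] (h1s : 1 < s) {q : Ideal (R z n s t)}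
    (hq : q.IsPrime)
    (hy : ∀ i, toA z n s t (y z n i) ∈ q.map (algebraMap (R z n s t) (A z n s t)))
    (hxz : ∀ i, toA z n s t (x z n * zel z n i) ∈ q.map (algebraMap (R z n s t) (A z n s t))) :
    IsLocalRing.maximalIdeal _ ≤ q := by
  have hJ := exists_algebraMap_R_eq_of_mem_jacobson n hz hs ht
  -- Membership in the extended ideal is brought back to `q` through a factor `j ∈ J`, as `J · qA ⊆
  -- q`.
  have key : ∀ (b : R z n s t) (a j : A z n s t) (k : ℕ), a ∈ q.map (algebraMap _ (A z n s t)) →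
      j ∈ Ideal.jacobson (⊥ : Ideal (A z n s t)) → algebraMap _ _ b ^ k = j * a → b ∈ q := by
    intro b a j k ha hj hb
    obtain ⟨i, hi, hij⟩ := exists_mem_algebraMap_eq_mul hJ ha hj
    rw [← hb, ← map_pow] at hij
    exact hq.mem_of_pow_mem k (algebraMap_R_injective n hij ▸ hi)
  have hw : toA z n s t (x z n * (x z n - 1)) ∈ q.map (algebraMap _ (A z n s t)) := by
    obtain ⟨w, hw⟩ := (exists_algebraMap_R_eq_iff (a := toA z n s t (x z n * (x z n - 1)))
      n hz hs ht).2 (by simp [χm_x, χn_x])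
    rw [← hw]
    -- The factor `y_m ^ (s - 1)` supplies the element of `J`; this needs `s > 1`.
    refine Ideal.mem_map_of_mem _ (key w _ (- toA z n s t (y z n (Fin.last n)) ^ (s - 1) *
      toA z n s t (x z n - 1) ^ (t - 1)) t (hy (Fin.last n)) ?_ ?_)
    · rw [mem_jacobson_iff n hz hs ht]
      simp [χm_y, χn_y, zero_pow (Nat.sub_ne_zero_of_lt h1s)]
    · rw [hw, map_mul, map_sub, map_one]
      exact mul_sub_one_pow_eq hs ht (toA_relation z n s t)
  have hMN : Ideal.span (Set.range (bm z n s t)) * Ideal.span (Set.range (bn z n s t)) ≤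
      q.map (algebraMap _ _) := by
    rw [Ideal.span_mul_span', Ideal.span_le]
    rintro _ ⟨_, ⟨_ | i, rfl⟩, _, ⟨_ | i' | i', rfl⟩, rfl⟩
    · rw [map_mul] at hw
      exact hw
    · have := hxz i'
      rw [map_mul] at this
      exact this
    · exact Ideal.mul_mem_left _ _ (hy i')
    · exact Ideal.mul_mem_right _ _ (hy i)
    · exact Ideal.mul_mem_right _ _ (hy i)
    · exact Ideal.mul_mem_right _ _ (hy i)
  intro b hb
  have hb1 := (mem_maximalIdeal_R_iff n hz hs ht).1 hb
  have hb2 := (χm_algebraMap_R n hz hs ht b).symm.trans hb1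
  -- In `b ^ 3` two factors give an element of the product of the maximal ideals, and the third is
  -- the element of `J`.
  refine key b _ (algebraMap _ _ b) 3 (hMN (Ideal.mul_mem_mul ((mem_span_bm_iff n hz hs ht).2 hb1)
    ((mem_span_bn_iff n hz hs).2 hb2))) ((mem_jacobson_iff n hz hs ht).2 ⟨hb1, hb2⟩) ?_
  ring

include hz hs ht in
theorem ringKrullDim_R_le (h1s : 1 < s) : ringKrullDim (R z n s t) ≤ (r + n + 1 : ℕ) := by
  have := isLocalRing_R n hz hs ht
  have := isNoetherianRing_R n hz hs ht
  choose b hb using exists_R_eq_x_mul_zel n hz hs ht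
  choose c hc using exists_R_eq_y n hz hs ht
  have h := IsLocalRing.ringKrullDim_le_card (Sum.elim b c) (by
    rintro (i | i)
    · rw [mem_maximalIdeal_R_iff n hz hs ht, Sum.elim_inl, hb]
      simp [χm_x]
    · rw [mem_maximalIdeal_R_iff n hz hs ht, Sum.elim_inr, hc, χm_y])
    fun q hq hbc => maximalIdeal_R_le n hz hs ht h1s hq
      (fun i => hc i ▸ Ideal.mem_map_of_mem _ (hbc (Sum.inr i)))
      (fun i => hb i ▸ Ideal.mem_map_of_mem _ (hbc (Sum.inl i)))
  rwa [Fintype.card_sum, Fintype.card_fin, Fintype.card_fin, ← add_assoc] at h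

include hz in
theorem ringKrullDim_R (hts : t ≤ s) (h1t : 1 < t) :
    ringKrullDim (R z n s t) = (r + n + 1 : ℕ) :=
  le_antisymm (ringKrullDim_R_le n hz (by omega) (by omega) (by omega))
    (le_ringKrullDim_R n hz (by omega) (by omega) hts h1t)

end Nagata

/-! ### Local rings with power series coordinates -/

section Regular

variable {κ L : Type*} [Field κ] [CommRing L] [Algebra κ L]

theorem IsLocalRing.maximalIdeal_eq_of_forall_exists_sub_mem [IsLocalRing L] {I : Ideal L}
    (hI : I ≠ ⊤) (h : ∀ a : L, ∃ c : κ, a - algebraMap κ L c ∈ I) : maximalIdeal L = I := by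
  refine le_antisymm (fun a ha => ?_) (le_maximalIdeal hI)
  obtain ⟨c, hc⟩ := h a
  have h1 : algebraMap κ L c ∈ maximalIdeal L := by
    have := sub_mem ha (le_maximalIdeal hI hc)
    rwa [sub_sub_cancel] at this
  have hc0 : c = 0 := by
    by_contra hc0
    exact (mem_maximalIdeal _).1 h1 ((isUnit_iff_ne_zero.2 hc0).map (algebraMap κ L))
  simpa [hc0] using hc

variable {σ : Type*} [Fintype σ] {b : σ → L} (ψ : L →ₐ[κ] MvPowerSeries σ κ)
  (hL : ∀ a : L, ∃ c : κ, a - algebraMap κ L c ∈ Ideal.span (Set.range b))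
  (hψ : ∀ i, ψ (b i) = MvPowerSeries.X i)

include hL hψ

theorem mem_span_range_pow_iff_le_order {k : ℕ} {a : L} :
    a ∈ Ideal.span (Set.range b) ^ k ↔ k ≤ (ψ a).order := by
  -- The case `F = 0` of the hypersurface criterion.
  let Φ := (Ideal.Quotient.mkₐ κ (Ideal.span {((0 : MvPolynomial σ κ) : MvPowerSeries σ κ)})).comp ψ
  rw [mem_span_range_pow_iff Φ hL (map_zero _) fun i => congrArg _ (hψ i)]
  change Ideal.Quotient.mk _ (ψ a) ∈ _ ↔ _
  rw [Ideal.mem_quotient_iff_mem_sup, MvPolynomial.coe_zero, Ideal.span_singleton_eq_bot.2 rfl,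
    sup_bot_eq, MvPowerSeries.mem_orderIdeal]

variable [IsLocalRing L]

theorem IsLocalRing.maximalIdeal_eq_span_range : maximalIdeal L = Ideal.span (Set.range b) := by
  refine maximalIdeal_eq_of_forall_exists_sub_mem (fun h => ?_) hL
  have h1 : (1 : L) ∈ Ideal.span (Set.range b) ^ 1 := by rw [h, pow_one]; trivial
  rw [mem_span_range_pow_iff_le_order ψ hL hψ, map_one, Nagata.order_eq_zero (by simp)] at h1
  simp at h1

theorem isAnalyticallyUnramified_of_mvPowerSeries : IsAnalyticallyUnramified L := by
  rw [IsAnalyticallyUnramified, IsLocalRing.maximalIdeal_eq_span_range ψ hL hψ]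
  refine AdicCompletion.isReduced_of_forall_sq_mem _ fun k a h => ?_
  rw [mem_span_range_pow_iff_le_order ψ hL hψ, map_pow, Nagata.order_pow] at h
  rw [mem_span_range_pow_iff_le_order ψ hL hψ]
  cases ho : (ψ a).order with
  | top => exact le_top
  | coe d =>
    rw [ho] at h
    have h1 : 2 * k + 1 ≤ 2 * d := by exact_mod_cast h
    exact_mod_cast (show k + 1 ≤ d by omega)

theorem ringKrullDim_le_of_mvPowerSeries [IsNoetherianRing L] :
    ringKrullDim L ≤ Fintype.card σ := by
  have h := IsLocalRing.maximalIdeal_eq_span_range ψ hL hψ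
  refine IsLocalRing.ringKrullDim_le_card b (fun i => ?_) fun q _ hq => ?_
  · rw [h]
    exact Ideal.subset_span ⟨i, rfl⟩
  · rw [h, Ideal.span_le]
    rintro _ ⟨i, rfl⟩
    exact hq i

end Regular

/-! ### The prime ideal `p` -/

namespace Nagata

variable {K : Type*} [Field K] {r : ℕ} {z : Fin r → K⟦X⟧} (n : ℕ) {s t : ℕ}
variable (hz : AlgIndep z) (hs : 0 < s) (ht : 0 < t)

theorem mem_p_iff {b : R z n s t} : b ∈ p z n s t ↔ algebraMap _ (A z n s t) b ∈ P z n s t :=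
  Iff.rfl

theorem x_mem_P : toA z n s t (x z n) ∈ P z n s t := Ideal.subset_span (Or.inl rfl)

theorem y_last_mem_P : toA z n s t (y z n (Fin.last n)) ∈ P z n s t := Ideal.subset_span (Or.inr rfl)

section

include hs ht

theorem y_castSucc_notMem_P (i : Fin n) : toA z n s t (y z n i.castSucc) ∉ P z n s t := by
  rw [toA_mem_P_iff z n hs ht, mem_PRm_iff, redRm_y_castSucc]
  intro h
  have := order_X (κ := K) i
  rw [h, MvPowerSeries.order_zero] at this
  exact absurd this (by simp)

theorem x_sub_one_notMem_P : toA z n s t (x z n) - 1 ∉ P z n s t := fun h =>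
  (isPrime_P z n hs ht).ne_top ((Ideal.eq_top_iff_one _).2
    (by simpa using sub_mem (x_mem_P (z := z) n) h))

theorem isPrime_p : (p z n s t).IsPrime := by
  have := isPrime_P z n hs ht
  exact Ideal.IsPrime.comap _

theorem isLocalRing_quotient_p [IsLocalRing (R z n s t)] :
    IsLocalRing (R z n s t ⧸ p z n s t) := by
  have := isPrime_p (z := z) n hs ht
  exact IsLocalRing.of_surjective' (Ideal.Quotient.mk _) Ideal.Quotient.mk_surjective

end

section

include hz hs ht

theorem exists_R_eq_y_mul (i : Fin (n + 1)) (a : A z n s t) :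
    ∃ b : R z n s t, algebraMap _ (A z n s t) b = toA z n s t (y z n i) * a :=
  exists_algebraMap_R_eq_of_mem_jacobson n hz hs ht _ ((mem_jacobson_iff n hz hs ht).2
    (by simp [χm_y, χn_y]))

/-- `x ∈ P` has residues 0 and 1, so a scalar multiple of it equalizes the two residues of `a`
without changing `a` modulo `P`. Hence `R / p = A / P`. -/
theorem exists_R_sub_mem_P (a : A z n s t) :
    ∃ b : R z n s t, a - algebraMap _ (A z n s t) b ∈ P z n s t := by
  obtain ⟨b, hb⟩ := (exists_algebraMap_R_eq_iff n hz hs ht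
    (a := a - algebraMap K _ (χn n hz hs a - χm n hs ht a) * toA z n s t (x z n))).2
    (by simp [χm_x, χn_x])
  refine ⟨b, ?_⟩
  rw [hb, sub_sub_cancel]
  exact Ideal.mul_mem_left _ _ (x_mem_P n)

theorem p_not_isMaximal [IsLocalRing (R z n s t)] (i : Fin n) : ¬ (p z n s t).IsMaximal := by
  intro h
  obtain ⟨b, hb⟩ := exists_R_eq_y n hz hs ht i.castSucc
  refine y_castSucc_notMem_P (z := z) n hs ht i ?_
  rw [← hb, ← mem_p_iff, IsLocalRing.eq_maximalIdeal h, mem_maximalIdeal_R_iff n hz hs ht, hb,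
    χm_y]

/-- Krull's principal ideal theorem: `p` is minimal over `y_m`. The relation between `x` and `y_m`
would put `x` into any prime of `A` below `P` containing `y_m`. To stay in `R`, everything is
multiplied by some `c = y_i` outside `p`, for which `c A ⊆ R`. -/
theorem p_height_le_one (i : Fin n) : (p z n s t).height ≤ 1 := by
  have := isNoetherianRing_R n hz hs ht
  have hP := isPrime_P z n hs ht
  have hp := isPrime_p (z := z) n hs ht
  obtain ⟨ym, hym⟩ := exists_R_eq_y n hz hs ht (Fin.last n)
  obtain ⟨c, hc⟩ := exists_R_eq_y n hz hs ht i.castSucc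
  refine Ideal.height_le_one_of_isPrincipal_of_mem_minimalPrimes (Ideal.span {ym}) _
    ⟨⟨hp, ?_⟩, ?_⟩
  · rw [Ideal.span_singleton_le_iff_mem, mem_p_iff, hym]
    exact y_last_mem_P n
  · rintro q ⟨hq, hyq⟩ hqp
    rw [Ideal.span_singleton_le_iff_mem] at hyq
    have hcp : c ∉ p z n s t := by
      rw [mem_p_iff, hc]
      exact y_castSucc_notMem_P n hs ht i
    have hcq : c ∉ q := fun h => hcp (hqp h)
    obtain ⟨w, hw⟩ := exists_R_eq_y_mul n hz hs ht i.castSucc (toA z n s t (x z n))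
    obtain ⟨v, hv⟩ := exists_R_eq_y_mul n hz hs ht i.castSucc (toA z n s t (x z n) - 1)
    have hvq : v ∉ q := by
      intro h
      have h1 := mem_p_iff n |>.1 (hqp h)
      rw [hv] at h1
      exact (hP.mem_or_mem h1).elim (y_castSucc_notMem_P n hs ht i) (x_sub_one_notMem_P n hs ht)
    have hwq : w ∈ q := by
      -- The relation times `y_i ^ (t + 1)`: one factor for each of the `t` copies of `x` and one
      -- for `x - 1`.
      have h1 : w ^ t * v = - ym ^ (s - 1) * c ^ (t + 1) * ym := by
        apply algebraMap_R_injective n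
        have h2 : toA z n s t (y z n (Fin.last n)) ^ s = toA z n s t (y z n (Fin.last n)) ^ (s - 1)
            * toA z n s t (y z n (Fin.last n)) := by
          rw [← pow_succ, Nat.sub_add_cancel hs]
        have h3 := toA_relation z n s t
        rw [h2] at h3
        rw [map_mul, map_mul, map_mul, map_pow, map_neg, map_pow, map_pow, hw, hv, hc, hym]
        linear_combination toA z n s t (y z n i.castSucc) ^ (t + 1) * h3
      have h2 : w ^ t * v ∈ q := by
        rw [h1]
        exact Ideal.mul_mem_left _ _ hyq
      exact hq.mem_of_pow_mem t ((hq.mem_or_mem h2).resolve_right hvq)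
    intro a ha
    obtain ⟨b, d, hbd⟩ := Ideal.mem_span_pair.1 ((mem_p_iff n).1 ha)
    obtain ⟨b', hb'⟩ := exists_R_eq_y_mul n hz hs ht i.castSucc b
    obtain ⟨d', hd'⟩ := exists_R_eq_y_mul n hz hs ht i.castSucc d
    have h1 : c ^ 2 * a = b' * w + d' * c * ym := by
      apply algebraMap_R_injective n
      simp only [map_mul, map_add, map_pow, hc, hb', hw, hd', hym]
      linear_combination - toA z n s t (y z n i.castSucc) ^ 2 * hbd
    have h2 : c ^ 2 * a ∈ q := by
      rw [h1]
      exact add_mem (Ideal.mul_mem_left _ _ hwq) (Ideal.mul_mem_left _ _ hyq)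
    exact (hq.mem_or_mem h2).resolve_left fun h => hcq (hq.mem_of_pow_mem 2 h)

theorem p_height (hts : t ≤ s) (h1t : 1 < t) (i : Fin n) : (p z n s t).height = 1 := by
  have := isDomain_R n hz hs ht
  have hp := isPrime_p (z := z) n hs ht
  refine le_antisymm (p_height_le_one n hz hs ht i) ?_
  rw [Order.one_le_iff_ne_zero, ne_eq, Ideal.height_eq_zero_iff_eq_bot]
  intro h
  obtain ⟨ym, hym⟩ := exists_R_eq_y n hz hs ht (Fin.last n)
  have h1 : ym ∈ p z n s t := by
    rw [mem_p_iff, hym]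
    exact y_last_mem_P n
  rw [h, Ideal.mem_bot] at h1
  rw [h1, map_zero, eq_comm] at hym
  exact y_last_ne_zero n hts h1t hym

/-- The projection of `A` onto `A / P = R / p`. -/
theorem exists_projection_quotient_p : ∃ ε : A z n s t →+* R z n s t ⧸ p z n s t,
    (∀ b, ε (algebraMap _ _ b) = Ideal.Quotient.mk _ b) ∧ ∀ a ∈ P z n s t, ε a = 0 := by
  let q : R z n s t ⧸ p z n s t →+* A z n s t ⧸ P z n s t :=
    Ideal.quotientMap (P z n s t) (algebraMap (R z n s t) (A z n s t)) le_rfl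
  have hq : ∀ b, q (Ideal.Quotient.mk _ b) = Ideal.Quotient.mk _ (algebraMap _ _ b) := fun b =>
    Ideal.quotientMap_mk
  have hbij : Function.Bijective q := by
    refine ⟨Ideal.quotientMap_injective' le_rfl, fun a => ?_⟩
    obtain ⟨a, rfl⟩ := Ideal.Quotient.mk_surjective a
    obtain ⟨b, hb⟩ := exists_R_sub_mem_P n hz hs ht a
    exact ⟨Ideal.Quotient.mk _ b, (hq b).trans (Ideal.Quotient.eq.2 hb).symm⟩
  let e := RingEquiv.ofBijective q hbij
  refine ⟨e.symm.toRingHom.comp (Ideal.Quotient.mk (P z n s t)), fun b => ?_, fun a ha => ?_⟩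
  · exact e.symm_apply_eq.2 (hq b).symm
  · change e.symm (Ideal.Quotient.mk _ a) = 0
    rw [Ideal.Quotient.eq_zero_iff_mem.2 ha, map_zero]

/-- Modulo `P` the coordinates `x` and `y_m` of the small branch disappear and `y_1, …, y_n` remain.
Both the reducedness of the completion and the bound on `dim R/p` are read off from this. -/
theorem exists_coordinates_quotient_p : ∃ (b : Fin n → R z n s t ⧸ p z n s t)
    (ψ : R z n s t ⧸ p z n s t →ₐ[K] MvPowerSeries (Fin n) K),
    (∀ a, ∃ c : K, a - algebraMap K _ c ∈ Ideal.span (Set.range b)) ∧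
    ∀ i, ψ (b i) = MvPowerSeries.X i := by
  obtain ⟨ψ, hψ⟩ := exists_redA z n hs ht
  choose c hc using exists_R_eq_y n hz hs ht
  obtain ⟨ε, hε, hεP⟩ := exists_projection_quotient_p n hz hs ht
  refine ⟨fun i => Ideal.Quotient.mk _ (c i.castSucc), Ideal.Quotient.liftₐ (p z n s t)
    (ψ.comp (IsScalarTower.toAlgHom K (R z n s t) (A z n s t)))
    (fun a ha => (mem_P_iff hψ).1 ha), fun a => ?_, fun i => ?_⟩
  · obtain ⟨a, rfl⟩ := Ideal.Quotient.mk_surjective a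
    obtain ⟨d, hd⟩ := exists_sub_mem_span_bm n hz (algebraMap _ (A z n s t) a)
    refine ⟨d, ?_⟩
    have h1 := Ideal.mem_map_of_mem ε hd
    rw [Ideal.map_span, IsScalarTower.algebraMap_apply K (R z n s t) (A z n s t), ← map_sub, hε,
      map_sub] at h1
    refine Ideal.span_le.2 ?_ h1
    rintro _ ⟨_, ⟨_ | i, rfl⟩, rfl⟩
    · change ε (toA z n s t (x z n)) ∈ _
      rw [hεP _ (x_mem_P n)]
      exact zero_mem _
    · change ε (toA z n s t (y z n i)) ∈ _
      induction i using Fin.lastCases with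
      | last =>
        rw [hεP _ (y_last_mem_P n)]
        exact zero_mem _
      | cast i =>
        rw [← hc, hε]
        exact Ideal.subset_span ⟨i, rfl⟩
  · change ψ (algebraMap (R z n s t) (A z n s t) (c i.castSucc)) = _
    rw [hc, hψ, redRm_y_castSucc]

theorem isAnalyticallyUnramifiedIdeal_p [IsLocalRing (R z n s t)] :
    (p z n s t).IsAnalyticallyUnramifiedIdeal := by
  obtain ⟨b, ψ, hL, hψ⟩ := exists_coordinates_quotient_p n hz hs ht
  have := isLocalRing_quotient_p (z := z) n hs ht
  exact ⟨inferInstance, isAnalyticallyUnramified_of_mvPowerSeries ψ hL hψ⟩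

theorem ringKrullDim_quotient_p_le [IsLocalRing (R z n s t)] :
    ringKrullDim (R z n s t ⧸ p z n s t) ≤ n := by
  obtain ⟨b, ψ, hL, hψ⟩ := exists_coordinates_quotient_p n hz hs ht
  have := isLocalRing_quotient_p (z := z) n hs ht
  have := isNoetherianRing_R n hz hs ht
  have h := ringKrullDim_le_of_mvPowerSeries ψ hL hψ
  rwa [Fintype.card_fin] at h

theorem p_height_add_lt [IsLocalRing (R z n s t)] (hr : 1 ≤ r) (hts : t ≤ s) (h1t : 1 < t)
    (i : Fin n) : ((p z n s t).height : WithBot ℕ∞) + ringKrullDim (R z n s t ⧸ p z n s t) <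
      ringKrullDim (R z n s t) := by
  rw [ringKrullDim_R n hz hts h1t, p_height n hz hs ht hts h1t i]
  refine (add_le_add_right (ringKrullDim_quotient_p_le n hz hs ht) _).trans_lt ?_
  exact_mod_cast (show 1 + n < r + n + 1 by omega)

end

end Nagata

/-! ### The multiplicity of `R` -/

namespace Nagata

variable {K : Type*} [Field K] {r : ℕ} {z : Fin r → K⟦X⟧} (n : ℕ) {s t : ℕ}
variable (hz : AlgIndep z) (hs : 0 < s) (ht : 0 < t)

theorem degree_preHilbertPoly (d k : ℕ) : (preHilbertPoly ℚ d k).degree = d := by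
  conv_rhs => rw [← natDegree_preHilbertPoly ℚ d k]
  refine Polynomial.degree_eq_natDegree fun h => ?_
  have h1 := leadingCoeff_preHilbertPoly ℚ d k
  rw [h, Polynomial.leadingCoeff_zero, eq_comm] at h1
  simp [Nat.factorial_ne_zero] at h1

include hz hs ht

/-- `J` is at once the maximal ideal of `R` and an ideal of `A`, and sums of products of its
elements are the same in both rings. Exponent 0 is excluded, since it would compare `R` with `A`. -/
theorem mem_maximalIdeal_R_pow_iff [IsLocalRing (R z n s t)] (k : ℕ) {b : R z n s t} :
    b ∈ IsLocalRing.maximalIdeal (R z n s t) ^ (k + 1) ↔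
      algebraMap _ (A z n s t) b ∈ Ideal.jacobson (⊥ : Ideal (A z n s t)) ^ (k + 1) := by
  have hm := maximalIdeal_R_eq n hz hs ht
  constructor
  · intro h
    refine Ideal.pow_right_mono (Ideal.map_le_iff_le_comap.2 hm.le) _ ?_
    rw [← Ideal.map_pow]
    exact Ideal.mem_map_of_mem _ h
  · have key : ∀ k, ∀ a ∈ Ideal.jacobson (⊥ : Ideal (A z n s t)) ^ (k + 1),
        ∃ b ∈ IsLocalRing.maximalIdeal (R z n s t) ^ (k + 1), algebraMap _ _ b = a := by
      intro k
      induction k with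
      | zero =>
        intro a ha
        rw [zero_add, pow_one] at ha
        obtain ⟨b, rfl⟩ := exists_algebraMap_R_eq_of_mem_jacobson n hz hs ht a ha
        refine ⟨b, ?_, rfl⟩
        rw [zero_add, pow_one, hm]
        exact ha
      | succ k ih =>
        intro a ha
        rw [pow_succ] at ha
        refine Submodule.mul_induction_on ha (fun a ha j hj => ?_) fun a b ha hb => ?_
        · obtain ⟨b, hb, rfl⟩ := ih a ha
          obtain ⟨c, rfl⟩ := exists_algebraMap_R_eq_of_mem_jacobson n hz hs ht j hj
          refine ⟨b * c, ?_, map_mul _ _ _⟩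
          rw [pow_succ]
          refine Ideal.mul_mem_mul hb ?_
          rw [hm]
          exact hj
        · obtain ⟨a', ha', rfl⟩ := ha
          obtain ⟨b', hb', rfl⟩ := hb
          exact ⟨a' + b', add_mem ha' hb', map_add _ _ _⟩
    intro h
    obtain ⟨b', hb', h'⟩ := key k _ h
    exact algebraMap_R_injective n h' ▸ hb'

theorem isCoprime_span_bm_bn :
    IsCoprime (Ideal.span (Set.range (bm z n s t))) (Ideal.span (Set.range (bn z n s t))) := by
  rw [Ideal.isCoprime_iff_exists]
  refine ⟨toA z n s t (x z n), ?_, 1 - toA z n s t (x z n), ?_, by ring⟩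
  · rw [mem_span_bm_iff n hz hs ht, χm_x]
  · rw [mem_span_bn_iff n hz hs, map_sub, map_one, χn_x, sub_self]

theorem jacobson_pow_eq (k : ℕ) : Ideal.jacobson (⊥ : Ideal (A z n s t)) ^ k =
    Ideal.span (Set.range (bm z n s t)) ^ k ⊓ Ideal.span (Set.range (bn z n s t)) ^ k := by
  have h := isCoprime_span_bm_bn n hz hs ht
  have h1 : Ideal.jacobson (⊥ : Ideal (A z n s t)) =
      Ideal.span (Set.range (bm z n s t)) ⊓ Ideal.span (Set.range (bn z n s t)) := by
    ext a
    rw [mem_jacobson_iff n hz hs ht, Ideal.mem_inf, mem_span_bm_iff n hz hs ht,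
      mem_span_bn_iff n hz hs]
  rw [← Ideal.mul_eq_inf_of_coprime (Ideal.isCoprime_iff_sup_eq.1 h.pow), ← mul_pow,
    Ideal.mul_eq_inf_of_coprime (Ideal.isCoprime_iff_sup_eq.1 h), h1]

/-- Counting in the exact sequence `0 → R/J^(k+1) → A/M × A/N → K → 0`, whose last map is the
difference of the residues; `K` accounts for the 1. -/
theorem finite_and_finrank_quotient_maximalIdeal_R_pow [IsLocalRing (R z n s t)] (k : ℕ) :
    Module.Finite K
      (R z n s t ⧸ (IsLocalRing.maximalIdeal (R z n s t) ^ (k + 1)).restrictScalars K) ∧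
    Module.finrank K
      (R z n s t ⧸ (IsLocalRing.maximalIdeal (R z n s t) ^ (k + 1)).restrictScalars K) + 1 =
    Module.finrank K
      (A z n s t ⧸ (Ideal.span (Set.range (bm z n s t)) ^ (k + 1)).restrictScalars K) +
    Module.finrank K
      (A z n s t ⧸ (Ideal.span (Set.range (bn z n s t)) ^ (k + 1)).restrictScalars K) := by
  set M := (Ideal.span (Set.range (bm z n s t)) ^ (k + 1)).restrictScalars K with hM
  set N := (Ideal.span (Set.range (bn z n s t)) ^ (k + 1)).restrictScalars K with hN
  have : Module.Finite K (A z n s t ⧸ M) := finite_quotient_span_bm_pow n hz _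
  have : Module.Finite K (A z n s t ⧸ N) := finite_quotient_span_bn_pow n hz _
  have hMχ : M ≤ LinearMap.ker (χm (z := z) (s := s) (t := t) n hs ht).toLinearMap := fun a ha =>
    (mem_span_bm_iff n hz hs ht).1 (Ideal.pow_le_self k.succ_ne_zero ha)
  have hNχ : N ≤ LinearMap.ker (χn (z := z) (s := s) (t := t) n hz hs).toLinearMap := fun a ha =>
    (mem_span_bn_iff n hz hs).1 (Ideal.pow_le_self k.succ_ne_zero ha)
  let δ : ((A z n s t ⧸ M) × (A z n s t ⧸ N)) →ₗ[K] K :=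
    M.liftQ _ hMχ ∘ₗ LinearMap.fst K _ _ - N.liftQ _ hNχ ∘ₗ LinearMap.snd K _ _
  have hδ : ∀ a b, δ (M.mkQ a, N.mkQ b) = χm n hs ht a - χn n hz hs b := fun a b => rfl
  let ι : R z n s t →ₗ[K] (A z n s t ⧸ M) × (A z n s t ⧸ N) :=
    (M.mkQ.prod N.mkQ) ∘ₗ (IsScalarTower.toAlgHom K (R z n s t) (A z n s t)).toLinearMap
  have hι : ∀ b, ι b = (M.mkQ (algebraMap _ _ b), N.mkQ (algebraMap _ _ b)) := fun b => rfl
  have hker : LinearMap.ker ι =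
      (IsLocalRing.maximalIdeal (R z n s t) ^ (k + 1)).restrictScalars K := by
    ext b
    rw [LinearMap.mem_ker, hι, Prod.mk_eq_zero, Submodule.mkQ_apply, Submodule.mkQ_apply,
      Submodule.Quotient.mk_eq_zero, Submodule.Quotient.mk_eq_zero]
    refine Iff.trans ?_ (mem_maximalIdeal_R_pow_iff n hz hs ht k).symm
    rw [jacobson_pow_eq n hz hs ht]
    rfl
  have hrange : LinearMap.range ι = LinearMap.ker δ := by
    ext ⟨a, b⟩
    obtain ⟨a, rfl⟩ := M.mkQ_surjective a
    obtain ⟨b, rfl⟩ := N.mkQ_surjective b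
    rw [LinearMap.mem_ker, hδ, sub_eq_zero]
    constructor
    · rintro ⟨c, hc⟩
      rw [hι, Prod.mk.injEq] at hc
      have h1 := hδ (algebraMap _ _ c) (algebraMap _ _ c)
      rw [hc.1, hc.2, hδ, χm_algebraMap_R n hz hs ht, sub_self, sub_eq_zero] at h1
      exact h1
    · intro h
      -- Chinese remainder theorem: with `e + g = 1`, the element `a * g + b * e` is `a` modulo `M`
      -- and `b` modulo `N`.
      obtain ⟨e, he, g, hg, heg⟩ := Ideal.isCoprime_iff_exists.1
        ((isCoprime_span_bm_bn (z := z) n hz hs ht).pow (m := k + 1) (n := k + 1))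
      have h1 : a * g + b * e - a ∈ M := by
        have : a * g + b * e - a = (b - a) * e := by linear_combination a * heg
        rw [this]
        exact Ideal.mul_mem_left _ _ he
      have h2 : a * g + b * e - b ∈ N := by
        have : a * g + b * e - b = (a - b) * g := by linear_combination b * heg
        rw [this]
        exact Ideal.mul_mem_left _ _ hg
      have h3 := hMχ h1
      have h4 := hNχ h2
      rw [LinearMap.mem_ker, map_sub, sub_eq_zero] at h3 h4
      obtain ⟨c, hc⟩ := (exists_algebraMap_R_eq_iff n hz hs ht).2
        ((h3.trans h).trans h4.symm : χm n hs ht (a * g + b * e) = χn n hz hs (a * g + b * e))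
      refine ⟨c, ?_⟩
      rw [hι, hc, Prod.mk.injEq]
      exact ⟨(Submodule.Quotient.eq _).2 h1, (Submodule.Quotient.eq _).2 h2⟩
  have hsurj : LinearMap.range δ = ⊤ := by
    rw [LinearMap.range_eq_top]
    intro c
    exact ⟨(M.mkQ (algebraMap K _ c), N.mkQ 0), by rw [hδ]; simp⟩
  let e := (Submodule.quotEquivOfEq _ _ hker.symm).trans
    (ι.quotKerEquivRange.trans (LinearEquiv.ofEq _ _ hrange))
  refine ⟨Module.Finite.equiv e.symm, ?_⟩
  rw [e.finrank_eq, ← Module.finrank_prod, ← LinearMap.finrank_range_add_finrank_ker δ, hsurj,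
    finrank_top, Module.finrank_self, add_comm]

omit hs in
theorem hasMultiplicity_R [IsLocalRing (R z n s t)] (hr : 1 ≤ r) (hts : t ≤ s) (h1t : 1 < t) :
    HasMultiplicity (R z n s t) 1 := by
  have hs : 0 < s := by omega
  -- The small branch and the `-1`. The two polynomials of degree `n + 2` share their leading
  -- coefficient, so the degree drops below `n + 2 ≤ r + n + 1`.
  let Q : ℚ[X] := preHilbertPoly ℚ (n + 2) 0 - preHilbertPoly ℚ (n + 2) t - 1
  have hD := degree_preHilbertPoly
  have hQ : Q.degree < (preHilbertPoly ℚ (r + n + 1) 0).degree := by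
    refine (Polynomial.degree_sub_le _ _).trans_lt (max_lt ?_ ?_)
    · refine (Polynomial.degree_sub_lt_left ?_ ?_ ?_).trans_le ?_
      · rw [hD, hD]
      · exact Polynomial.ne_zero_of_degree_gt (n := ⊥) (by rw [hD]; exact WithBot.bot_lt_coe _)
      · rw [leadingCoeff_preHilbertPoly, leadingCoeff_preHilbertPoly]
      · rw [hD, hD]
        exact_mod_cast (by omega : n + 2 ≤ r + n + 1)
    · rw [hD, Polynomial.degree_one]
      exact_mod_cast (by omega : 0 < r + n + 1)
  refine ⟨r + n + 1, preHilbertPoly ℚ (r + n + 1) 0 + Q, ?_, ?_, ?_, ?_⟩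
  · rw [Module.supportDim_self_eq_ringKrullDim, ringKrullDim_R n hz hts h1t]
  · rw [Polynomial.degree_add_eq_left_of_degree_lt hQ, hD]
  · rw [Polynomial.leadingCoeff_add_of_degree_lt' hQ, leadingCoeff_preHilbertPoly]
    simp [Nat.factorial_ne_zero]
  · filter_upwards [Filter.eventually_ge_atTop t] with k hk
    obtain ⟨h1, h2⟩ := finite_and_finrank_quotient_maximalIdeal_R_pow (z := z) n hz hs ht k
    refine ⟨_, IsLocalRing.length_quotient_maximalIdeal_pow
      (exists_sub_mem_maximalIdeal_R n hz hs ht) (k + 1) h1, ?_⟩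
    have h3 := finrank_quotient_span_bm_pow n hz ht hts hk
    have h4 := finrank_quotient_span_bn_pow n hz (s := s) (t := t) (by omega)
      (show 1 ≤ k by omega)
    -- Pascal's rule: the large branch, of order 1, has the Hilbert function of a regular ring of
    -- dimension `r + n + 1`.
    have h5 : (k + (r + n + 2)).choose (r + n + 2) =
        (k + (r + n + 1)).choose (r + n + 1) + (k - 1 + (r + n + 2)).choose (r + n + 2) := by
      rw [← add_assoc, show k - 1 + (r + n + 2) = k + (r + n + 1) by omega]
      exact Nat.choose_succ_succ _ _
    rw [Polynomial.eval_add, Polynomial.eval_sub, Polynomial.eval_sub, Polynomial.eval_one,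
      preHilbertPoly_eq_choose_sub_add ℚ _ (Nat.zero_le k),
      preHilbertPoly_eq_choose_sub_add ℚ _ (Nat.zero_le k),
      preHilbertPoly_eq_choose_sub_add ℚ _ hk, Nat.sub_zero]
    have h6 : (Module.finrank K (R z n s t ⧸
        (IsLocalRing.maximalIdeal (R z n s t) ^ (k + 1)).restrictScalars K)) + 1 +
        (k - t + (n + 2)).choose (n + 2) = (k + (n + 2)).choose (n + 2) +
        (k + (r + n + 1)).choose (r + n + 1) := by omega
    have h7 := congrArg (Nat.cast (R := ℚ)) h6
    push_cast at h7
    linear_combination h7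

end Nagata

/-! ### The multiplicity of `R_p` -/

/-- The multiplicity of the local ring of a plane curve is the order of its equation. -/
theorem hasMultiplicity_of_mvPowerSeries_fin_two {κ L : Type*} [Field κ] [CommRing L]
    [IsLocalRing L] [Algebra κ L] {b : Fin 2 → L} {F : MvPolynomial (Fin 2) κ}
    (Φ : L →ₐ[κ] MvPowerSeries (Fin 2) κ ⧸ Ideal.span {(F : MvPowerSeries (Fin 2) κ)})
    (hL : ∀ a : L, ∃ c : κ, a - algebraMap κ L c ∈ Ideal.span (Set.range b))
    (hF : MvPolynomial.aeval b F = 0)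
    (hΦ : ∀ i, Φ (b i) = Ideal.Quotient.mk _ (MvPowerSeries.X i))
    (hb : ∀ i, b i ∈ IsLocalRing.maximalIdeal L) {t : ℕ} (ht : 0 < t)
    (hFt : (F : MvPowerSeries (Fin 2) κ).order = t) (hdim : ringKrullDim L = 1) :
    HasMultiplicity L t := by
  have hm : IsLocalRing.maximalIdeal L = Ideal.span (Set.range b) := by
    refine IsLocalRing.maximalIdeal_eq_of_forall_exists_sub_mem (fun h => ?_) hL
    refine (IsLocalRing.maximalIdeal.isMaximal L).ne_top (top_le_iff.1 ?_)
    rw [← h, Ideal.span_le]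
    rintro _ ⟨i, rfl⟩
    exact hb i
  have ht' : (t : ℚ) ≠ 0 := by exact_mod_cast ht.ne'
  -- This is `(k+2 choose 2) - (k-t+2 choose 2)` expanded in `k`.
  refine ⟨1, Polynomial.C (t : ℚ) * Polynomial.X + Polynomial.C ((3 * (t : ℚ) - (t : ℚ) ^ 2) / 2), ?_,
    Polynomial.degree_linear ht', ?_, ?_⟩
  · rw [Module.supportDim_self_eq_ringKrullDim, hdim]
    rfl
  · rw [Polynomial.leadingCoeff_linear ht']
    simp
  · filter_upwards [Filter.eventually_ge_atTop t] with k hk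
    have hfin := finite_quotient_span_range_pow Φ hL hF hΦ (k + 1)
    have h1 := finrank_quotient_span_range_pow Φ hL hF hΦ hFt hk
    rw [← hm] at hfin h1 hL
    refine ⟨_, IsLocalRing.length_quotient_maximalIdeal_pow hL (k + 1) hfin, ?_⟩
    obtain ⟨l, rfl⟩ := Nat.exists_eq_add_of_le hk
    rw [Fintype.card_fin, Nat.add_sub_cancel_left] at h1
    have h2 := congrArg (Nat.cast (R := ℚ)) h1
    rw [Nat.cast_add, Nat.cast_choose_two, Nat.cast_choose_two] at h2
    simp only [Polynomial.eval_add, Polynomial.eval_mul, Polynomial.eval_C, Polynomial.eval_X]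
    push_cast at h2 ⊢
    linear_combination h2

/-- `c` carries `A` into `R`, so `a ↦ (c a) / c` makes sense wherever `c` is invertible. It serves
to identify `A_P` with `R_p`. -/
theorem exists_ringHom_of_conductor {R A L : Type*} [CommRing R] [CommRing A] [CommRing L]
    [Algebra R A] [Algebra R L] (hinj : Function.Injective (algebraMap R A)) {c : R}
    (hc : IsUnit (algebraMap R L c)) (h : ∀ a : A, ∃ b : R, algebraMap R A b = algebraMap R A c * a) :
    ∃ α : A →+* L, ∀ b, α (algebraMap R A b) = algebraMap R L b := by
  choose β hβ using h
  obtain ⟨u, hu⟩ := hc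
  have h0 : β 0 = 0 := hinj (by rw [hβ, mul_zero, map_zero])
  have h1 : ∀ b, β (algebraMap R A b) = c * b := fun b => hinj (by rw [hβ, map_mul])
  have hadd : ∀ a a', β (a + a') = β a + β a' := fun a a' =>
    hinj (by rw [hβ, map_add, hβ, hβ, mul_add])
  have hmul : ∀ a a', c * β (a * a') = β a * β a' := fun a a' =>
    hinj (by rw [map_mul, map_mul, hβ, hβ, hβ]; ring)
  refine ⟨{ toFun := fun a => ↑u⁻¹ * algebraMap R L (β a), map_one' := ?_, map_mul' := ?_,
            map_zero' := ?_, map_add' := ?_ }, fun b => ?_⟩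
  · rw [← map_one (algebraMap R A), h1, mul_one, ← hu, Units.inv_mul]
  · intro a a'
    rw [Units.inv_mul_eq_iff_eq_mul]
    refine u.isUnit.mul_left_cancel ?_
    have h2 := congrArg (algebraMap R L) (hmul a a')
    rw [map_mul, map_mul, ← hu] at h2
    rw [h2]
    linear_combination - (algebraMap R L (β a) * algebraMap R L (β a')) *
      ((u : L) * ↑u⁻¹ + 1) * u.mul_inv
  · rw [h0, map_zero, mul_zero]
  · intro a a'
    rw [hadd, map_add, mul_add]
  · change ↑u⁻¹ * algebraMap R L (β (algebraMap R A b)) = _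
    rw [h1, map_mul, ← hu, Units.inv_mul_cancel_left]

namespace Nagata

variable {K : Type*} [Field K] {r : ℕ} {z : Fin r → K⟦X⟧} (n : ℕ) {s t : ℕ}
variable (hz : AlgIndep z) (hs : 0 < s) (ht : 0 < t) [(p z n s t).IsPrime]

include hz hs ht

/-- The map from `A` to `A_P = R_p`. -/
theorem exists_ringHom_localization_p (i : Fin n) :
    ∃ α : A z n s t →+* Localization.AtPrime (p z n s t),
      (∀ b, α (algebraMap (R z n s t) _ b) = algebraMap _ _ b) ∧ (∀ a, a ∉ P z n s t → IsUnit (α a)) ∧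
      (∀ a ∈ P z n s t, α a ∈ IsLocalRing.maximalIdeal (Localization.AtPrime (p z n s t))) ∧
      ∀ l, ∃ v g : Rm z n, v ∉ PRm z n ∧ l * α (toA z n s t v) = α (toA z n s t g) := by
  have hP := isPrime_P z n hs ht
  obtain ⟨c, hc⟩ := exists_R_eq_y n hz hs ht i.castSucc
  have hcP := y_castSucc_notMem_P (z := z) n hs ht i
  have hunit : ∀ b : R z n s t, algebraMap _ (A z n s t) b ∉ P z n s t →
      IsUnit (algebraMap _ (Localization.AtPrime (p z n s t)) b) := fun b hb =>
    IsLocalization.map_units _ (⟨b, hb⟩ : (p z n s t).primeCompl)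
  have hcu := hunit c (hc ▸ hcP)
  have hcond : ∀ a : A z n s t, ∃ b : R z n s t, algebraMap _ _ b = algebraMap _ _ c * a := by
    intro a
    rw [hc]
    exact exists_R_eq_y_mul n hz hs ht i.castSucc a
  obtain ⟨α, hα⟩ := exists_ringHom_of_conductor (algebraMap_R_injective n) hcu hcond
  have hαu : ∀ a, a ∉ P z n s t → IsUnit (α a) := by
    intro a ha
    obtain ⟨b, hb⟩ := hcond a
    have h1 : IsUnit (α (algebraMap _ _ b)) := by
      rw [hα]
      refine hunit b ?_
      rw [hb, hc]
      exact fun h => (hP.mem_or_mem h).elim hcP ha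
    rw [hb, map_mul] at h1
    exact isUnit_of_mul_isUnit_right h1
  refine ⟨α, hα, hαu, fun a ha => ?_, fun l => ?_⟩
  · obtain ⟨b, hb⟩ := hcond a
    have h1 : α (algebraMap _ _ b) ∈
        IsLocalRing.maximalIdeal (Localization.AtPrime (p z n s t)) := by
      rw [hα, IsLocalization.AtPrime.to_map_mem_maximal_iff _ (p z n s t), mem_p_iff, hb]
      exact Ideal.mul_mem_left _ _ ha
    rw [hb, map_mul] at h1
    refine (Ideal.unit_mul_mem_iff_mem _ ?_).1 h1
    rwa [hα]
  · obtain ⟨b, w, rfl⟩ := IsLocalization.exists_mk'_eq (p z n s t).primeCompl l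
    obtain ⟨u, hu, g, hg⟩ := exists_toA_mul_eq z n s t (algebraMap _ _ b)
    obtain ⟨v, hv, h, hh⟩ := exists_toA_mul_eq z n s t (algebraMap _ _ (w : R z n s t))
    have hS : ∀ u ∈ S z n, toA z n s t u ∉ P z n s t := fun u hu h =>
      hP.ne_top (Ideal.eq_top_of_isUnit_mem _ h (isUnit_toA z n s t hu))
    -- From `l = b / w` with `b = g / u` and `w = h / v`.
    refine ⟨h * u, g * v, ?_, ?_⟩
    · rw [← toA_mem_P_iff z n hs ht, map_mul, ← hh]
      exact fun h => (hP.mem_or_mem h).elim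
        (fun h => (hP.mem_or_mem h).elim (hS v hv) w.2) (hS u hu)
    · have h1 := IsLocalization.mk'_spec (Localization.AtPrime (p z n s t)) b w
      rw [← hα, ← hα] at h1
      rw [map_mul, map_mul, map_mul, map_mul, ← hg, ← hh, map_mul, map_mul]
      linear_combination α (toA z n s t v) * α (toA z n s t u) * h1

theorem ringKrullDim_localization_p (hts : t ≤ s) (h1t : 1 < t) (i : Fin n) :
    ringKrullDim (Localization.AtPrime (p z n s t)) = 1 := by
  rw [IsLocalization.AtPrime.ringKrullDim_eq_height (p z n s t), p_height n hz hs ht hts h1t i]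
  rfl

omit hs in
-- Nonzero polynomials in `y_1, …, y_n` avoid `P`, so `R_p` contains the field `K(y_1, …, y_n)`.
-- Over it `x` and `y_m` are coordinates of a plane curve of order `t`.
theorem hasMultiplicity_localization_p (hts : t ≤ s) (h1t : 1 < t) (i : Fin n) :
    HasMultiplicity (Localization.AtPrime (p z n s t)) t := by
  have hs : 0 < s := by omega
  obtain ⟨α, hα, hαu, hαP, hαl⟩ := exists_ringHom_localization_p n hz hs ht i
  obtain ⟨Φ, hΦx, hΦy, hΦq, hΦu⟩ := exists_ΦP (z := z) n (s := s) (t := t)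
  let γ₀ : MvPolynomial (Fin n) K →+* Localization.AtPrime (p z n s t) :=
    (α.comp (toA z n s t)).comp (ofPolyY z n).toRingHom
  have hγ₀ : ∀ q : nonZeroDivisors (MvPolynomial (Fin n) K), IsUnit (γ₀ q) := by
    rintro ⟨q, hq⟩
    refine hαu _ ?_
    rw [toA_mem_P_iff z n hs ht, mem_PRm_iff]
    change redRm z n (ofPolyY z n q) ≠ 0
    rw [redRm_ofPolyY, ne_eq, MvPolynomial.coe_eq_zero_iff]
    exact nonZeroDivisors.ne_zero hq
  let γ : kP K n →+* Localization.AtPrime (p z n s t) := IsLocalization.lift hγ₀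
  have hγ : ∀ q, γ (algebraMap _ _ q) = α (toA z n s t (ofPolyY z n q)) :=
    IsLocalization.lift_eq hγ₀
  algebraize [γ]
  have hΦp : ∀ b : (p z n s t).primeCompl,
      IsUnit ((Φ.toRingHom.comp (algebraMap (R z n s t) (A z n s t))) b) := fun b => hΦu _ b.2
  let Ψ₀ : Localization.AtPrime (p z n s t) →+* _ := IsLocalization.lift hΦp
  have hΨ₀ : ∀ b : R z n s t, Ψ₀ (algebraMap _ _ b) = Φ (algebraMap _ _ b) :=
    IsLocalization.lift_eq hΦp
  -- Both sides agree on `R`; a general `a` enters `R` after multiplication by `y_i`, whose image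
  -- under `Φ` is a unit.
  have hΨα : ∀ a, Ψ₀ (α a) = Φ a := by
    intro a
    obtain ⟨c, hc⟩ := exists_R_eq_y n hz hs ht i.castSucc
    obtain ⟨b, hb⟩ := exists_R_eq_y_mul n hz hs ht i.castSucc a
    have h1 := hΨ₀ b
    rw [← hα, hb, map_mul, map_mul, map_mul, ← hc, hα, hΨ₀] at h1
    refine (hΦu _ ?_).mul_left_cancel h1
    rw [hc]
    exact y_castSucc_notMem_P n hs ht i
  have hΨγ : Ψ₀.comp γ = algebraMap (kP K n) _ := by
    refine IsLocalization.ringHom_ext (nonZeroDivisors (MvPolynomial (Fin n) K))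
      (RingHom.ext fun q => ?_)
    change Ψ₀ (γ (algebraMap _ _ q)) = _
    rw [hγ, hΨα, hΦq]
    rfl
  let Ψ : Localization.AtPrime (p z n s t) →ₐ[kP K n] _ :=
    { Ψ₀ with commutes' := fun c => RingHom.congr_fun hΨγ c }
  let b : Fin 2 → Localization.AtPrime (p z n s t) :=
    ![α (toA z n s t (x z n)), α (toA z n s t (y z n (Fin.last n)))]
  have hspan : ∀ g ∈ PRm z n, α (toA z n s t g) ∈ Ideal.span (Set.range b) := by
    intro g hg
    obtain ⟨a, d, rfl⟩ := Ideal.mem_span_pair.1 hg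
    rw [map_add, map_add, map_mul, map_mul, map_mul, map_mul]
    exact add_mem (Ideal.mul_mem_left _ _ (Ideal.subset_span ⟨0, rfl⟩))
      (Ideal.mul_mem_left _ _ (Ideal.subset_span ⟨1, rfl⟩))
  refine hasMultiplicity_of_mvPowerSeries_fin_two (b := b) (F := eqm (kP K n) 0 1 s t) Ψ
    (fun l => ?_) ?_ ?_ ?_ ht (order_eqm (by simp) ht hts)
    (ringKrullDim_localization_p n hz hs ht hts h1t i)
  · obtain ⟨v, g, hv, hvg⟩ := hαl l
    obtain ⟨q, hq⟩ := exists_sub_ofPolyY_mem_PRm z n v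
    obtain ⟨q', hq'⟩ := exists_sub_ofPolyY_mem_PRm z n g
    have hq0 : algebraMap _ (kP K n) q ≠ 0 := by
      intro h
      have : q = 0 := IsFractionRing.injective (MvPolynomial (Fin n) K) (kP K n)
        (h.trans (map_zero (algebraMap (MvPolynomial (Fin n) K) (kP K n))).symm)
      exact hv (by simpa [this] using hq)
    -- `q'` and `q` are the residues of numerator and denominator of `l` modulo `(x, y_m)`.
    refine ⟨algebraMap _ _ q' / algebraMap _ _ q, ?_⟩
    change l - γ _ ∈ _
    have h1 : γ (algebraMap _ _ q) * γ (algebraMap _ _ q' / algebraMap _ _ q) =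
        γ (algebraMap _ _ q') := by
      rw [← map_mul, mul_div_cancel₀ _ hq0]
    rw [hγ, hγ] at h1
    refine (Ideal.unit_mul_mem_iff_mem _ (hαu _ ((toA_mem_P_iff z n hs ht).not.2 hv))).1 ?_
    have h2 := hspan _ hq
    have h3 := hspan _ hq'
    rw [map_sub, map_sub] at h2 h3
    have h4 : α (toA z n s t v) * (l - γ (algebraMap _ _ q' / algebraMap _ _ q)) =
        (α (toA z n s t g) - α (toA z n s t (ofPolyY z n q'))) -
        γ (algebraMap _ _ q' / algebraMap _ _ q) *
          (α (toA z n s t v) - α (toA z n s t (ofPolyY z n q))) := by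
      linear_combination hvg - h1
    rw [h4]
    exact sub_mem h3 (Ideal.mul_mem_left _ _ h2)
  · have h := congrArg α (toA_relation z n s t)
    simpa [eqm, b] using h
  · intro i
    fin_cases i
    · exact (hΨα _).trans hΦx
    · exact (hΨα _).trans hΦy
  · intro i
    fin_cases i
    · exact hαP _ (x_mem_P n)
    · exact hαP _ (y_last_mem_P n)

end Nagata

/-! ### The main theorem. -/

theorem mainTheorem4 (K : Type*) [Field K] (r : ℕ) (hr : 1 ≤ r) :
    (∃ z : Fin r → PowerSeries K, Nagata.AlgIndep z) ∧
    ∀ z : Fin r → PowerSeries K, Nagata.AlgIndep z →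
    ∀ n s t : ℕ, 1 ≤ n → t ≤ s → 1 < t →
      IsDomain (Nagata.A z n s t) ∧
      Module.Finite (Nagata.R z n s t) (Nagata.A z n s t) ∧
      IsNoetherianRing (Nagata.R z n s t) ∧
      IsDomain (Nagata.R z n s t) ∧
      ∃ _ : IsLocalRing (Nagata.R z n s t),
        IsLocalRing.maximalIdeal (Nagata.R z n s t) =
          (Ideal.jacobson (⊥ : Ideal (Nagata.A z n s t))).comap
            (algebraMap (Nagata.R z n s t) (Nagata.A z n s t)) ∧
        Function.Bijective (algebraMap K (IsLocalRing.ResidueField (Nagata.R z n s t))) ∧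
        ¬ IsCatenaryRing (Nagata.R z n s t) ∧
        HasMultiplicity (Nagata.R z n s t) 1 ∧
        (Nagata.P z n s t).IsPrime ∧
        ∃ _ : (Nagata.p z n s t).IsPrime,
          ¬ (Nagata.p z n s t).IsMaximal ∧
          (Nagata.p z n s t).IsAnalyticallyUnramifiedIdeal ∧
          ((Nagata.p z n s t).height : WithBot ℕ∞) +
              ringKrullDim (Nagata.R z n s t ⧸ Nagata.p z n s t) ≠
            ringKrullDim (Nagata.R z n s t) ∧
          HasMultiplicity (Localization.AtPrime (Nagata.p z n s t)) t := by
  refine ⟨?_, fun z hz n s t hn hts h1t => ?_⟩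
  · obtain ⟨z, hz⟩ := exists_algebraicIndependent_polynomial K r
    exact ⟨z, hz.algIndep⟩
  have ht : 0 < t := by omega
  have hs : 0 < s := by omega
  have hdom := Nagata.isDomain_R n hz hs ht
  have hnoeth := Nagata.isNoetherianRing_R n hz hs ht
  have hloc := Nagata.isLocalRing_R n hz hs ht
  have hp := Nagata.isPrime_p (z := z) n hs ht
  -- One strict inequality yields both the failure of the dimension formula at `p` and the failure
  -- of `R` to be catenary. The index `⟨0, hn⟩` is `y_1`, available since `m ≥ 2`.
  have hlt := Nagata.p_height_add_lt n hz hs ht hr hts h1t ⟨0, hn⟩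
  exact ⟨Nagata.isDomain_A n hz hs ht, Nagata.finite_R_A n hz hs ht, hnoeth, hdom, hloc,
    Nagata.maximalIdeal_R_eq n hz hs ht, Nagata.bijective_algebraMap_residueField n hz hs ht,
    not_isCatenaryRing_of_height_add_lt _ hlt, Nagata.hasMultiplicity_R n hz ht hr hts h1t,
    Nagata.isPrime_P z n hs ht, hp, Nagata.p_not_isMaximal n hz hs ht ⟨0, hn⟩,
    Nagata.isAnalyticallyUnramifiedIdeal_p n hz hs ht, hlt.ne,
    Nagata.hasMultiplicity_localization_p n hz ht hts h1t ⟨0, hn⟩⟩
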